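/- Let $(Y,\mathcal A)$ be a measurable space, $\mathcal P(Y,\mathcal A)$ its set of probability measures, and $\mathcal W\subset\mathcal P(Y,\mathcal A)$ a non-empty set. Let $\mathcal P(\mathcal W)$ be the set of probability mass functions $P$ on $\mathcal W$ with finite support. For $P\in\mathcal P(\mathcal W)$ and $\alpha\in[0,\infty]$ let $\mu_{\alpha,P}$ be the measure whose density with respect to any measure $\nu$ dominating all $W$ with $P(W)>0$ is $\big(\sum_W P(W)(\tfrac{dW}{d\nu})^\alpha\big)^{1/\alpha}$ for $0<\alpha<\infty$, $\prod_{W:P(W)>0}(\tfrac{dW}{d\nu})^{P(W)}$ for $\alpha=0$ and $\max_{W:P(W)>0}\tfrac{dW}{d\nu}$ for $\alpha=\infty$; $\|\mu\|$ denotes the total mass of $\mu$. For $\alpha\in(0,\infty]$ the Rényi information is $I_\alpha(P)=\frac{\alpha}{\alpha-1}\ln\|\mu_{\alpha,P}\|$ if $\alpha\ne1,\infty$, $I_\infty(P)=\ln\|\mu_{\infty,P}\|$, and $I_1(P)=\sum_W P(W)\int \frac{dW}{d\mu_{1,P}}\ln\frac{dW}{d\mu_{1,P}}\,d\mu_{1,P}$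 (the mutual information), and the Rényi capacity is $C_\alpha(\mathcal W)=\sup_{P\in\mathcal P(\mathcal W)}I_\alpha(P)\in[0,\infty]$. Let $D_\alpha(W\|Q)$ be the order $\alpha$ Rényi divergence. An order $\alpha$ Rényi center of $\mathcal W$ is a $q\in\mathcal P(Y,\mathcal A)$ with $\sup_{W\in\mathcal W}D_\alpha(W\|q)=C_\alpha(\mathcal W)$. A set $\mathcal S$ of finite measures is uniformly absolutely continuous with respect to $\nu$ (written $\mathcal S\prec^{uni}\nu$) if for every $\epsilon>0$ there is $\delta>0$ such that $\mu(E)<\epsilon$ for all $\mu\in\mathcal S$ and all $E\in\mathcal A$ with $\nu(E)<\delta$. On the space of finite signed measures on $(Y,\mathcal A)$, the topology of setwise convergence is the one generated by the maps $\mu\mapsto\mu(E)$, $E\in\mathcal A$, and the weak topology is the one generated by all linear functionals that are continuous for the total variation norm. A set is relatively compact if its closure is compact. Then: (a) $C_\alpha(\operatorname{ch}\mathcal W)=C_\alpha(\mathcal W)$ for all $\alpha\in(0,\infty]$, where $\operatorname{ch}\mathcal W=\{\mu_{1,P}:P\in\mathcal P(\mathcal W)\}$ is the convex hull of $\mathcal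 W$. (b) $C_\alpha(\operatorname{cl}\mathcal W)=C_\alpha(\mathcal W)$ for all $\alpha\in(0,\infty]$, where $\operatorname{cl}\mathcal W$ is the closure of $\mathcal W$ in the topology of setwise convergence, or in any stronger topology, on $\mathcal P(Y,\mathcal A)$. (c) If $C_\vartheta(\mathcal W)<\infty$ for some $\vartheta\in[1,\infty]$, then $\mathcal W$ has a unique order $\vartheta$ Rényi center $q_{\vartheta,\mathcal W}$, and the set $\{\mu_{\alpha,P}:\alpha\in[0,\vartheta],\ P\in\mathcal P(\mathcal W)\}$ is uniformly absolutely continuous with respect to $q_{\vartheta,\mathcal W}$ and relatively compact both in the topology of setwise convergence and in the weak topology. (d) The following four statements are equivalent: (i) $\lim_{\alpha\uparrow1}\frac{1-\alpha}{\alpha}C_\alpha(\mathcal W)=0$; (ii) there is a $\nu\in\mathcal P(Y,\mathcal A)$ with $\mathcal W\prec^{uni}\nu$; (iii) $\mathcal W$ has compact closure in the topology of setwise convergence; (iv) $\mathcal W$ has compact closure in the weak topology. -/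

import Mathlib

open MeasureTheory Set Filter Topology
open scoped NNReal ENNReal

noncomputable section

namespace Renyi

/-- Probability mass functions on `A` with finite support: nonnegative weights supported on
finitely many elements of `A` and summing to one. -/
def pmfs {X : Type*} (A : Set X) : Set (X →₀ ℝ≥0) :=
  {P | (P.support : Set X) ⊆ A ∧ P.sum (fun _ r => r) = 1}

variable {Y : Type*} [MeasurableSpace Y]

/-! ### Mean measures -/

/-- The mixture `∑ P(W) W`, used as the reference measure for the members of the support of `P`.
(The mean measures do not depend on the choice of the reference measure.) -/
def refMeasure (P : ProbabilityMeasure Y →₀ ℝ≥0) : Measure Y :=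
  ∑ W ∈ P.support, P W • (W : Measure Y)

instance (P : ProbabilityMeasure Y →₀ ℝ≥0) : IsFiniteMeasure (refMeasure P) := by
  unfold refMeasure; infer_instance

/-- The order `α` weighted power mean of the values `g W`, `W ∈ supp P`, for the weights `P W`. -/
def powerMean {X : Type*} (α : ℝ≥0∞) (P : X →₀ ℝ≥0) (g : X → ℝ≥0∞) : ℝ≥0∞ :=
  if α = 0 then ∏ W ∈ P.support, g W ^ (P W : ℝ)
  else if α = ⊤ then ⨆ W ∈ P.support, g W
  else (∑ W ∈ P.support, (P W : ℝ≥0∞) * g W ^ α.toReal) ^ (1 / α.toReal)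

/-- The order `α` mean of the Radon–Nikodym derivatives for the prior `P`. -/
def meanDensity (α : ℝ≥0∞) (P : ProbabilityMeasure Y →₀ ℝ≥0) (y : Y) : ℝ≥0∞ :=
  powerMean α P (fun W => (W : Measure Y).rnDeriv (refMeasure P) y)

theorem powerMean_mono {X : Type*} (α : ℝ≥0∞) (P : X →₀ ℝ≥0) {g h : X → ℝ≥0∞}
    (hgh : ∀ W ∈ P.support, g W ≤ h W) : powerMean α P g ≤ powerMean α P h := by
  unfold powerMean
  split_ifs with h0 h1
  · exact Finset.prod_le_prod' fun W hW => ENNReal.rpow_le_rpow (hgh W hW) (by positivity)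
  · exact iSup₂_mono hgh
  · refine ENNReal.rpow_le_rpow (Finset.sum_le_sum fun W hW => ?_) (by positivity)
    gcongr
    exact hgh W hW

theorem powerMean_lt_top {X : Type*} (α : ℝ≥0∞) (P : X →₀ ℝ≥0) {g : X → ℝ≥0∞}
    (hg : ∀ W ∈ P.support, g W < ⊤) : powerMean α P g < ⊤ := by
  unfold powerMean
  split_ifs with h0 h1
  · exact ENNReal.prod_lt_top fun W hW =>
      ENNReal.rpow_lt_top_of_nonneg (by positivity) (hg W hW).ne
  · rw [← Finset.sup_eq_iSup]
    exact (Finset.sup_lt_iff (by simp)).2 hg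
  · refine ENNReal.rpow_lt_top_of_nonneg (by positivity) (ENNReal.sum_lt_top.2 fun W hW => ?_).ne
    exact ENNReal.mul_lt_top ENNReal.coe_lt_top
      (ENNReal.rpow_lt_top_of_nonneg (by positivity) (hg W hW).ne)

theorem rnDeriv_refMeasure_le (P : ProbabilityMeasure Y →₀ ℝ≥0) {W : ProbabilityMeasure Y}
    (hW : W ∈ P.support) :
    ∀ᵐ y ∂(refMeasure P), (W : Measure Y).rnDeriv (refMeasure P) y ≤ (P W : ℝ≥0∞)⁻¹ := by
  have hle : P W • (W : Measure Y) ≤ refMeasure P := by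
    unfold refMeasure
    exact Finset.single_le_sum (f := fun V => P V • ((V : ProbabilityMeasure Y) : Measure Y))
      (fun V _ => Measure.zero_le _) hW
  have h1 := Measure.rnDeriv_le_one_of_le hle
  have h2 := Measure.rnDeriv_smul_left (W : Measure Y) (refMeasure P) (P W)
  filter_upwards [h1, h2] with y hy1 hy2
  rw [hy2] at hy1
  rw [ENNReal.le_inv_iff_mul_le, mul_comm]
  simpa [ENNReal.smul_def] using hy1

/-- The order `α` mean measure for the prior `P`. -/
def meanMeasure (α : ℝ≥0∞) (P : ProbabilityMeasure Y →₀ ℝ≥0) : FiniteMeasure Y :=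
  ⟨(refMeasure P).withDensity (meanDensity α P), by
    have hfin : powerMean α P (fun W => (P W : ℝ≥0∞)⁻¹) < ⊤ :=
      powerMean_lt_top α P fun W hW => by
        have := Finsupp.mem_support_iff.1 hW
        simpa [pos_iff_ne_zero] using this
    have hae : ∀ᵐ y ∂(refMeasure P),
        meanDensity α P y ≤ powerMean α P (fun W => (P W : ℝ≥0∞)⁻¹) := by
      have := (Finset.eventually_all P.support).2 fun W hW => rnDeriv_refMeasure_le P hW
      filter_upwards [this] with y hy
      exact powerMean_mono α P hy
    refine isFiniteMeasure_withDensity (ne_of_lt ((lintegral_mono_ae hae).trans_lt ?_))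
    rw [lintegral_const]
    exact ENNReal.mul_lt_top hfin (measure_lt_top _ _)⟩

/-- The order one posterior `p₁(W|y) = P(W) dW/dμ_{1,P}(y)`. -/
def posterior (P : ProbabilityMeasure Y →₀ ℝ≥0) (W : ProbabilityMeasure Y) (y : Y) : ℝ :=
  P W * ((W : Measure Y).rnDeriv (meanMeasure 1 P : Measure Y) y).toReal

/-! ### Rényi information, capacity, divergence and center -/

open Classical in
/-- The order `α` Rényi information for the prior `P`. -/
def information (α : ℝ≥0∞) (P : ProbabilityMeasure Y →₀ ℝ≥0) : ℝ :=
  if α = 0 then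
    essInf (fun y => Real.log (1 / ∑ W ∈ P.support, if 0 < posterior P W y then (P W : ℝ) else 0))
      (meanMeasure 1 P : Measure Y)
  else if α = ⊤ then Real.log (meanMeasure ⊤ P).mass
  else if α = 1 then
    ∫ y, ∑ W ∈ P.support, posterior P W y * Real.log (posterior P W y / P W)
      ∂(meanMeasure 1 P : Measure Y)
  else α.toReal / (α.toReal - 1) * Real.log (meanMeasure α P).mass

/-- The order `α` Rényi capacity: the supremum of the Rényi information over all priors on `𝒲`. -/
def capacity (α : ℝ≥0∞) (𝒲 : Set (ProbabilityMeasure Y)) : EReal :=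
  ⨆ P ∈ pmfs 𝒲, (information α P : EReal)

/-- The order `α` Rényi divergence between probability measures, with reference measure `W + Q`.
At order one it is the Kullback–Leibler divergence. -/
def divergence (α : ℝ≥0∞) (W Q : ProbabilityMeasure Y) : EReal :=
  let ν : Measure Y := (W : Measure Y) + Q
  let w : Y → ℝ≥0∞ := (W : Measure Y).rnDeriv ν
  let q : Y → ℝ≥0∞ := (Q : Measure Y).rnDeriv ν
  if α = 0 then -ENNReal.log ((Q : Measure Y) {y | 0 < w y})
  else if α = ⊤ then ENNReal.log (essSup (fun y => w y / q y) ν)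
  else if α = 1 then (InformationTheory.klDiv (W : Measure Y) Q : EReal)
  else ((1 / (α.toReal - 1) : ℝ) : EReal) *
    ENNReal.log (∫⁻ y, w y ^ α.toReal * q y ^ (1 - α.toReal) ∂ν)

/-- `q` is an order `α` Rényi center of `𝒲`: `sup_{W ∈ 𝒲} D_α(W ‖ q) = C_α(𝒲)`. -/
def IsCenter (α : ℝ≥0∞) (𝒲 : Set (ProbabilityMeasure Y)) (q : ProbabilityMeasure Y) : Prop :=
  ⨆ W ∈ 𝒲, divergence α W q = capacity α 𝒲

/-- The convex hull `{μ_{1,P} : P a prior on 𝒲}`. -/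
def convHull (𝒲 : Set (ProbabilityMeasure Y)) : Set (ProbabilityMeasure Y) :=
  {V | ∃ P ∈ pmfs 𝒲, V.toFiniteMeasure = meanMeasure 1 P}

/-- All mean measures of order at most `ϑ` for priors on `𝒲`. -/
def meanMeasures (ϑ : ℝ≥0∞) (𝒲 : Set (ProbabilityMeasure Y)) : Set (FiniteMeasure Y) :=
  {μ | ∃ α ≤ ϑ, ∃ P ∈ pmfs 𝒲, μ = meanMeasure α P}

/-- The set `S` of measures is uniformly absolutely continuous with respect to `ν`. -/
def UAC (S : Set (FiniteMeasure Y)) (ν : Measure Y) : Prop :=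
  ∀ ε : ℝ≥0, 0 < ε → ∃ δ : ℝ≥0, 0 < δ ∧
    ∀ μ ∈ S, ∀ E : Set Y, MeasurableSet E → ν E < δ → μ E < ε

/-! ### Topologies on the space of finite signed measures -/

/-- The signed measure given by a finite measure. -/
def toSigned (μ : FiniteMeasure Y) : SignedMeasure Y := (μ : Measure Y).toSignedMeasure

variable (Y) in
/-- The topology of setwise convergence on finite signed measures: the coarsest topology for which
`s ↦ s E` is continuous for every measurable set `E`. -/
abbrev setwiseTopology : TopologicalSpace (SignedMeasure Y) :=
  ⨅ E : {E : Set Y // MeasurableSet E},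
    TopologicalSpace.induced (fun s : SignedMeasure Y => s E) inferInstance

variable (Y) in
/-- The topology of setwise convergence on probability measures. -/
abbrev setwiseTopologyProb : TopologicalSpace (ProbabilityMeasure Y) :=
  TopologicalSpace.induced (fun W => toSigned W.toFiniteMeasure) (setwiseTopology Y)

/-- The total variation norm `|s|(Y)`. -/
def tvNorm (s : SignedMeasure Y) : ℝ := s.variation.real univ

instance (s : SignedMeasure Y) : IsFiniteMeasure s.variation := by
  rw [← SignedMeasure.totalVariation_eq_variation]; infer_instance

theorem tvNorm_smul (c : ℝ) (s : SignedMeasure Y) : tvNorm (c • s) = ‖c‖ * tvNorm s := by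
  unfold tvNorm
  rw [VectorMeasure.variation_smul, measureReal_nnreal_smul_apply, coe_nnnorm]

theorem tvNorm_core :
    letI : Norm (SignedMeasure Y) := ⟨tvNorm⟩
    NormedSpace.Core ℝ (SignedMeasure Y) := by
  let : Norm (SignedMeasure Y) := ⟨tvNorm⟩
  refine ⟨⟨fun s => ?_, fun c s => ?_, fun s t => ?_⟩, fun s => ?_⟩
  · exact measureReal_nonneg
  · exact tvNorm_smul c s
  · change (s + t).variation.real univ ≤ s.variation.real univ + t.variation.real univ
    rw [← measureReal_add_apply]
    exact ENNReal.toReal_mono (measure_ne_top _ _) (VectorMeasure.variation_add_le univ)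
  · change s.variation.real univ = 0 ↔ s = 0
    rw [measureReal_eq_zero_iff, Measure.measure_univ_eq_zero, VectorMeasure.variation_eq_zero]

variable (Y) in
/-- Finite signed measures as a normed group with the total variation norm. -/
abbrev tvNormedGroup : NormedAddCommGroup (SignedMeasure Y) :=
  letI : Norm (SignedMeasure Y) := ⟨tvNorm⟩
  NormedAddCommGroup.ofCore tvNorm_core

variable (Y) in
/-- Finite signed measures as a normed space with the total variation norm. -/
abbrev tvNormedSpace :
    letI := tvNormedGroup Y
    NormedSpace ℝ (SignedMeasure Y) :=
  letI := tvNormedGroup Y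
  NormedSpace.ofCore tvNorm_core

variable (Y) in
/-- The weak topology on finite signed measures: the coarsest topology for which every linear
functional that is continuous for the total variation norm is continuous. -/
abbrev weakTopology : TopologicalSpace (SignedMeasure Y) :=
  letI := tvNormedGroup Y
  letI := tvNormedSpace Y
  TopologicalSpace.induced (toWeakSpace ℝ (SignedMeasure Y)) inferInstance

/-- `S` has compact closure in the space of finite signed measures with the topology `t`. -/
def RelativelyCompact (t : TopologicalSpace (SignedMeasure Y)) (S : Set (FiniteMeasure Y)) : Prop :=
  @IsCompact _ t (@closure _ t (toSigned '' S))

end Renyi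

end

/-! Orders `ϑ ≥ 1` are governed by a center. On a strictly increasing scale `D_ϑ` becomes a
nonnegative `d(W, Q)` and `I_ϑ` a nonnegative `F(P)`: the relative entropy and mutual information at
order one, `∫ (dW/dQ)^ϑ dQ` and `‖μ_{ϑ,P}‖^ϑ` for finite `ϑ > 1`, the least `K` with `W ≤ K Q` and
`‖μ_{∞,P}‖` at infinity. For finite orders the `P`-average of `d(·, Q)` exceeds `F(P)` by at least a
multiple of the squared distance on sets between `Q` and the optimal output of `P` (a compensation
identity plus a weak Pinsker inequality). Hence nearly optimal priors have uniformly close outputs.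
Their limit is a center, as seen by mixing a little of any `W ∈ 𝒲` into the priors and using lower
semicontinuity of `d` (`exists_unique_center`). At order infinity `μ_{∞,P}` is the least measure
dominating the support of `P`, and monotonicity replaces the quadratic bound
(`exists_unique_center_top`).

The bound `d(W, Q) ≤ K` survives mixtures and setwise limits, so the center of `𝒲` also serves its
hull and closure; this gives (a) and (b) for `ϑ ≥ 1`. It also bounds the divergence of every
`μ_{ϑ,P}` from `Q`, and superlinearity turns that into uniform absolute continuity; lower orders
follow because power means increase with the order. The Dunford–Pettis theorem
(`UAC.relativelyCompact_weak`) then gives the compactness in (c).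

Below order one the information is a decreasing function of the mass. For the hull, priors are
composed and concavity of `t ^ a` applies; for the closure, the mass is upper semicontinuous, by its
supporting linear functionals (`exists_mass_lt_of_closure`).

For (d), `(1 - a) / a * I_a` is minus the logarithm of the mass. Uniform absolute continuity permits
truncation of densities, which keeps masses near one. Its failure produces by a gliding hump
measures `W n` and sets `E n` with `W n (E n) ≥ ε` while earlier measures barely charge `E n`. Such
a sequence contradicts setwise compactness, and uniform priors on its members keep masses away from
one. -/

noncomputable section

/-! ### Weak compactness of bounded uniformly absolutely continuous families -/

namespace Renyi

-- Grothendieck's criterion. A weak-star limit of `S` in the bidual lies in the copy of `K` plus a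
-- ball of radius `ε / 2`, a weak-star closed set because `K` is compact. So it is arbitrarily close
-- in norm to the canonical copy of `X`, which is norm closed by completeness.
open NormedSpace Bornology Pointwise in
theorem isCompact_closure_of_approx {X : Type*} [NormedAddCommGroup X] [NormedSpace ℝ X]
    [CompleteSpace X] {S : Set X} (hb : IsBounded S)
    (hS : ∀ ε : ℝ, 0 < ε → ∃ K : Set (WeakSpace ℝ X), IsCompact K ∧
      ∀ x ∈ S, ∃ k : X, toWeakSpace ℝ X k ∈ K ∧ ‖x - k‖ ≤ ε) :
    IsCompact (closure (toWeakSpace ℝ X '' S)) := by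
  refine isCompact_closure_of_isBounded ℝ X _ ?_ ?_
  · rwa [preimage_image_eq _ (toWeakSpace ℝ X).injective]
  intro φ hφ
  let J := inclusionInDoubleDualLi ℝ (E := X)
  have hclosed : IsClosed (range J) := by
    exact J.isometry.isUniformInducing.isComplete_range.isClosed
  suffices h : WeakDual.toStrongDual φ ∈ range J by
    obtain ⟨x, hx⟩ := h
    exact ⟨toWeakSpace ℝ X x, by apply WeakDual.toStrongDual.injective; rw [← hx]; rfl⟩
  rw [← hclosed.closure_eq]
  refine (Metric.mem_closure_iff (α := StrongDual ℝ (StrongDual ℝ X))).2 fun ε hε => ?_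
  obtain ⟨K, hK, hSK⟩ := hS (ε / 2) (half_pos hε)
  have hK' := hK.image (inclusionInDoubleDualWeak ℝ X).continuous
  have hsum := (WeakDual.isClosed_closedBall (𝕜 := ℝ) (E := StrongDual ℝ X) 0
    (ε / 2)).add_left_of_isCompact hK'
  have hsub : inclusionInDoubleDualWeak ℝ X '' (toWeakSpace ℝ X '' S) ⊆
      inclusionInDoubleDualWeak ℝ X '' K +
        WeakDual.toStrongDual ⁻¹' Metric.closedBall (0 : StrongDual ℝ (StrongDual ℝ X)) (ε / 2) := by
    rintro _ ⟨_, ⟨x, hx, rfl⟩, rfl⟩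
    obtain ⟨k, hk, hxk⟩ := hSK x hx
    refine ⟨_, ⟨_, hk, rfl⟩, inclusionInDoubleDualWeak ℝ X (toWeakSpace ℝ X (x - k)), ?_, ?_⟩
    · refine (mem_closedBall_zero_iff (E := StrongDual ℝ (StrongDual ℝ X))).2 ?_
      change ‖J (x - k)‖ ≤ _
      rwa [J.norm_map]
    · dsimp only
      rw [← map_add, ← map_add, add_sub_cancel]
  obtain ⟨_, ⟨k, -, rfl⟩, b, hb, rfl⟩ := closure_minimal hsub hsum hφ
  refine ⟨_, ⟨(toWeakSpace ℝ X).symm k, rfl⟩, ?_⟩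
  refine (dist_eq_norm (E := StrongDual ℝ (StrongDual ℝ X)) _ _).trans_lt ?_
  have : WeakDual.toStrongDual (inclusionInDoubleDualWeak ℝ X k + b) -
      J ((toWeakSpace ℝ X).symm k) = WeakDual.toStrongDual b := by
    rw [map_add]
    exact add_sub_cancel_left _ _
  dsimp only
  rw [this]
  have hb' := (mem_closedBall_zero_iff (E := StrongDual ℝ (StrongDual ℝ X))).1 hb
  exact hb'.trans_lt (half_lt_self hε)

-- Hilbert spaces are reflexive: a functional on the dual, read through the Riesz isometry, is a
-- functional on `H` and is represented by a point.
open NormedSpace in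
theorem isCompact_closure_closedBall_weakSpace {H : Type*} [NormedAddCommGroup H]
    [InnerProductSpace ℝ H] [CompleteSpace H] (r : ℝ) :
    IsCompact (closure (toWeakSpace ℝ H '' Metric.closedBall 0 r)) := by
  refine isCompact_closure_of_isBounded ℝ H _ ?_ ?_
  · rw [preimage_image_eq _ (toWeakSpace ℝ H).injective]
    exact Metric.isBounded_closedBall
  intro φ _
  let ψ : StrongDual ℝ H :=
    (WeakDual.toStrongDual φ).comp (InnerProductSpace.toDual ℝ H).toContinuousLinearEquiv.toContinuousLinearMap
  refine ⟨toWeakSpace ℝ H ((InnerProductSpace.toDual ℝ H).symm ψ), ?_⟩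
  refine WeakDual.toStrongDual.injective (ContinuousLinearMap.ext fun f => ?_)
  obtain ⟨y, rfl⟩ := (InnerProductSpace.toDual ℝ H).surjective f
  change InnerProductSpace.toDual ℝ H y ((InnerProductSpace.toDual ℝ H).symm ψ) = ψ y
  rw [InnerProductSpace.toDual_apply_apply, real_inner_comm, InnerProductSpace.toDual_symm_apply]

variable {Y : Type*} [MeasurableSpace Y]

/-- The inclusion of `L²` into `L¹` for a finite measure. -/
def L2ToL1 (ν : Measure Y) [IsFiniteMeasure ν] : Lp ℝ 2 ν →L[ℝ] Lp ℝ 1 ν :=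
  LinearMap.mkContinuous
    { toFun := fun f => ((Lp.memLp f).mono_exponent (by norm_num)).toLp f
      map_add' := fun f g => by
        ext1
        refine (MemLp.coeFn_toLp _).trans ((Lp.coeFn_add f g).trans ?_)
        refine EventuallyEq.trans ?_ (Lp.coeFn_add _ _).symm
        filter_upwards [MemLp.coeFn_toLp ((Lp.memLp f).mono_exponent (p := 1) (by norm_num)),
          MemLp.coeFn_toLp ((Lp.memLp g).mono_exponent (p := 1) (by norm_num))] with y h1 h2
        simp [h1, h2]
      map_smul' := fun c f => by
        ext1
        refine (MemLp.coeFn_toLp _).trans ((Lp.coeFn_smul c f).trans ?_)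
        refine EventuallyEq.trans ?_ (Lp.coeFn_smul _ _).symm
        filter_upwards [MemLp.coeFn_toLp ((Lp.memLp f).mono_exponent (p := 1) (by norm_num))]
          with y h1
        simp [h1] }
    (ν.real univ ^ (1 - 1 / 2 : ℝ)) fun f => by
      have h := eLpNorm_le_eLpNorm_mul_rpow_measure_univ (p := 1) (q := 2) (μ := ν)
        (by norm_num) (Lp.aestronglyMeasurable f)
      change ‖MemLp.toLp f ((Lp.memLp f).mono_exponent (by norm_num))‖ ≤ _
      rw [Lp.norm_toLp, Lp.norm_def, mul_comm, measureReal_def, ENNReal.toReal_rpow,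
        ← ENNReal.toReal_mul]
      refine ENNReal.toReal_mono ?_ ?_
      · exact ENNReal.mul_ne_top (Lp.eLpNorm_ne_top f)
          (ENNReal.rpow_ne_top_of_nonneg (by norm_num) (measure_ne_top _ _))
      · simpa using h

theorem L2ToL1_toLp (ν : Measure Y) [IsFiniteMeasure ν] {f : Y → ℝ} (hf : MemLp f 2 ν)
    (hf1 : MemLp f 1 ν) : L2ToL1 ν (hf.toLp f) = hf1.toLp f := by
  ext1
  refine (MemLp.coeFn_toLp ((Lp.memLp _).mono_exponent (by norm_num))).trans ?_
  exact hf.coeFn_toLp.trans hf1.coeFn_toLp.symm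

attribute [local instance] tvNormedGroup tvNormedSpace

/-- The signed measure with a given `L¹` density. -/
def L1ToSigned (ν : Measure Y) : Lp ℝ 1 ν →L[ℝ] SignedMeasure Y :=
  LinearMap.mkContinuous
    { toFun := fun f => ν.withDensityᵥ f
      map_add' := fun f g => by
        rw [WithDensityᵥEq.congr_ae (Lp.coeFn_add f g)]
        exact withDensityᵥ_add (L1.integrable_coeFn f) (L1.integrable_coeFn g)
      map_smul' := fun c f => by
        rw [WithDensityᵥEq.congr_ae (Lp.coeFn_smul c f)]
        exact withDensityᵥ_smul _ c }
    1 fun f => by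
      have hf := L1.integrable_coeFn f
      have hle : (ν.withDensityᵥ f).variation ≤ ν.withDensity fun y => ‖f y‖ₑ := by
        refine VectorMeasure.variation_le_of_forall_enorm_le fun s hs => ?_
        rw [withDensityᵥ_apply hf hs, withDensity_apply _ hs]
        exact enorm_integral_le_lintegral_enorm _
      rw [one_mul]
      change (ν.withDensityᵥ f).variation.real univ ≤ _
      rw [L1.norm_def]
      refine ENNReal.toReal_mono hf.2.ne ((hle univ).trans ?_)
      rw [withDensity_apply _ MeasurableSet.univ, Measure.restrict_univ]

theorem L1ToSigned_toLp (ν : Measure Y) {f : Y → ℝ} (hf : MemLp f 1 ν) :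
    L1ToSigned ν (hf.toLp f) = ν.withDensityᵥ f :=
  WithDensityᵥEq.congr_ae hf.coeFn_toLp

theorem UAC.absolutelyContinuous {S : Set (FiniteMeasure Y)} {ν : Measure Y} (h : UAC S ν)
    {μ : FiniteMeasure Y} (hμ : μ ∈ S) : (μ : Measure Y) ≪ ν := by
  refine Measure.AbsolutelyContinuous.mk fun E hE hνE => ?_
  by_contra h0
  have hpos : 0 < μ E := by
    rw [pos_iff_ne_zero]
    exact fun h1 => h0 ((FiniteMeasure.null_iff_toMeasure_null _ _).1 h1)
  obtain ⟨δ, hδ, H⟩ := h _ hpos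
  exact lt_irrefl _ (H μ hμ E hE (by rw [hνE]; exact_mod_cast hδ))

theorem weakTopology_t2 : @T2Space _ (weakTopology Y) := by
  exact @T2Space.of_injective_continuous _ _ (weakTopology Y) _ _ _
    (toWeakSpace ℝ (SignedMeasure Y)).injective continuous_induced_dom

theorem continuous_weak_L1ToSigned (ν : Measure Y) :
    @Continuous _ _ _ (weakTopology Y)
      (fun x : WeakSpace ℝ (Lp ℝ 1 ν) => L1ToSigned ν ((toWeakSpace ℝ (Lp ℝ 1 ν)).symm x)) :=
  continuous_induced_rng.2 (WeakSpace.map (L1ToSigned ν)).continuous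

theorem memLp_one_rnDeriv (μ ν : Measure Y) [IsFiniteMeasure μ] :
    MemLp (fun y => (μ.rnDeriv ν y).toReal) 1 ν :=
  memLp_one_iff_integrable.2 Measure.integrable_toReal_rnDeriv

theorem L1ToSigned_rnDeriv (μ : FiniteMeasure Y) (ν : Measure Y) [SigmaFinite ν]
    (h : (μ : Measure Y) ≪ ν) :
    L1ToSigned ν ((memLp_one_rnDeriv (μ : Measure Y) ν).toLp _) = toSigned μ := by
  rw [L1ToSigned_toLp, withDensityᵥ_toReal (Measure.measurable_rnDeriv _ _).aemeasurable
    (Measure.lintegral_rnDeriv_lt_top _ _).ne]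
  unfold toSigned
  congr 1
  exact Measure.withDensity_rnDeriv_eq _ _ h

/-- Densities truncated at `N` are bounded in `L²`, so they sit in the image in `L¹` of a relatively
weakly compact ball. The `L¹` error of truncation is at most the `μ`-measure of the set where the
density exceeds `N`, which is uniformly small. Thus `isCompact_closure_of_approx` applies in `L¹`,
and `L1ToSigned` carries compactness to signed measures. -/
theorem UAC.relativelyCompact_weak {S : Set (FiniteMeasure Y)} {ν : Measure Y} [IsFiniteMeasure ν]
    (h : UAC S ν) {C : ℝ≥0} (hC : ∀ μ ∈ S, μ.mass ≤ C) : RelativelyCompact (weakTopology Y) S := by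
  let D : FiniteMeasure Y → Lp ℝ 1 ν := fun μ => (memLp_one_rnDeriv (μ : Measure Y) ν).toLp _
  have hD : ∀ μ ∈ S, L1ToSigned ν (D μ) = toSigned μ := fun μ hμ =>
    L1ToSigned_rnDeriv μ ν (h.absolutelyContinuous hμ)
  have hnorm : ∀ μ ∈ S, ‖D μ‖ ≤ C := by
    intro μ hμ
    rw [Lp.norm_toLp, eLpNorm_one_eq_lintegral_enorm]
    have : ∫⁻ y, ‖((μ : Measure Y).rnDeriv ν y).toReal‖ₑ ∂ν ≤ (C : ℝ≥0∞) := by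
      calc _ ≤ ∫⁻ y, (μ : Measure Y).rnDeriv ν y ∂ν := by
            refine lintegral_mono fun y => ?_
            rw [Real.enorm_of_nonneg ENNReal.toReal_nonneg]
            exact ENNReal.ofReal_toReal_le
        _ ≤ (μ : Measure Y) univ := Measure.lintegral_rnDeriv_le
        _ ≤ C := by
            rw [← FiniteMeasure.ennreal_mass]
            exact_mod_cast hC μ hμ
    exact ENNReal.toReal_mono ENNReal.coe_ne_top this
  have hcomp : IsCompact (closure (toWeakSpace ℝ (Lp ℝ 1 ν) '' (D '' S))) := by
    refine isCompact_closure_of_approx ?_ ?_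
    · refine (Metric.isBounded_closedBall (x := (0 : Lp ℝ 1 ν)) (r := C)).subset ?_
      rintro _ ⟨μ, hμ, rfl⟩
      exact mem_closedBall_zero_iff.2 (hnorm μ hμ)
    intro ε hε
    obtain ⟨δ, hδ, H⟩ := h ⟨ε, hε.le⟩ hε
    -- Markov's inequality bounds the `ν`-measure of the truncated region by `C / N`, which has to
    -- fall below `δ`.
    obtain ⟨N, hN⟩ : ∃ N : ℝ≥0, 0 < N ∧ C < N * δ := by
      refine ⟨(C + 1) / δ, by positivity, ?_⟩
      rw [div_mul_cancel₀ _ hδ.ne']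
      exact lt_add_one C
    have hmeas : ∀ μ : FiniteMeasure Y, Measurable fun y => ((μ : Measure Y).rnDeriv ν y).toReal :=
      fun μ => (Measure.measurable_rnDeriv _ _).ennreal_toReal
    have hbd : ∀ (μ : FiniteMeasure Y) (y : Y),
        ‖min ((μ : Measure Y).rnDeriv ν y).toReal N‖ ≤ N := fun μ y => by
      rw [Real.norm_of_nonneg (le_min ENNReal.toReal_nonneg N.coe_nonneg)]
      exact min_le_right _ _
    have hmem : ∀ (μ : FiniteMeasure Y) (p : ℝ≥0∞),
        MemLp (fun y => min ((μ : Measure Y).rnDeriv ν y).toReal N) p ν := fun μ p =>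
      MemLp.of_bound ((hmeas μ).min measurable_const).aestronglyMeasurable N
        (Eventually.of_forall (hbd μ))
    refine ⟨_, (isCompact_closure_closedBall_weakSpace (H := Lp ℝ 2 ν)
      (ν.real univ ^ ((2 : ℝ≥0∞).toReal⁻¹) * N)).image (WeakSpace.map (L2ToL1 ν)).continuous, ?_⟩
    rintro _ ⟨μ, hμ, rfl⟩
    refine ⟨(hmem μ 1).toLp _, ⟨toWeakSpace ℝ _ ((hmem μ 2).toLp _), subset_closure ⟨_, ?_, rfl⟩,
      ?_⟩, ?_⟩
    · rw [mem_closedBall_zero_iff, Lp.norm_toLp]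
      have := eLpNorm_le_of_ae_bound (p := 2) (μ := ν) (C := (N : ℝ)) (Eventually.of_forall (hbd μ))
      refine (ENNReal.toReal_mono ?_ this).trans (le_of_eq ?_)
      · finiteness
      · rw [ENNReal.toReal_mul, ← ENNReal.toReal_rpow, ENNReal.toReal_ofReal (NNReal.coe_nonneg N),
          measureReal_def]
    · exact congrArg (toWeakSpace ℝ (Lp ℝ 1 ν)) (L2ToL1_toLp ν (hmem μ 2) (hmem μ 1))
    · rw [← MemLp.toLp_sub, Lp.norm_toLp, eLpNorm_one_eq_lintegral_enorm]
      set E : Set Y := {y | (N : ℝ≥0∞) < (μ : Measure Y).rnDeriv ν y} with hE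
      have hEm : MeasurableSet E := measurableSet_lt measurable_const (Measure.measurable_rnDeriv _ _)
      have hνE : ν E < δ := by
        have h1 : (N : ℝ≥0∞) * ν E ≤ C := by
          calc (N : ℝ≥0∞) * ν E ≤ N * ν {y | (N : ℝ≥0∞) ≤ (μ : Measure Y).rnDeriv ν y} := by
                gcongr
                intro y hy
                simp only [hE, mem_ofPred_eq] at hy ⊢
                exact hy.le
            _ ≤ ∫⁻ y, (μ : Measure Y).rnDeriv ν y ∂ν :=
                mul_meas_ge_le_lintegral (Measure.measurable_rnDeriv _ _) _
            _ ≤ (μ : Measure Y) univ := Measure.lintegral_rnDeriv_le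
            _ ≤ C := by
              rw [← FiniteMeasure.ennreal_mass]
              exact_mod_cast hC μ hμ
        have h2 : (N : ℝ≥0∞) * ν E < N * δ := h1.trans_lt (by exact_mod_cast hN.2)
        exact lt_of_mul_lt_mul_left' h2
      have h3 : ∫⁻ y, ‖((fun y => ((μ : Measure Y).rnDeriv ν y).toReal) -
          fun y => min ((μ : Measure Y).rnDeriv ν y).toReal N) y‖ₑ ∂ν ≤ (μ : Measure Y) E := by
        calc _ ≤ ∫⁻ y, E.indicator (fun y => (μ : Measure Y).rnDeriv ν y) y ∂ν := by
              refine lintegral_mono_ae ?_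
              filter_upwards [Measure.rnDeriv_lt_top (μ : Measure Y) ν] with y hy
              rw [Pi.sub_apply]
              by_cases hyE : y ∈ E
              · rw [indicator_of_mem hyE, Real.enorm_of_nonneg (sub_nonneg.2 (min_le_left _ _))]
                refine ENNReal.ofReal_le_of_le_toReal ?_
                exact sub_le_self _ (le_min ENNReal.toReal_nonneg N.coe_nonneg)
              · rw [indicator_of_notMem hyE, min_eq_left]
                · simp
                · rw [hE, mem_ofPred_eq, not_lt] at hyE
                  exact ENNReal.toReal_mono ENNReal.coe_ne_top hyE
          _ ≤ (μ : Measure Y) E := by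
              rw [lintegral_indicator hEm]
              exact Measure.setLIntegral_rnDeriv_le _
      have h4 := H μ hμ E hEm hνE
      refine (ENNReal.toReal_mono (measure_ne_top _ _) h3).trans ?_
      have : (μ E : ℝ) < ε := h4
      exact this.le
  let := weakTopology Y
  have : T2Space (SignedMeasure Y) := weakTopology_t2
  have himg := hcomp.image (continuous_weak_L1ToSigned ν)
  refine himg.of_isClosed_subset isClosed_closure (closure_minimal ?_ himg.isClosed)
  rintro _ ⟨μ, hμ, rfl⟩
  exact ⟨_, subset_closure ⟨_, ⟨μ, hμ, rfl⟩, rfl⟩, hD μ hμ⟩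

theorem continuous_apply_weakTopology (E : Set Y) :
    @Continuous _ _ (weakTopology Y) _ (fun s : SignedMeasure Y => s E) := by
  let f : SignedMeasure Y →L[ℝ] ℝ := LinearMap.mkContinuous
    { toFun := fun s => s E, map_add' := fun s t => rfl, map_smul' := fun c s => rfl } 1 fun s => by
      rw [one_mul]
      exact (VectorMeasure.norm_measure_le_variation (μ := s) (E := E)).trans
        (measureReal_mono (subset_univ _))
  have h : Continuous fun x : WeakSpace ℝ (SignedMeasure Y) => f ((toWeakSpace ℝ _).symm x) :=
    WeakBilin.eval_continuous (topDualPairing ℝ (SignedMeasure Y)).flip f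
  let := weakTopology Y
  exact h.comp continuous_induced_dom

theorem weakTopology_le_setwiseTopology : weakTopology Y ≤ setwiseTopology Y :=
  le_iInf fun E => continuous_iff_le_induced.1 (continuous_apply_weakTopology E.1)

theorem setwiseTopology_t2 : @T2Space _ (setwiseTopology Y) := by
  let := setwiseTopology Y
  have hc : ∀ E : {E : Set Y // MeasurableSet E}, Continuous fun s : SignedMeasure Y => s E :=
    fun E => continuous_iff_le_induced.2 (iInf_le _ E)
  refine T2Space.of_injective_continuous
    (f := fun (s : SignedMeasure Y) (E : {E : Set Y // MeasurableSet E}) => s E) ?_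
    (continuous_pi hc)
  intro s t hst
  ext E hE
  exact congrFun hst ⟨E, hE⟩

/-- The weak closure stays compact in the coarser setwise topology, is closed there by the Hausdorff
property, and so contains the setwise closure. -/
theorem RelativelyCompact.setwise {S : Set (FiniteMeasure Y)}
    (h : RelativelyCompact (weakTopology Y) S) : RelativelyCompact (setwiseTopology Y) S := by
  have h1 : @IsCompact _ (setwiseTopology Y) (@closure _ (weakTopology Y) (toSigned '' S)) := by
    have := @IsCompact.image _ _ (weakTopology Y) (setwiseTopology Y) _ id h
      (continuous_id_iff_le.2 weakTopology_le_setwiseTopology)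
    rwa [image_id] at this
  have hsub := @subset_closure _ (weakTopology Y) (toSigned '' S)
  let := setwiseTopology Y
  have : T2Space (SignedMeasure Y) := setwiseTopology_t2
  exact h1.of_isClosed_subset isClosed_closure (closure_minimal hsub h1.isClosed)

end Renyi

/-! ### Power means and mean measures -/

namespace Renyi

section PowerMean

variable {X : Type*} {A : Set X} {P : X →₀ ℝ≥0}

theorem pmfs_sum (hP : P ∈ pmfs A) : ∑ W ∈ P.support, P W = 1 := hP.2

theorem pmfs_sum_real (hP : P ∈ pmfs A) : ∑ W ∈ P.support, (P W : ℝ) = 1 := by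
  exact_mod_cast hP.2

theorem pmfs_sum_ennreal (hP : P ∈ pmfs A) : ∑ W ∈ P.support, (P W : ℝ≥0∞) = 1 := by
  exact_mod_cast hP.2

theorem pmfs_support_nonempty (hP : P ∈ pmfs A) : P.support.Nonempty := by
  rw [Finset.nonempty_iff_ne_empty]
  intro h
  simpa [h] using pmfs_sum hP

theorem pmfs_mono {B : Set X} (h : A ⊆ B) : pmfs A ⊆ pmfs B := fun _ hP => ⟨hP.1.trans h, hP.2⟩

theorem pmfs_univ (hP : P ∈ pmfs A) : P ∈ pmfs (univ : Set X) := pmfs_mono (subset_univ A) hP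

theorem single_mem_pmfs {W : X} (hW : W ∈ A) : Finsupp.single W (1 : ℝ≥0) ∈ pmfs A := by
  refine ⟨?_, by simp⟩
  rw [Finsupp.support_single _ one_ne_zero]
  simpa using hW

theorem powerMean_zero (g : X → ℝ≥0∞) :
    powerMean 0 P g = ∏ W ∈ P.support, g W ^ (P W : ℝ) := if_pos rfl

theorem powerMean_top (g : X → ℝ≥0∞) : powerMean ⊤ P g = ⨆ W ∈ P.support, g W := by
  simp [powerMean]

theorem powerMean_ofReal {a : ℝ} (ha : 0 < a) (g : X → ℝ≥0∞) :
    powerMean (ENNReal.ofReal a) P g =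
      (∑ W ∈ P.support, (P W : ℝ≥0∞) * g W ^ a) ^ (1 / a) := by
  simp [powerMean, ha, ENNReal.toReal_ofReal ha.le]

theorem powerMean_one (g : X → ℝ≥0∞) :
    powerMean 1 P g = ∑ W ∈ P.support, (P W : ℝ≥0∞) * g W := by
  simp [powerMean]

theorem ennreal_cases (α : ℝ≥0∞) :
    α = 0 ∨ α = ⊤ ∨ ∃ a : ℝ, 0 < a ∧ α = ENNReal.ofReal a := by
  rcases eq_or_ne α 0 with h | h0
  · exact Or.inl h
  rcases eq_or_ne α ⊤ with h | h1
  · exact Or.inr (Or.inl h)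
  exact Or.inr (Or.inr ⟨α.toReal, ENNReal.toReal_pos h0 h1, (ENNReal.ofReal_toReal h1).symm⟩)

theorem powerMean_congr (α : ℝ≥0∞) {g h : X → ℝ≥0∞} (hgh : ∀ W ∈ P.support, g W = h W) :
    powerMean α P g = powerMean α P h :=
  le_antisymm (powerMean_mono α P fun W hW => (hgh W hW).le)
    (powerMean_mono α P fun W hW => (hgh W hW).ge)

theorem measurable_powerMean {Y : Type*} [MeasurableSpace Y] (α : ℝ≥0∞) {g : X → Y → ℝ≥0∞}
    (hg : ∀ W, Measurable (g W)) : Measurable fun y => powerMean α P fun W => g W y := by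
  unfold powerMean
  split_ifs
  · exact Finset.measurable_fun_prod _ fun W _ => (hg W).pow_const _
  · exact Measurable.biSup (P.support : Set X) (Finset.countable_toSet _) fun W _ => hg W
  · exact (Finset.measurable_fun_sum _ fun W _ => ((hg W).pow_const _).const_mul _).pow_const _

/-- Homogeneity is what makes the mean measures independent of the reference measure. -/
theorem powerMean_mul (hP : P ∈ pmfs A) (α : ℝ≥0∞) (g : X → ℝ≥0∞) (c : ℝ≥0∞) :
    powerMean α P (fun W => g W * c) = powerMean α P g * c := by
  rcases ennreal_cases α with rfl | rfl | ⟨a, ha, rfl⟩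
  · simp only [powerMean_zero]
    rw [Finset.prod_congr rfl fun W _ => ENNReal.mul_rpow_of_nonneg _ _ (P W).coe_nonneg,
      Finset.prod_mul_distrib]
    congr 1
    have h : ∀ s : Finset X, ∏ W ∈ s, c ^ (P W : ℝ) = c ^ (∑ W ∈ s, (P W : ℝ)) := by
      classical
      intro s
      induction s using Finset.induction with
      | empty => simp
      | insert W s hW ih =>
        rw [Finset.prod_insert hW, Finset.sum_insert hW, ih,
          ENNReal.rpow_add_of_nonneg _ _ (P W).coe_nonneg
            (Finset.sum_nonneg fun V _ => (P V).coe_nonneg)]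
    rw [h, pmfs_sum_real hP, ENNReal.rpow_one]
  · simp only [powerMean_top, ENNReal.iSup_mul]
  · simp only [powerMean_ofReal ha]
    rw [Finset.sum_congr rfl fun W _ => by rw [ENNReal.mul_rpow_of_nonneg _ _ ha.le, ← mul_assoc],
      ← Finset.sum_mul, ENNReal.mul_rpow_of_nonneg _ _ (by positivity), ← ENNReal.rpow_mul,
      mul_one_div_cancel ha.ne', ENNReal.rpow_one]

theorem powerMean_const (hP : P ∈ pmfs A) (α : ℝ≥0∞) (c : ℝ≥0∞) :
    powerMean α P (fun _ => c) = c := by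
  have h := powerMean_mul hP α (fun _ => 1) c
  rw [show (fun _ : X => (1 : ℝ≥0∞) * c) = fun _ => c by simp] at h
  have h1 : powerMean α P (fun _ => (1 : ℝ≥0∞)) = 1 := by
    rcases ennreal_cases α with rfl | rfl | ⟨a, ha, rfl⟩
    · simp [powerMean_zero]
    · rw [powerMean_top]
      exact biSup_const (pmfs_support_nonempty hP)
    · simp [powerMean_ofReal ha, pmfs_sum_ennreal hP]
  rw [h, h1, one_mul]

theorem powerMean_le_powerMean_top (hP : P ∈ pmfs A) (α : ℝ≥0∞) (g : X → ℝ≥0∞) :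
    powerMean α P g ≤ powerMean ⊤ P g := by
  rw [← powerMean_const hP α (powerMean ⊤ P g)]
  refine powerMean_mono α P fun W hW => ?_
  rw [powerMean_top]
  exact le_iSup₂ (f := fun W (_ : W ∈ P.support) => g W) W hW

theorem powerMean_zero_le (hP : P ∈ pmfs A) {a : ℝ} (ha : 0 < a) (g : X → ℝ≥0∞) :
    powerMean 0 P g ≤ powerMean (ENNReal.ofReal a) P g := by
  rw [powerMean_zero, powerMean_ofReal ha, one_div, ENNReal.le_rpow_inv_iff ha,
    ← ENNReal.prod_rpow_of_nonneg ha.le]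
  by_cases! h : ∃ W ∈ P.support, g W = ⊤
  · obtain ⟨W, hW, hgW⟩ := h
    refine le_top.trans (top_le_iff.2 ?_).ge
    refine ENNReal.sum_eq_top.2 ⟨W, hW, ?_⟩
    rw [hgW, ENNReal.top_rpow_of_pos ha]
    exact ENNReal.mul_top (by simpa using hW)
  · have hlift : ∀ W ∈ P.support, g W = ((g W).toNNReal : ℝ≥0∞) := fun W hW =>
      (ENNReal.coe_toNNReal (h W hW)).symm
    rw [Finset.prod_congr rfl fun W hW => by
        rw [← ENNReal.rpow_mul, mul_comm, ENNReal.rpow_mul, hlift W hW,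
          ← ENNReal.coe_rpow_of_nonneg _ ha.le, ← ENNReal.coe_rpow_of_nonneg _ (P W).coe_nonneg],
      Finset.sum_congr rfl fun W hW => by
        rw [hlift W hW, ← ENNReal.coe_rpow_of_nonneg _ ha.le, ← ENNReal.coe_mul]]
    exact_mod_cast NNReal.geom_mean_le_arith_mean_weighted P.support P
      (fun W => (g W).toNNReal ^ a) (pmfs_sum hP)

/-- Jensen's inequality for the exponent `b / a` between finite positive orders, and weighted AM–GM
for the values `g W ^ a` at order zero. -/
theorem powerMean_le_powerMean (hP : P ∈ pmfs A) {α β : ℝ≥0∞} (h : α ≤ β) (g : X → ℝ≥0∞) :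
    powerMean α P g ≤ powerMean β P g := by
  rcases ennreal_cases β with rfl | rfl | ⟨b, hb, rfl⟩
  · rw [nonpos_iff_eq_zero.1 h]
  · exact powerMean_le_powerMean_top hP α g
  rcases ennreal_cases α with rfl | rfl | ⟨a, ha, rfl⟩
  · exact powerMean_zero_le hP hb g
  · simp at h
  have hab : a ≤ b := (ENNReal.ofReal_le_ofReal_iff hb.le).1 h
  have := ENNReal.rpow_arith_mean_le_arith_mean_rpow P.support (fun W => (P W : ℝ≥0∞))
    (fun W => g W ^ a) (pmfs_sum_ennreal hP) ((one_le_div ha).2 hab)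
  rw [powerMean_ofReal ha, powerMean_ofReal hb]
  calc (∑ W ∈ P.support, (P W : ℝ≥0∞) * g W ^ a) ^ (1 / a)
      = ((∑ W ∈ P.support, (P W : ℝ≥0∞) * g W ^ a) ^ (b / a)) ^ (1 / b) := by
        rw [← ENNReal.rpow_mul]
        congr 1
        field_simp
    _ ≤ (∑ W ∈ P.support, (P W : ℝ≥0∞) * (g W ^ a) ^ (b / a)) ^ (1 / b) := by gcongr
    _ = _ := by
        simp_rw [← ENNReal.rpow_mul, mul_div_cancel₀ b ha.ne']

end PowerMean

section MeanMeasure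

variable {Y : Type*} [MeasurableSpace Y] {A : Set (ProbabilityMeasure Y)}
  {P : ProbabilityMeasure Y →₀ ℝ≥0}

theorem refMeasure_apply (P : ProbabilityMeasure Y →₀ ℝ≥0) (E : Set Y) :
    refMeasure P E = ∑ W ∈ P.support, (P W : ℝ≥0∞) * (W : Measure Y) E := by
  simp [refMeasure, Measure.finsetSum_apply]

theorem isProbabilityMeasure_refMeasure (hP : P ∈ pmfs A) :
    IsProbabilityMeasure (refMeasure P) := by
  constructor
  rw [refMeasure_apply]
  simpa using pmfs_sum_ennreal hP

theorem absolutelyContinuous_refMeasure {W : ProbabilityMeasure Y} (hW : W ∈ P.support) :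
    (W : Measure Y) ≪ refMeasure P := by
  refine Measure.AbsolutelyContinuous.mk fun E _ hE => ?_
  rw [refMeasure_apply, Finset.sum_eq_zero_iff] at hE
  exact (mul_eq_zero.1 (hE W hW)).resolve_left (by simpa using hW)

theorem refMeasure_absolutelyContinuous {ν : Measure Y}
    (h : ∀ W ∈ P.support, (W : Measure Y) ≪ ν) : refMeasure P ≪ ν := by
  refine Measure.AbsolutelyContinuous.mk fun E _ hE => ?_
  rw [refMeasure_apply, Finset.sum_eq_zero_iff]
  intro W hW
  rw [h W hW hE, mul_zero]

/-- By the chain rule all densities pick up the same factor when the reference measure changes, and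
homogeneity pulls that factor out of the mean. -/
theorem meanMeasure_eq_withDensity (hP : P ∈ pmfs A) (α : ℝ≥0∞) (ν : Measure Y) [SigmaFinite ν]
    (h : ∀ W ∈ P.support, (W : Measure Y) ≪ ν) :
    (meanMeasure α P : Measure Y) =
      ν.withDensity fun y => powerMean α P fun W => (W : Measure Y).rnDeriv ν y := by
  have hm : Measurable (meanDensity α P) :=
    measurable_powerMean α fun W => Measure.measurable_rnDeriv _ _
  change (refMeasure P).withDensity (meanDensity α P) = _
  conv_lhs => rw [← Measure.withDensity_rnDeriv_eq _ _ (refMeasure_absolutelyContinuous h)]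
  rw [← withDensity_mul _ (Measure.measurable_rnDeriv _ _) hm]
  refine withDensity_congr_ae ?_
  have := (Finset.eventually_all P.support).2 fun W hW =>
    Measure.rnDeriv_mul_rnDeriv (κ := ν) (absolutelyContinuous_refMeasure hW)
  filter_upwards [this] with y hy
  rw [Pi.mul_apply, mul_comm, meanDensity, ← powerMean_mul hP]
  exact powerMean_congr α hy

theorem meanMeasure_apply (hP : P ∈ pmfs A) (α : ℝ≥0∞) (ν : Measure Y) [SigmaFinite ν]
    (h : ∀ W ∈ P.support, (W : Measure Y) ≪ ν) {E : Set Y} (hE : MeasurableSet E) :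
    (meanMeasure α P : Measure Y) E =
      ∫⁻ y in E, powerMean α P (fun W => (W : Measure Y).rnDeriv ν y) ∂ν := by
  rw [meanMeasure_eq_withDensity hP α ν h, withDensity_apply _ hE]

theorem meanMeasure_mass (hP : P ∈ pmfs A) (α : ℝ≥0∞) (ν : Measure Y) [SigmaFinite ν]
    (h : ∀ W ∈ P.support, (W : Measure Y) ≪ ν) :
    ((meanMeasure α P).mass : ℝ≥0∞) =
      ∫⁻ y, powerMean α P (fun W => (W : Measure Y).rnDeriv ν y) ∂ν := by
  rw [FiniteMeasure.ennreal_mass, meanMeasure_apply hP α ν h MeasurableSet.univ,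
    Measure.restrict_univ]

theorem meanMeasure_mono (hP : P ∈ pmfs A) {α β : ℝ≥0∞} (h : α ≤ β) :
    (meanMeasure α P : Measure Y) ≤ meanMeasure β P := by
  change (refMeasure P).withDensity _ ≤ (refMeasure P).withDensity _
  exact withDensity_mono (Eventually.of_forall fun y => powerMean_le_powerMean hP h _)

theorem meanMeasure_one (hP : P ∈ pmfs A) : (meanMeasure 1 P : Measure Y) = refMeasure P := by
  ext E hE
  rw [meanMeasure_apply hP 1 (refMeasure P) (fun W => absolutelyContinuous_refMeasure) hE,
    refMeasure_apply]
  simp only [powerMean_one]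
  rw [lintegral_finsetSum _ fun W _ => (Measure.measurable_rnDeriv _ _).const_mul _]
  refine Finset.sum_congr rfl fun W hW => ?_
  rw [lintegral_const_mul _ (Measure.measurable_rnDeriv _ _),
    Measure.setLIntegral_rnDeriv (absolutelyContinuous_refMeasure hW)]

theorem mass_meanMeasure_one (hP : P ∈ pmfs A) : (meanMeasure 1 P).mass = 1 := by
  have := isProbabilityMeasure_refMeasure hP
  have h : ((meanMeasure 1 P).mass : ℝ≥0∞) = 1 := by
    rw [FiniteMeasure.ennreal_mass, meanMeasure_one hP, measure_univ]
  exact_mod_cast h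

theorem mass_mono (hP : P ∈ pmfs A) {α β : ℝ≥0∞} (h : α ≤ β) :
    (meanMeasure α P).mass ≤ (meanMeasure β P).mass := by
  have := meanMeasure_mono hP h univ
  rw [← FiniteMeasure.ennreal_mass, ← FiniteMeasure.ennreal_mass] at this
  exact_mod_cast this

theorem one_le_mass (hP : P ∈ pmfs A) {α : ℝ≥0∞} (h : 1 ≤ α) : 1 ≤ (meanMeasure α P).mass :=
  (mass_meanMeasure_one hP).symm.le.trans (mass_mono hP h)

theorem mass_le_one (hP : P ∈ pmfs A) {α : ℝ≥0∞} (h : α ≤ 1) : (meanMeasure α P).mass ≤ 1 :=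
  (mass_mono hP h).trans (mass_meanMeasure_one hP).le

/-- This is why a mean measure of positive order dominates every member of the support and has
positive mass. Order zero is excluded because one vanishing factor annihilates a product. -/
theorem le_powerMean {α : ℝ≥0∞} (hα : α ≠ 0) {W : ProbabilityMeasure Y} (hW : W ∈ P.support) :
    ∃ c : ℝ≥0∞, c ≠ 0 ∧ ∀ g : ProbabilityMeasure Y → ℝ≥0∞, c * g W ≤ powerMean α P g := by
  rcases ennreal_cases α with rfl | rfl | ⟨a, ha, rfl⟩
  · exact absurd rfl hα
  · refine ⟨1, one_ne_zero, fun g => ?_⟩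
    rw [one_mul, powerMean_top]
    exact le_iSup₂ (f := fun W (_ : W ∈ P.support) => g W) W hW
  · have hPW : (P W : ℝ≥0∞) ≠ 0 := by simpa using hW
    refine ⟨(P W : ℝ≥0∞) ^ (1 / a), by simp [ENNReal.rpow_eq_zero_iff, hPW], fun g => ?_⟩
    rw [powerMean_ofReal ha]
    calc (P W : ℝ≥0∞) ^ (1 / a) * g W = ((P W : ℝ≥0∞) * g W ^ a) ^ (1 / a) := by
          rw [ENNReal.mul_rpow_of_nonneg _ _ (by positivity), ← ENNReal.rpow_mul,
            mul_one_div_cancel ha.ne', ENNReal.rpow_one]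
      _ ≤ _ := by
          refine ENNReal.rpow_le_rpow ?_ (by positivity)
          exact Finset.single_le_sum (f := fun W => (P W : ℝ≥0∞) * g W ^ a)
            (fun _ _ => zero_le) hW

theorem absolutelyContinuous_meanMeasure (hP : P ∈ pmfs A) {α : ℝ≥0∞} (hα : α ≠ 0)
    {W : ProbabilityMeasure Y} (hW : W ∈ P.support) :
    (W : Measure Y) ≪ (meanMeasure α P : Measure Y) := by
  refine Measure.AbsolutelyContinuous.mk fun E hE h0 => ?_
  obtain ⟨c, hc, hle⟩ := le_powerMean hα hW
  rw [meanMeasure_apply hP α (refMeasure P) (fun W => absolutelyContinuous_refMeasure) hE] at h0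
  have h1 : c * (W : Measure Y) E ≤ 0 := by
    rw [← h0, ← Measure.setLIntegral_rnDeriv (absolutelyContinuous_refMeasure hW),
      ← lintegral_const_mul _ (Measure.measurable_rnDeriv _ _)]
    exact lintegral_mono fun y => hle _
  exact (mul_eq_zero.1 (nonpos_iff_eq_zero.1 h1)).resolve_left hc

theorem mass_pos (hP : P ∈ pmfs A) {α : ℝ≥0∞} (hα : α ≠ 0) : 0 < (meanMeasure α P).mass := by
  rw [pos_iff_ne_zero]
  intro h
  obtain ⟨W, hW⟩ := pmfs_support_nonempty hP
  have h1 : (meanMeasure α P : Measure Y) univ = 0 := by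
    rw [← FiniteMeasure.ennreal_mass, h, ENNReal.coe_zero]
  have := absolutelyContinuous_meanMeasure hP hα hW h1
  simp at this

theorem information_ofReal {a : ℝ} (ha : 0 < a) (ha1 : a ≠ 1) :
    information (ENNReal.ofReal a) P =
      a / (a - 1) * Real.log (meanMeasure (ENNReal.ofReal a) P).mass := by
  simp [information, ha, ha1, ENNReal.toReal_ofReal ha.le]

theorem information_top : information ⊤ P = Real.log (meanMeasure ⊤ P).mass := by
  simp [information]

theorem le_capacity {𝒲 : Set (ProbabilityMeasure Y)} (hP : P ∈ pmfs 𝒲) (α : ℝ≥0∞) :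
    (information α P : EReal) ≤ capacity α 𝒲 :=
  le_iSup₂ (f := fun P (_ : P ∈ pmfs 𝒲) => (information α P : EReal)) P hP

theorem capacity_mono (α : ℝ≥0∞) {𝒲 𝒱 : Set (ProbabilityMeasure Y)} (h : 𝒲 ⊆ 𝒱) :
    capacity α 𝒲 ≤ capacity α 𝒱 :=
  iSup₂_le fun _ hP => le_capacity (pmfs_mono h hP) α

end MeanMeasure

end Renyi

/-! ### Failure of uniform absolute continuity; setwise compactness -/

namespace Renyi

variable {Y : Type*} [MeasurableSpace Y] {𝒲 : Set (ProbabilityMeasure Y)}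

theorem uac_iff {S : Set (FiniteMeasure Y)} {ν : Measure Y} :
    UAC S ν ↔ ∀ ε : ℝ≥0, 0 < ε → ∃ δ : ℝ≥0, 0 < δ ∧ ∀ μ ∈ S, ∀ E : Set Y, MeasurableSet E →
      ν E < δ → (μ : Measure Y) E < ε := by
  simp only [UAC, ← FiniteMeasure.ennreal_coeFn_eq_coeFn_toMeasure, ENNReal.coe_lt_coe]

theorem uac_toFiniteMeasure_iff {ν : Measure Y} :
    UAC (ProbabilityMeasure.toFiniteMeasure '' 𝒲) ν ↔
      ∀ ε : ℝ≥0, 0 < ε → ∃ δ : ℝ≥0, 0 < δ ∧ ∀ W ∈ 𝒲, ∀ E : Set Y, MeasurableSet E →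
        ν E < δ → (W : Measure Y) E < ε := by
  rw [uac_iff]
  simp only [forall_mem_image]
  rfl

/-- If finitely many members of `𝒲` control all of `𝒲` at every level, then `𝒲` is uniformly
absolutely continuous with respect to a probability measure. -/
theorem exists_uac_of_finset (h𝒲 : 𝒲.Nonempty)
    (h : ∀ ε : ℝ≥0, 0 < ε → ∃ S : Finset (ProbabilityMeasure Y), (S : Set _) ⊆ 𝒲 ∧
      ∃ δ : ℝ≥0, 0 < δ ∧ ∀ W ∈ 𝒲, ∀ E : Set Y, MeasurableSet E →
        (∀ V ∈ S, (V : Measure Y) E < δ) → (W : Measure Y) E < ε) :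
    ∃ m : ProbabilityMeasure Y, UAC (ProbabilityMeasure.toFiniteMeasure '' 𝒲) m := by
  obtain ⟨W₀, hW₀⟩ := h𝒲
  have hpos : ∀ k : ℕ, (0 : ℝ≥0) < 1 / (k + 1) := fun k => by positivity
  choose S _ δ hδ hS using fun k : ℕ => h _ (hpos k)
  have hcount : ({W₀} ∪ ⋃ k, (S k : Set (ProbabilityMeasure Y))).Countable :=
    (countable_singleton _).union (countable_iUnion fun k => Finset.countable_toSet _)
  obtain ⟨V, hV⟩ := hcount.exists_eq_range ⟨W₀, Or.inl rfl⟩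
  -- A geometric mixture of all the countably many controlling measures. Each finite `S k` receives
  -- weights bounded below, so `m E` small enough forces `U E < δ k` for all `U ∈ S k`.
  let m : Measure Y := Measure.sum fun j => ((1 / 2 : ℝ≥0∞) ^ (j + 1)) • (V j : Measure Y)
  have hm : IsProbabilityMeasure m := by
    constructor
    rw [Measure.sum_apply _ MeasurableSet.univ]
    simp only [Measure.smul_apply, measure_univ, smul_eq_mul, mul_one]
    rw [ENNReal.tsum_geometric_add_one, one_div, ENNReal.one_sub_inv_two, inv_inv]
    exact ENNReal.inv_mul_cancel two_ne_zero ENNReal.ofNat_ne_top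
  refine ⟨⟨m, hm⟩, uac_toFiniteMeasure_iff.2 fun ε hε => ?_⟩
  obtain ⟨k, hk⟩ := exists_nat_one_div_lt (show (0 : ℝ) < ε from hε)
  have hSk : ∀ U ∈ S k, ∃ j, V j = U := fun U hU => by
    have : U ∈ range V := hV ▸ Or.inr (mem_iUnion.2 ⟨k, hU⟩)
    exact this
  choose! idx hidx using hSk
  refine ⟨δ k * (1 / 2) ^ ((S k).sup idx + 1), mul_pos (hδ k) (by positivity), ?_⟩
  intro W hW E hE hmE
  refine (hS k W hW E hE fun U hU => ?_).trans (by exact_mod_cast hk)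
  have h1 : (1 / 2 : ℝ≥0∞) ^ (idx U + 1) * (U : Measure Y) E ≤ m E := by
    rw [Measure.sum_apply _ hE]
    refine le_trans (le_of_eq ?_) (ENNReal.le_tsum (idx U))
    rw [hidx U hU]
    rfl
  have h2 : (1 / 2 : ℝ≥0∞) ^ ((S k).sup idx + 1) ≤ (1 / 2 : ℝ≥0∞) ^ (idx U + 1) :=
    pow_le_pow_of_le_one (by simp) (by simp)
      (Nat.succ_le_succ (Finset.le_sup hU))
  have h3 : (1 / 2 : ℝ≥0∞) ^ ((S k).sup idx + 1) * (U : Measure Y) E <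
      (1 / 2 : ℝ≥0∞) ^ ((S k).sup idx + 1) * δ k := by
    calc _ ≤ (1 / 2 : ℝ≥0∞) ^ (idx U + 1) * (U : Measure Y) E := by gcongr
      _ ≤ m E := h1
      _ < _ := hmE
      _ = _ := by simp [mul_comm, ENNReal.inv_pow]
  exact lt_of_mul_lt_mul_left' h3

/-- A failure of uniform absolute continuity is witnessed by a sequence of measures and sets. -/
theorem exists_seq_of_not_uac (h𝒲 : 𝒲.Nonempty)
    (h : ¬∃ m : ProbabilityMeasure Y, UAC (ProbabilityMeasure.toFiniteMeasure '' 𝒲) m) :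
    ∃ ε : ℝ≥0, 0 < ε ∧ ∃ (W : ℕ → ProbabilityMeasure Y) (E : ℕ → Set Y), (∀ n, W n ∈ 𝒲) ∧
      (∀ n, MeasurableSet (E n)) ∧ (∀ n, (ε : ℝ≥0∞) ≤ (W n : Measure Y) (E n)) ∧
      ∀ m n, m < n → (W m : Measure Y) (E n) ≤ ε * (1 / 2) ^ (n + 1) := by
  have h1 := mt (exists_uac_of_finset h𝒲) h
  push Not at h1
  obtain ⟨ε, hε, H⟩ := h1
  refine ⟨ε, hε, ?_⟩
  -- The third coordinate is a strictly increasing counter, hence at least `n` at stage `n`; this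
  -- yields the bound `ε * (1 / 2) ^ (n + 1)`.
  obtain ⟨f, hf, hf'⟩ := exists_seq_of_forall_finset_exists
    (P := fun x : ProbabilityMeasure Y × Set Y × ℕ =>
      x.1 ∈ 𝒲 ∧ MeasurableSet x.2.1 ∧ (ε : ℝ≥0∞) ≤ (x.1 : Measure Y) x.2.1)
    (r := fun x x' => (x.1 : Measure Y) x'.2.1 ≤ ε * (1 / 2) ^ (x'.2.2 + 1) ∧ x.2.2 < x'.2.2)
    (by
      classical
      intro s hs
      let k := s.sup (fun x => x.2.2) + 1
      obtain ⟨W, hW, E, hE, hEs, hWE⟩ := H (s.image Prod.fst)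
        (by
          intro V hV
          obtain ⟨x, hx, rfl⟩ := Finset.mem_image.1 (Finset.mem_coe.1 hV)
          exact (hs x hx).1) (ε * (1 / 2) ^ (k + 1)) (by positivity)
      refine ⟨(W, E, k), ⟨hW, hE, hWE⟩, fun x hx => ⟨?_, ?_⟩⟩
      · exact (hEs x.1 (Finset.mem_image_of_mem _ hx)).le.trans
          (le_of_eq (by simp [ENNReal.inv_pow]))
      · exact Nat.lt_succ_of_le (Finset.le_sup (f := fun x => x.2.2) hx))
  have hmono : StrictMono fun n => (f n).2.2 := fun m n hmn => (hf' m n hmn).2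
  refine ⟨fun n => (f n).1, fun n => (f n).2.1, fun n => (hf n).1, fun n => (hf n).2.1,
    fun n => (hf n).2.2, fun m n hmn => (hf' m n hmn).1.trans ?_⟩
  refine mul_le_mul' le_rfl ?_
  exact pow_le_pow_right_of_le_one' (by simp) (Nat.succ_le_succ (hmono.id_le n))

/-- Take a cluster point `s` of the sequence `W n` and the tails `F n = ⋃ m ≥ n, E m`. Since `W k (F
n) ≥ ε` for all `k ≥ n`, also `s (F n) ≥ ε`. By Borel–Cantelli every `W i` vanishes on `⋂ n, F n`,
hence so does `s`, contradicting continuity from above. -/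
theorem exists_uac_of_relativelyCompact (h𝒲 : 𝒲.Nonempty)
    (h : RelativelyCompact (setwiseTopology Y) (ProbabilityMeasure.toFiniteMeasure '' 𝒲)) :
    ∃ m : ProbabilityMeasure Y, UAC (ProbabilityMeasure.toFiniteMeasure '' 𝒲) m := by
  by_contra hcon
  obtain ⟨ε, hε, W, E, hW, hE, hWE, hsmall⟩ := exists_seq_of_not_uac h𝒲 hcon
  let := setwiseTopology Y
  have hc : ∀ E : Set Y, MeasurableSet E → Continuous fun s : SignedMeasure Y => s E :=
    fun E hE => continuous_iff_le_induced.2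
      (iInf_le (fun E : {E : Set Y // MeasurableSet E} =>
        TopologicalSpace.induced (fun s : SignedMeasure Y => s E) inferInstance) ⟨E, hE⟩)
  obtain ⟨s, -, hs⟩ := h.exists_mapClusterPt (f := atTop)
    (u := fun n => toSigned (W n).toFiniteMeasure)
    (tendsto_principal.2 (Eventually.of_forall fun n =>
      subset_closure ⟨_, ⟨W n, hW n, rfl⟩, rfl⟩))
  have hval : ∀ n (B : Set Y), MeasurableSet B →
      toSigned (W n).toFiniteMeasure B = (W n : Measure Y).real B := fun n B hB =>
    Measure.toSignedMeasure_apply_measurable hB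
  have hclus : ∀ (B : Set Y), MeasurableSet B → ∀ T : Set ℝ, IsClosed T →
      (∀ᶠ n in atTop, (W n : Measure Y).real B ∈ T) → s B ∈ T := by
    intro B hB T hT hev
    have h1 := (hs.continuousAt_comp (hc B hB).continuousAt)
    refine hT.mem_of_mapClusterPt h1 ?_
    filter_upwards [hev] with n hn
    rwa [Function.comp_apply, hval n B hB]
  let F : ℕ → Set Y := fun n => ⋃ m, E (m + n)
  have hF : ∀ n, MeasurableSet (F n) := fun n => MeasurableSet.iUnion fun m => hE _
  have hanti : Antitone F := by
    intro a b hab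
    refine iUnion_subset fun m => ?_
    have : m + b = m + (b - a) + a := by omega
    rw [this]
    exact subset_iUnion (fun m => E (m + a)) _
  have h1 : ∀ n, (ε : ℝ) ≤ s (F n) := by
    intro n
    refine hclus _ (hF n) (Ici (ε : ℝ)) isClosed_Ici ?_
    filter_upwards [eventually_ge_atTop n] with k hk
    have h2 : E k ⊆ F n := by
      have : k = (k - n) + n := by omega
      rw [this]
      exact subset_iUnion (fun m => E (m + n)) _
    have := (hWE k).trans (measure_mono h2)
    exact ENNReal.toReal_mono (measure_ne_top _ _) this
  have h2 : s (⋂ n, F n) = 0 := by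
    refine hclus _ (MeasurableSet.iInter hF) {0} isClosed_singleton (Eventually.of_forall fun i => ?_)
    have h3 : (W i : Measure Y) (limsup E atTop) = 0 := by
      refine measure_limsup_atTop_eq_zero ?_
      -- Only the sets with index beyond `i` are controlled by `W i`; the finitely many earlier
      -- terms are merely finite.
      have h4 : ∑' n, (W i : Measure Y) (E (n + (i + 1))) ≠ ⊤ := by
        refine ne_top_of_le_ne_top ?_ (ENNReal.tsum_le_tsum fun n => hsmall i _ (by omega))
        rw [ENNReal.tsum_mul_left]
        refine ENNReal.mul_ne_top ENNReal.coe_ne_top ?_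
        have : ∀ n, ((1 / 2 : ℝ≥0∞) ^ (n + (i + 1) + 1)) = (1 / 2) ^ (i + 2) * (1 / 2) ^ n := by
          intro n; rw [← pow_add]; congr 1; omega
        simp only [this]
        rw [ENNReal.tsum_mul_left, ENNReal.tsum_geometric]
        refine ENNReal.mul_ne_top (by simp) ?_
        simp
      rw [← (ENNReal.summable (f := fun n => (W i : Measure Y) (E (n + (i + 1))))).sum_add_tsum_nat_add'
        (f := fun n => (W i : Measure Y) (E n))]
      exact ENNReal.add_ne_top.2 ⟨ENNReal.sum_ne_top.2 fun _ _ => measure_ne_top _ _, h4⟩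
    have h5 : (⋂ n, F n) = limsup E atTop := by
      rw [limsup_eq_iInf_iSup_of_nat']
      simp only [F, add_comm]
      rfl
    rw [mem_singleton_iff, measureReal_def, h5, h3, ENNReal.toReal_zero]
  have h3 := VectorMeasure.tendsto_vectorMeasure_iInter_atTop_nat (v := s) hanti hF
  have h4 := ge_of_tendsto' h3 h1
  rw [h2] at h4
  exact absurd hε (not_lt.2 (by exact_mod_cast h4))

end Renyi

/-! ### Bounds on masses at orders below one -/

namespace Renyi

variable {Y : Type*} [MeasurableSpace Y] {𝒲 : Set (ProbabilityMeasure Y)}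
  {P : ProbabilityMeasure Y →₀ ℝ≥0}

/-- Split each density into its parts on and off `A V` and apply Minkowski's inequality with
exponent `1 / a`. On the disjoint sets at most one summand is nonzero, so the power and the root
cancel and leave the weights `P V ^ (1 / a)`. Off them the order `a` mean is at most the arithmetic
mean, whose integral is at most `1 - η`. -/
theorem mass_rpow_le_of_disjoint (hP : P ∈ pmfs 𝒲) {a : ℝ} (ha : 0 < a) (ha1 : a ≤ 1)
    (A : ProbabilityMeasure Y → Set Y) (hA : ∀ V, MeasurableSet (A V))
    (hdisj : (P.support : Set (ProbabilityMeasure Y)).PairwiseDisjoint A) {η : ℝ≥0∞}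
    (hη : ∀ V ∈ P.support, η ≤ (V : Measure Y) (A V)) :
    ((meanMeasure (ENNReal.ofReal a) P).mass : ℝ≥0∞) ^ a ≤
      (∑ V ∈ P.support, (P V : ℝ≥0∞) ^ (1 / a)) ^ a + (1 - η) ^ a := by
  set ν := refMeasure P
  have hac : ∀ V ∈ P.support, (V : Measure Y) ≪ ν := fun V => absolutelyContinuous_refMeasure
  have hmeas : ∀ V : ProbabilityMeasure Y, Measurable ((V : Measure Y).rnDeriv ν) :=
    fun V => Measure.measurable_rnDeriv _ _
  let u : ProbabilityMeasure Y → Y → ℝ≥0∞ := fun V => (A V).indicator ((V : Measure Y).rnDeriv ν)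
  let v : ProbabilityMeasure Y → Y → ℝ≥0∞ := fun V => (A V)ᶜ.indicator ((V : Measure Y).rnDeriv ν)
  have hu : ∀ V, Measurable (u V) := fun V => (hmeas V).indicator (hA V)
  have hv : ∀ V, Measurable (v V) := fun V => (hmeas V).indicator (hA V).compl
  let f : Y → ℝ≥0∞ := fun y => ∑ V ∈ P.support, (P V : ℝ≥0∞) * u V y ^ a
  let g : Y → ℝ≥0∞ := fun y => ∑ V ∈ P.support, (P V : ℝ≥0∞) * v V y ^ a
  have hf : Measurable f := Finset.measurable_fun_sum _ fun V _ => ((hu V).pow_const _).const_mul _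
  have hg : Measurable g := Finset.measurable_fun_sum _ fun V _ => ((hv V).pow_const _).const_mul _
  have hM : ((meanMeasure (ENNReal.ofReal a) P).mass : ℝ≥0∞) =
      ∫⁻ y, (f + g) y ^ (1 / a) ∂ν := by
    rw [meanMeasure_mass hP _ ν hac]
    refine lintegral_congr fun y => ?_
    rw [powerMean_ofReal ha, Pi.add_apply, ← Finset.sum_add_distrib]
    congr 1
    refine Finset.sum_congr rfl fun V _ => ?_
    rw [← mul_add]
    congr 1
    by_cases hy : y ∈ A V <;> simp [u, v, hy, ha]
  have hadd := ENNReal.lintegral_Lp_add_le (μ := ν) hf.aemeasurable hg.aemeasurable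
    ((one_le_div ha).2 ha1)
  rw [one_div_one_div, ← hM] at hadd
  refine hadd.trans (add_le_add (ENNReal.rpow_le_rpow ?_ ha.le) (ENNReal.rpow_le_rpow ?_ ha.le))
  · calc ∫⁻ y, f y ^ (1 / a) ∂ν
        ≤ ∫⁻ y, ∑ V ∈ P.support, (P V : ℝ≥0∞) ^ (1 / a) * u V y ∂ν := by
          refine lintegral_mono fun y => ?_
          by_cases! h : ∃ V ∈ P.support, y ∈ A V
          · obtain ⟨V, hV, hy⟩ := h
            have h0 : ∀ U ∈ P.support, U ≠ V → u U y = 0 := fun U hU hUV => by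
              refine indicator_of_notMem (fun hyU => ?_) _
              exact Set.disjoint_left.1 (hdisj hU hV hUV) hyU hy
            have h1 : f y = (P V : ℝ≥0∞) * u V y ^ a :=
              Finset.sum_eq_single_of_mem V hV fun U hU hUV => by simp [h0 U hU hUV, ha]
            dsimp only
            rw [h1, ENNReal.mul_rpow_of_nonneg _ _ (by positivity), ← ENNReal.rpow_mul,
              mul_one_div_cancel ha.ne', ENNReal.rpow_one]
            exact Finset.single_le_sum (f := fun V => (P V : ℝ≥0∞) ^ (1 / a) * u V y)
              (fun _ _ => zero_le) hV
          · have h1 : f y = 0 := Finset.sum_eq_zero fun V hV => by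
              simp [u, indicator_of_notMem (h V hV), ha]
            simp [h1, ha]
      _ ≤ ∑ V ∈ P.support, (P V : ℝ≥0∞) ^ (1 / a) := by
          rw [lintegral_finsetSum _ fun V _ => (hu V).const_mul _]
          refine Finset.sum_le_sum fun V _ => ?_
          rw [lintegral_const_mul _ (hu V), lintegral_indicator (hA V)]
          refine mul_le_of_le_one_right' ?_
          exact (Measure.setLIntegral_rnDeriv_le _).trans prob_le_one
  · calc ∫⁻ y, g y ^ (1 / a) ∂ν
        ≤ ∫⁻ y, ∑ V ∈ P.support, (P V : ℝ≥0∞) * v V y ∂ν := by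
          refine lintegral_mono fun y => ?_
          have := powerMean_le_powerMean hP (ENNReal.ofReal_le_one.2 ha1) fun V => v V y
          rwa [powerMean_ofReal ha, powerMean_one] at this
      _ ≤ ∑ V ∈ P.support, (P V : ℝ≥0∞) * (1 - η) := by
          rw [lintegral_finsetSum _ fun V _ => (hv V).const_mul _]
          refine Finset.sum_le_sum fun V hV => ?_
          rw [lintegral_const_mul _ (hv V), lintegral_indicator (hA V).compl]
          gcongr
          refine (Measure.setLIntegral_rnDeriv_le _).trans ?_
          rw [prob_compl_eq_one_sub (hA V)]
          exact tsub_le_tsub_left (hη V hV) _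
      _ = 1 - η := by rw [← Finset.sum_mul, pmfs_sum_ennreal hP, one_mul]

/-- The uniform prior on a nonempty finite set. -/
def uniformPrior {X : Type*} (S : Finset X) : X →₀ ℝ≥0 :=
  Finsupp.indicator S fun _ _ => (S.card : ℝ≥0)⁻¹

theorem uniformPrior_apply {X : Type*} {S : Finset X} {x : X} (hx : x ∈ S) :
    uniformPrior S x = (S.card : ℝ≥0)⁻¹ := Finsupp.indicator_of_mem hx _

theorem support_uniformPrior {X : Type*} (S : Finset X) : (uniformPrior S).support = S := by
  ext x
  rw [Finsupp.mem_support_iff]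
  by_cases hx : x ∈ S
  · rw [uniformPrior_apply hx]
    simp only [hx, iff_true]
    exact inv_ne_zero (Nat.cast_ne_zero.2 (Finset.card_ne_zero_of_mem hx))
  · simp [uniformPrior, hx, Finsupp.indicator_of_notMem hx]

theorem uniformPrior_mem_pmfs {X : Type*} {S : Finset X} {A : Set X} (hS : S.Nonempty)
    (hSA : (S : Set X) ⊆ A) : uniformPrior S ∈ pmfs A := by
  refine ⟨by rwa [support_uniformPrior], ?_⟩
  rw [Finsupp.sum, support_uniformPrior, Finset.sum_congr rfl fun x hx => uniformPrior_apply hx,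
    Finset.sum_const, nsmul_eq_mul]
  exact mul_inv_cancel₀ (Nat.cast_ne_zero.2 (Finset.card_ne_zero.2 hS))

/-- If `𝒲` is not uniformly absolutely continuous with respect to any probability measure, then
the masses of the mean measures of order `a < 1` are bounded away from one. -/
theorem exists_mass_le_of_not_uac (h𝒲 : 𝒲.Nonempty)
    (h : ¬∃ m : ProbabilityMeasure Y, UAC (ProbabilityMeasure.toFiniteMeasure '' 𝒲) m) :
    ∃ t : ℝ, t < 1 ∧ 0 < t ∧ ∀ a : ℝ, 0 < a → a < 1 → ∃ P ∈ pmfs 𝒲,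
      ((meanMeasure (ENNReal.ofReal a) P).mass : ℝ) ≤ t := by
  obtain ⟨ε, hε, W, E, hW, hE, hWE, hsmall⟩ := exists_seq_of_not_uac h𝒲 h
  have hε1 : ε ≤ 1 := by
    have := (hWE 0).trans prob_le_one
    exact_mod_cast this
  have hε1' : (ε : ℝ) ≤ 1 := by exact_mod_cast hε1
  have hε' : (0 : ℝ) < ε := hε
  have hsum : ∀ n, (W n : Measure Y) (⋃ m, E (m + (n + 1))) ≤ ε / 2 := by
    intro n
    calc (W n : Measure Y) (⋃ m, E (m + (n + 1)))
        ≤ ∑' m, (W n : Measure Y) (E (m + (n + 1))) := measure_iUnion_le _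
      _ ≤ ∑' m, (ε : ℝ≥0∞) * (1 / 2) ^ (m + (n + 1) + 1) :=
          ENNReal.tsum_le_tsum fun m => hsmall n _ (by omega)
      _ ≤ ∑' m, (ε : ℝ≥0∞) / 2 * (1 / 2) ^ (m + 1) := by
          refine ENNReal.tsum_le_tsum fun m => ?_
          rw [show (ε : ℝ≥0∞) / 2 = ε * (1 / 2) by rw [one_div, div_eq_mul_inv], mul_assoc,
            ← pow_succ']
          exact mul_le_mul' le_rfl (pow_le_pow_right_of_le_one' (by simp) (by omega))
      _ = ε / 2 := by
          rw [ENNReal.tsum_mul_left, ENNReal.tsum_geometric_add_one, one_div,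
            ENNReal.one_sub_inv_two, inv_inv, ENNReal.inv_mul_cancel two_ne_zero ENNReal.ofNat_ne_top,
            mul_one]
  -- Removing the later sets makes the sequence disjoint and costs `W n` at most `ε / 2`.
  let A : ℕ → Set Y := fun n => E n \ ⋃ m, E (m + (n + 1))
  have hA : ∀ n, MeasurableSet (A n) := fun n =>
    (hE n).diff (MeasurableSet.iUnion fun m => hE _)
  have hAdisj : Pairwise (Function.onFun Disjoint A) := by
    refine (pairwise_disjoint_on A).2 fun m n hmn => Set.disjoint_left.2 fun y hy hy' => ?_
    refine hy.2 (mem_iUnion.2 ⟨n - (m + 1), ?_⟩)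
    rw [show n - (m + 1) + (m + 1) = n by omega]
    exact hy'.1
  have hWA : ∀ n, ((ε / 2 : ℝ≥0) : ℝ≥0∞) ≤ (W n : Measure Y) (A n) := by
    intro n
    have h1 := le_measure_sdiff (μ := (W n : Measure Y)) (s₁ := E n)
      (s₂ := ⋃ m, E (m + (n + 1)))
    refine le_trans ?_ h1
    rw [ENNReal.coe_div two_ne_zero]
    refine le_trans ?_ (tsub_le_tsub (hWE n) (hsum n))
    rw [ENNReal.coe_ofNat, ENNReal.sub_half ENNReal.coe_ne_top]
  -- A repetition `W m = W n` would give `ε ≤ W n (E n) ≤ ε * (1 / 2) ^ (n + 1)`. Distinctness makes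
  -- the uniform prior on the first `k` members have weights exactly `1 / k`.
  have hinj : Function.Injective W := by
    refine Function.Injective.of_lt_imp_ne fun m n hmn heq => ?_
    have h1 := hsmall m n hmn
    rw [heq] at h1
    have h2 := (hWE n).trans h1
    have h3 : ε * (1 / 2) ^ (n + 1) < ε :=
      mul_lt_of_lt_one_right hε (pow_lt_one₀ (by positivity) (by
        rw [div_lt_one two_pos]; exact one_lt_two) (by omega))
    have h4 : ε ≤ ε * (1 / 2) ^ (n + 1) := by
      rw [← ENNReal.coe_le_coe]
      simpa [ENNReal.inv_pow] using h2
    exact absurd h4 (not_le.2 h3)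
  -- With weights `1 / k` the first sum in `mass_rpow_le_of_disjoint` is `k ^ (1 - 1 / a)`, which
  -- tends to zero since `a < 1`. The limiting bound on the mass is `1 - ε / 2` for every `a`, so a
  -- slightly larger constant serves all `a` at once, with `k` depending on `a`.
  refine ⟨1 - ε / 4, by linarith, by linarith, fun a ha ha1 => ?_⟩
  have hlim : Tendsto (fun k : ℕ => ((k : ℝ) ^ (1 - 1 / a)) ^ a + (1 - ε / 2 : ℝ) ^ a) atTop
      (𝓝 (0 ^ a + (1 - ε / 2 : ℝ) ^ a)) := by
    refine Tendsto.add_const _ (Tendsto.rpow_const ?_ (Or.inr ha.le))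
    have h1 : 0 < 1 / a - 1 := by
      rw [sub_pos]
      exact (one_lt_div ha).2 ha1
    have := (tendsto_rpow_neg_atTop h1).comp tendsto_natCast_atTop_atTop
    refine this.congr fun k => ?_
    simp
  have hlt : (0 : ℝ) ^ a + (1 - ε / 2 : ℝ) ^ a < (1 - ε / 4) ^ a := by
    rw [Real.zero_rpow ha.ne', zero_add]
    exact Real.rpow_lt_rpow (by linarith) (by linarith) ha
  obtain ⟨k, hk, hk0⟩ := ((hlim.eventually_lt_const hlt).and (eventually_gt_atTop 0)).exists
  let S : Finset (ProbabilityMeasure Y) := (Finset.range k).map ⟨W, hinj⟩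
  have hcard : S.card = k := by simp [S]
  have hSne : S.Nonempty := by rw [← Finset.card_pos, hcard]; exact hk0
  have hP : uniformPrior S ∈ pmfs 𝒲 := by
    refine uniformPrior_mem_pmfs hSne ?_
    intro V hV
    obtain ⟨n, -, rfl⟩ := Finset.mem_map.1 (Finset.mem_coe.1 hV)
    exact hW n
  refine ⟨uniformPrior S, hP, ?_⟩
  let idx : ProbabilityMeasure Y → ℕ := Function.invFun W
  have hidx : ∀ n, idx (W n) = n := Function.leftInverse_invFun hinj
  have hb := mass_rpow_le_of_disjoint hP ha ha1.le (fun V => A (idx V)) (fun V => hA _)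
    (by
      rw [support_uniformPrior]
      intro U hU V hV hUV
      obtain ⟨m, -, rfl⟩ := Finset.mem_map.1 (Finset.mem_coe.1 hU)
      obtain ⟨n, -, rfl⟩ := Finset.mem_map.1 (Finset.mem_coe.1 hV)
      simp only [Function.onFun, Function.Embedding.coeFn_mk, hidx]
      exact hAdisj fun h => hUV (by rw [h]))
    (η := ((ε / 2 : ℝ≥0) : ℝ≥0∞))
    (by
      rw [support_uniformPrior]
      intro V hV
      obtain ⟨n, -, rfl⟩ := Finset.mem_map.1 hV
      simp only [Function.Embedding.coeFn_mk, hidx]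
      exact hWA n)
  rw [support_uniformPrior, Finset.sum_congr rfl fun V hV => by rw [uniformPrior_apply hV, hcard],
    Finset.sum_const, hcard] at hb
  have hfin : k • (((k : ℝ≥0)⁻¹ : ℝ≥0) : ℝ≥0∞) ^ (1 / a) ≠ ⊤ := by
    rw [nsmul_eq_mul]
    exact ENNReal.mul_ne_top (ENNReal.natCast_ne_top k)
      (ENNReal.rpow_ne_top_of_nonneg (by positivity) ENNReal.coe_ne_top)
  have hfin1 := ENNReal.rpow_ne_top_of_nonneg ha.le hfin
  have hfin2 : (1 - ((ε / 2 : ℝ≥0) : ℝ≥0∞)) ^ a ≠ ⊤ :=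
    ENNReal.rpow_ne_top_of_nonneg ha.le (by finiteness)
  have hb' : ((meanMeasure (ENNReal.ofReal a) (uniformPrior S)).mass : ℝ) ^ a ≤
      ((k : ℝ) ^ (1 - 1 / a)) ^ a + (1 - ε / 2 : ℝ) ^ a := by
    have h1 := ENNReal.toReal_mono (ENNReal.add_ne_top.2 ⟨hfin1, hfin2⟩) hb
    rw [ENNReal.toReal_add hfin1 hfin2, ← ENNReal.toReal_rpow, ← ENNReal.toReal_rpow,
      ← ENNReal.toReal_rpow, ENNReal.toReal_sub_of_le
        (by exact_mod_cast (half_le_self zero_le).trans hε1) ENNReal.one_ne_top] at h1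
    refine h1.trans (le_of_eq ?_)
    congr 2
    rw [nsmul_eq_mul, ENNReal.toReal_mul, ← ENNReal.toReal_rpow,
      Real.rpow_sub (by exact_mod_cast hk0), Real.rpow_one]
    simp [Real.inv_rpow, div_eq_mul_inv]
  refine (Real.rpow_le_rpow_iff (NNReal.coe_nonneg _) (by linarith) ha).1 (hb'.trans hk.le)

/-- For `v ≤ N` and `a < 1` one has `v ^ a ≥ N ^ (a - 1) * v`, so the order `a` sum of densities
dominates a multiple of the linear average of truncated densities. Integrals of the latter are at
least `t`. -/
theorem le_mass_of_truncation (hP : P ∈ pmfs 𝒲) {a : ℝ} (ha : 0 < a) (ha1 : a < 1)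
    (ν : Measure Y) [IsProbabilityMeasure ν] (hac : ∀ V ∈ P.support, (V : Measure Y) ≪ ν)
    {N : ℝ≥0} (hN : 0 < N) {t : ℝ≥0∞}
    (ht : ∀ V ∈ P.support, t ≤ ∫⁻ y, min ((V : Measure Y).rnDeriv ν y) N ∂ν) :
    (N : ℝ≥0∞) ^ (a - 1) * t ≤ ((meanMeasure (ENNReal.ofReal a) P).mass : ℝ≥0∞) ^ a := by
  let v : ProbabilityMeasure Y → Y → ℝ≥0∞ := fun V y => min ((V : Measure Y).rnDeriv ν y) N
  have hv : ∀ V, Measurable (v V) := fun V => (Measure.measurable_rnDeriv _ _).min measurable_const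
  have hN0 : (N : ℝ≥0∞) ≠ 0 := by exact_mod_cast hN.ne'
  have hpt : ∀ V y, (N : ℝ≥0∞) ^ (a - 1) * v V y ≤ ((V : Measure Y).rnDeriv ν y) ^ a := by
    intro V y
    refine le_trans ?_ (ENNReal.rpow_le_rpow (min_le_left _ (N : ℝ≥0∞)) ha.le)
    change _ ≤ v V y ^ a
    rcases eq_or_ne (v V y) 0 with h0 | h0
    · simp [h0]
    have hvN : v V y ≤ N := min_le_right _ _
    have hvt : v V y ≠ ⊤ := ne_top_of_le_ne_top ENNReal.coe_ne_top hvN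
    calc (N : ℝ≥0∞) ^ (a - 1) * v V y ≤ v V y ^ (a - 1) * v V y := by
          gcongr ?_ * _
          rw [show a - 1 = -(1 - a) by ring, ENNReal.rpow_neg, ENNReal.rpow_neg]
          exact ENNReal.inv_le_inv.2 (ENNReal.rpow_le_rpow hvN (by linarith))
      _ = v V y ^ a := by
          nth_rw 2 [← ENNReal.rpow_one (v V y)]
          rw [← ENNReal.rpow_add _ _ h0 hvt]
          congr 1
          ring
  let f : Y → ℝ≥0∞ := fun y => (N : ℝ≥0∞) ^ (a - 1) * ∑ V ∈ P.support, (P V : ℝ≥0∞) * v V y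
  have hsm : Measurable fun y => ∑ V ∈ P.support, (P V : ℝ≥0∞) * v V y :=
    Finset.measurable_fun_sum _ fun V _ => (hv V).const_mul _
  have hf : Measurable f := hsm.const_mul _
  have h1 : (N : ℝ≥0∞) ^ (a - 1) * t ≤ ∫⁻ y, f y ∂ν := by
    rw [lintegral_const_mul _ hsm, lintegral_finsetSum _ fun V _ => (hv V).const_mul _]
    gcongr
    calc t = ∑ V ∈ P.support, (P V : ℝ≥0∞) * t := by
          rw [← Finset.sum_mul, pmfs_sum_ennreal hP, one_mul]
      _ ≤ _ := by
          refine Finset.sum_le_sum fun V hV => ?_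
          rw [lintegral_const_mul _ (hv V)]
          gcongr
          exact ht V hV
  -- Hölder's inequality against the constant one, `ν` being a probability measure.
  have h2 : ∫⁻ y, f y ∂ν ≤ (∫⁻ y, f y ^ (1 / a) ∂ν) ^ a := by
    have := ENNReal.lintegral_mul_norm_pow_le (μ := ν) (f := fun y => f y ^ (1 / a))
      (g := fun _ => 1) (hf.pow_const _).aemeasurable aemeasurable_const ha.le
      (sub_nonneg.2 ha1.le) (by ring)
    simpa [← ENNReal.rpow_mul, inv_mul_cancel₀ ha.ne'] using this
  refine h1.trans (h2.trans (ENNReal.rpow_le_rpow ?_ ha.le))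
  rw [meanMeasure_mass hP _ ν hac]
  refine lintegral_mono fun y => ?_
  rw [powerMean_ofReal ha]
  refine ENNReal.rpow_le_rpow ?_ (by positivity)
  simp only [f]
  rw [Finset.mul_sum]
  refine Finset.sum_le_sum fun V _ => ?_
  rw [mul_left_comm]
  gcongr
  exact hpt V y

/-- Truncation of densities for a uniformly absolutely continuous family. -/
theorem exists_truncation {m : ProbabilityMeasure Y}
    (h : UAC (ProbabilityMeasure.toFiniteMeasure '' 𝒲) m) {ε : ℝ≥0} (hε : 0 < ε) :
    ∃ N : ℝ≥0, 0 < N ∧ ∀ V ∈ 𝒲,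
      1 - (ε : ℝ≥0∞) ≤ ∫⁻ y, min ((V : Measure Y).rnDeriv m y) N ∂(m : Measure Y) := by
  obtain ⟨δ, hδ, H⟩ := uac_toFiniteMeasure_iff.1 h ε hε
  -- By Markov's inequality the density reaches `2 / δ` only on a set of `m`-measure at most `δ /
  -- 2`.
  refine ⟨2 / δ, by positivity, fun V hV => ?_⟩
  have hac : (V : Measure Y) ≪ m := h.absolutelyContinuous ⟨V, hV, rfl⟩
  set N : ℝ≥0 := 2 / δ
  have hm := Measure.measurable_rnDeriv (V : Measure Y) m
  set E : Set Y := {y | (N : ℝ≥0∞) ≤ (V : Measure Y).rnDeriv m y} with hEdef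
  have hE : MeasurableSet E := measurableSet_le measurable_const hm
  have h1 : (N : ℝ≥0∞) * (m : Measure Y) E ≤ 1 :=
    (mul_meas_ge_le_lintegral hm _).trans (Measure.lintegral_rnDeriv_le.trans_eq measure_univ)
  have h2 : (m : Measure Y) E < δ := by
    refine lt_of_mul_lt_mul_left' (a := (N : ℝ≥0∞)) (h1.trans_lt ?_)
    rw [← ENNReal.coe_mul, div_mul_cancel₀ _ hδ.ne']
    simp
  have h3 := H V hV E hE h2
  calc 1 - (ε : ℝ≥0∞) ≤ 1 - (V : Measure Y) E := tsub_le_tsub_left h3.le _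
    _ = (V : Measure Y) Eᶜ := (prob_compl_eq_one_sub hE).symm
    _ = ∫⁻ y in Eᶜ, (V : Measure Y).rnDeriv m y ∂(m : Measure Y) :=
        (Measure.setLIntegral_rnDeriv hac _).symm
    _ ≤ ∫⁻ y in Eᶜ, min ((V : Measure Y).rnDeriv m y) N ∂(m : Measure Y) := by
        refine setLIntegral_mono (hm.min measurable_const) fun y hy => ?_
        rw [hEdef, mem_compl_iff, mem_ofPred_eq, not_le] at hy
        exact le_min le_rfl hy.le
    _ ≤ _ := setLIntegral_le_lintegral _ _

end Renyi

/-! ### The limit of `(1 - α) / α * C_α` at one -/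

namespace Renyi

variable {Y : Type*} [MeasurableSpace Y] {𝒲 : Set (ProbabilityMeasure Y)}
  {P : ProbabilityMeasure Y →₀ ℝ≥0}

/-- The factor cancels, so statement (i) says that the masses of the order `a` mean measures tend to
one uniformly over priors as `a ↑ 1`. -/
theorem mul_information_ofReal {a : ℝ} (ha : 0 < a) (ha1 : a < 1) :
    (1 - a) / a * information (ENNReal.ofReal a) P =
      -Real.log (meanMeasure (ENNReal.ofReal a) P).mass := by
  rw [information_ofReal ha ha1.ne]
  have : a - 1 ≠ 0 := by linarith
  field_simp
  ring

theorem mul_capacity_le {a y : ℝ} (ha : 0 < a) (ha1 : a < 1)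
    (h : ∀ P ∈ pmfs 𝒲, -Real.log (meanMeasure (ENNReal.ofReal a) P).mass ≤ y) :
    (((1 - a) / a : ℝ) : EReal) * capacity (ENNReal.ofReal a) 𝒲 ≤ y := by
  have hpos : 0 < (1 - a) / a := div_pos (by linarith) ha
  have h1 : capacity (ENNReal.ofReal a) 𝒲 ≤ ((y / ((1 - a) / a) : ℝ) : EReal) := by
    refine iSup₂_le fun P hP => EReal.coe_le_coe_iff.2 ?_
    rw [le_div_iff₀ hpos, mul_comm, mul_information_ofReal ha ha1]
    exact h P hP
  refine (mul_le_mul_of_nonneg_left h1 (EReal.coe_nonneg.2 hpos.le)).trans (le_of_eq ?_)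
  rw [← EReal.coe_mul, mul_div_cancel₀ _ hpos.ne']

theorem le_mul_capacity (hP : P ∈ pmfs 𝒲) {a : ℝ} (ha : 0 < a) (ha1 : a < 1) :
    ((-Real.log (meanMeasure (ENNReal.ofReal a) P).mass : ℝ) : EReal) ≤
      (((1 - a) / a : ℝ) : EReal) * capacity (ENNReal.ofReal a) 𝒲 := by
  have hpos : 0 < (1 - a) / a := div_pos (by linarith) ha
  rw [← mul_information_ofReal ha ha1, EReal.coe_mul]
  exact mul_le_mul_of_nonneg_left (le_capacity hP _) (EReal.coe_nonneg.2 hpos.le)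

theorem exists_uac_of_tendsto (h𝒲 : 𝒲.Nonempty)
    (h : Tendsto (fun α : ℝ => (((1 - α) / α : ℝ) : EReal) * capacity (ENNReal.ofReal α) 𝒲)
      (𝓝[<] 1) (𝓝 0)) :
    ∃ m : ProbabilityMeasure Y, UAC (ProbabilityMeasure.toFiniteMeasure '' 𝒲) m := by
  by_contra hcon
  obtain ⟨t, ht1, ht0, H⟩ := exists_mass_le_of_not_uac h𝒲 hcon
  have hpos : (0 : EReal) < ((-Real.log t : ℝ) : EReal) :=
    EReal.coe_pos.2 (neg_pos.2 (Real.log_neg ht0 ht1))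
  have h01 : ∀ᶠ a : ℝ in 𝓝[<] 1, a ∈ Ioo (0 : ℝ) 1 := Ioo_mem_nhdsLT one_pos
  obtain ⟨a, ha, ha0, ha1⟩ := ((h.eventually_lt_const hpos).and h01).exists
  obtain ⟨P, hP, hPt⟩ := H a ha0 ha1
  have h1 := (le_mul_capacity hP ha0 ha1).trans_lt ha
  rw [EReal.coe_lt_coe_iff, neg_lt_neg_iff] at h1
  have hM : (0 : ℝ) < (meanMeasure (ENNReal.ofReal a) P).mass :=
    mass_pos hP (by simpa using ha0)
  exact absurd (Real.log_le_log hM hPt) (not_le.2 h1)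

theorem tendsto_of_uac (h𝒲 : 𝒲.Nonempty) {m : ProbabilityMeasure Y}
    (h : UAC (ProbabilityMeasure.toFiniteMeasure '' 𝒲) m) :
    Tendsto (fun α : ℝ => (((1 - α) / α : ℝ) : EReal) * capacity (ENNReal.ofReal α) 𝒲)
      (𝓝[<] 1) (𝓝 0) := by
  have h01 : ∀ᶠ a : ℝ in 𝓝[<] 1, a ∈ Ioo (0 : ℝ) 1 := Ioo_mem_nhdsLT one_pos
  obtain ⟨W₀, hW₀⟩ := h𝒲
  refine tendsto_order.2 ⟨fun b hb => ?_, fun b hb => ?_⟩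
  · filter_upwards [h01] with a ⟨ha, ha1⟩
    refine hb.trans_le (le_trans ?_ (le_mul_capacity (single_mem_pmfs hW₀) ha ha1))
    rw [EReal.coe_nonneg, neg_nonneg]
    refine Real.log_nonpos (NNReal.coe_nonneg _) ?_
    exact_mod_cast mass_le_one (single_mem_pmfs hW₀) (ENNReal.ofReal_le_one.2 ha1.le)
  obtain ⟨c, hc0, hcb⟩ := EReal.lt_iff_exists_real_btwn.1 hb
  have hc : 0 < c := EReal.coe_pos.1 hc0
  have hexp : Real.exp (-(c / 2)) < 1 := Real.exp_lt_one_iff.2 (by linarith)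
  -- Truncated masses at least `1 - ε = exp (-c / 2)` give `-log mass ≤ (1 - a) / a * log N + c / (2
  -- * a)`, whose limit at `a = 1` is `c / 2 < c`.
  obtain ⟨ε, hε⟩ : ∃ ε : ℝ≥0, (ε : ℝ) = 1 - Real.exp (-(c / 2)) :=
    ⟨⟨1 - Real.exp (-(c / 2)), by linarith⟩, rfl⟩
  obtain ⟨N, hN, H⟩ := exists_truncation h (ε := ε) (by
    rw [← NNReal.coe_pos, hε]
    linarith)
  have hlim : Tendsto (fun a : ℝ => (1 - a) / a * Real.log N + 1 / a * (c / 2)) (𝓝[<] 1)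
      (𝓝 ((1 - 1) / 1 * Real.log N + 1 / 1 * (c / 2))) := by
    refine tendsto_nhdsWithin_of_tendsto_nhds (ContinuousAt.tendsto ?_)
    fun_prop (disch := norm_num)
  filter_upwards [h01, hlim.eventually_lt_const (show _ < c by linarith)] with a ⟨ha, ha1⟩ hac
  refine lt_of_le_of_lt ?_ hcb
  refine (mul_capacity_le ha ha1 fun P hP => ?_).trans (EReal.coe_le_coe_iff.2 hac.le)
  have h1 := le_mass_of_truncation hP ha ha1 (m : Measure Y)
    (fun V hV => h.absolutelyContinuous ⟨V, hP.1 hV, rfl⟩) hN (fun V hV => H V (hP.1 hV))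
  have hM : (0 : ℝ) < (meanMeasure (ENNReal.ofReal a) P).mass :=
    mass_pos hP (by simpa using ha)
  have h2 := ENNReal.toReal_mono (ENNReal.rpow_ne_top_of_nonneg ha.le ENNReal.coe_ne_top) h1
  have h3 : (1 - (ε : ℝ≥0∞)).toReal = Real.exp (-(c / 2)) := by
    rw [ENNReal.toReal_sub_of_le (by
      rw [ENNReal.coe_le_one_iff, ← NNReal.coe_le_coe, hε]
      simp [Real.exp_nonneg]) ENNReal.one_ne_top, ENNReal.coe_toReal, hε]
    simp
  rw [ENNReal.toReal_mul, h3, ← ENNReal.toReal_rpow, ← ENNReal.toReal_rpow,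
    ENNReal.coe_toReal, ENNReal.coe_toReal] at h2
  have hN' : (0 : ℝ) < N := hN
  have h4 := Real.log_le_log (mul_pos (Real.rpow_pos_of_pos hN' _) (Real.exp_pos _)) h2
  rw [Real.log_mul (Real.rpow_pos_of_pos hN' _).ne' (Real.exp_pos _).ne', Real.log_rpow hN',
    Real.log_rpow hM, Real.log_exp] at h4
  have h5 : (1 - a) / a * Real.log N + 1 / a * (c / 2) =
      -(((a - 1) * Real.log N + -(c / 2)) / a) := by
    field_simp
    ring
  rw [h5, neg_le_neg_iff, div_le_iff₀ ha, mul_comm (Real.log _)]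
  exact h4

theorem equicontinuity_tfae (h𝒲 : 𝒲.Nonempty) :
    [Tendsto (fun α : ℝ => (((1 - α) / α : ℝ) : EReal) * capacity (ENNReal.ofReal α) 𝒲)
        (𝓝[<] 1) (𝓝 0),
      ∃ m : ProbabilityMeasure Y, UAC (ProbabilityMeasure.toFiniteMeasure '' 𝒲) m,
      RelativelyCompact (setwiseTopology Y) (ProbabilityMeasure.toFiniteMeasure '' 𝒲),
      RelativelyCompact (weakTopology Y) (ProbabilityMeasure.toFiniteMeasure '' 𝒲)].TFAE := by
  tfae_have 1 → 2 := exists_uac_of_tendsto h𝒲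
  tfae_have 2 → 1 := fun ⟨_, h⟩ => tendsto_of_uac h𝒲 h
  tfae_have 2 → 4 := fun ⟨_, h⟩ => h.relativelyCompact_weak (C := 1) (by
    rintro _ ⟨W, -, rfl⟩
    simp)
  tfae_have 4 → 3 := RelativelyCompact.setwise
  tfae_have 3 → 2 := exists_uac_of_relativelyCompact h𝒲
  tfae_finish

end Renyi

/-! ### Setwise convergence; closures at orders below one -/

namespace Renyi

variable {Y : Type*} [MeasurableSpace Y] {𝒲 : Set (ProbabilityMeasure Y)}
  {P : ProbabilityMeasure Y →₀ ℝ≥0}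

/-- Setwise convergence of probability measures along a filter. -/
def SetwiseTendsto {ι : Type*} (u : ι → ProbabilityMeasure Y) (F : Filter ι)
    (W : ProbabilityMeasure Y) : Prop :=
  ∀ E : Set Y, MeasurableSet E →
    Tendsto (fun i => (u i : Measure Y) E) F (𝓝 ((W : Measure Y) E))

namespace SetwiseTendsto

variable {ι : Type*} {u : ι → ProbabilityMeasure Y} {F : Filter ι} {W : ProbabilityMeasure Y}

/-- The integral is a supremum over simple functions, whose integrals are finite combinations of
masses of sets and hence converge. -/
theorem eventually_lt_lintegral (h : SetwiseTendsto u F W) (f : Y → ℝ≥0∞) {c : ℝ≥0∞}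
    (hc : c < ∫⁻ y, f y ∂(W : Measure Y)) : ∀ᶠ i in F, c < ∫⁻ y, f y ∂(u i : Measure Y) := by
  rw [lintegral_eq_nnreal] at hc
  obtain ⟨φ, hφ⟩ := lt_iSup_iff.1 hc
  obtain ⟨hφf, hφc⟩ := lt_iSup_iff.1 hφ
  have hlim : Tendsto (fun i => (φ.map ((↑) : ℝ≥0 → ℝ≥0∞)).lintegral (u i : Measure Y)) F
      (𝓝 ((φ.map ((↑) : ℝ≥0 → ℝ≥0∞)).lintegral (W : Measure Y))) := by
    simp only [SimpleFunc.map_lintegral]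
    refine tendsto_finsetSum _ fun x _ => ?_
    exact ENNReal.Tendsto.const_mul (h _ (φ.measurableSet_preimage _)) (Or.inr ENNReal.coe_ne_top)
  filter_upwards [hlim.eventually_const_lt hφc] with i hi
  refine hi.trans_le ?_
  rw [← SimpleFunc.lintegral_eq_lintegral]
  exact lintegral_mono fun y => hφf y

/-- Lower semicontinuity for `f` gives one half; for `C - f` it gives the other. -/
theorem tendsto_lintegral (h : SetwiseTendsto u F W) {f : Y → ℝ≥0∞} (hf : Measurable f)
    {C : ℝ≥0∞} (hC : C ≠ ⊤) (hfC : ∀ y, f y ≤ C) :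
    Tendsto (fun i => ∫⁻ y, f y ∂(u i : Measure Y)) F (𝓝 (∫⁻ y, f y ∂(W : Measure Y))) := by
  have hle : ∀ V : ProbabilityMeasure Y, ∫⁻ y, f y ∂(V : Measure Y) ≤ C := fun V =>
    (lintegral_mono hfC).trans (by simp)
  have hsub : ∀ V : ProbabilityMeasure Y,
      ∫⁻ y, (C - f y) ∂(V : Measure Y) = C - ∫⁻ y, f y ∂(V : Measure Y) := fun V => by
    rw [lintegral_sub hf (ne_top_of_le_ne_top hC (hle V)) (Eventually.of_forall hfC)]
    simp
  refine tendsto_order.2 ⟨fun c hc => h.eventually_lt_lintegral f hc, fun c hc => ?_⟩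
  rcases lt_or_ge C c with hCc | hCc
  · exact Eventually.of_forall fun i => (hle _).trans_lt hCc
  have h1 : C - c < ∫⁻ y, (C - f y) ∂(W : Measure Y) := by
    rw [hsub]
    refine ENNReal.sub_lt_of_lt_add hCc ?_
    calc C = (C - ∫⁻ y, f y ∂(W : Measure Y)) + ∫⁻ y, f y ∂(W : Measure Y) :=
          (tsub_add_cancel_of_le (hle W)).symm
      _ < (C - ∫⁻ y, f y ∂(W : Measure Y)) + c :=
          ENNReal.add_lt_add_left (ne_top_of_le_ne_top hC tsub_le_self) hc
  filter_upwards [h.eventually_lt_lintegral _ h1] with i hi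
  rw [hsub] at hi
  exact lt_of_tsub_lt_tsub_left hi

end SetwiseTendsto

theorem exists_setwiseTendsto_of_mem_closure {W : ProbabilityMeasure Y}
    (hW : W ∈ @closure _ (setwiseTopologyProb Y) 𝒲) :
    ∃ F : Filter (ProbabilityMeasure Y), F.NeBot ∧ 𝒲 ∈ F ∧ SetwiseTendsto id F W := by
  let := setwiseTopologyProb Y
  refine ⟨𝓝[𝒲] W, mem_closure_iff_nhdsWithin_neBot.1 hW, self_mem_nhdsWithin, fun E hE => ?_⟩
  have h1 : Continuous fun V : ProbabilityMeasure Y => (V : Measure Y).real E := by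
    have h2 : @Continuous _ _ (setwiseTopology Y) _ fun s : SignedMeasure Y => s E :=
      continuous_iff_le_induced.2
        (iInf_le (fun E : {E : Set Y // MeasurableSet E} =>
          TopologicalSpace.induced (fun s : SignedMeasure Y => s E) inferInstance) ⟨E, hE⟩)
    have h3 := @Continuous.comp _ _ _ _ (setwiseTopology Y) _ _ _ h2
      (continuous_induced_dom (f := fun W : ProbabilityMeasure Y => toSigned W.toFiniteMeasure))
    refine h3.congr fun V => ?_
    exact Measure.toSignedMeasure_apply_measurable hE
  have h2 := (ENNReal.continuous_ofReal.comp h1).tendsto W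
  have h3 : (fun V : ProbabilityMeasure Y => ENNReal.ofReal ((V : Measure Y).real E)) =
      fun V : ProbabilityMeasure Y => (V : Measure Y) E :=
    funext fun V => ofReal_measureReal (measure_ne_top _ _)
  simp only [Function.comp_def, h3] at h2
  rw [ofReal_measureReal (measure_ne_top _ _)] at h2
  exact h2.mono_left nhdsWithin_le_nhds

section LowerSemicontinuity

theorem sum_rpow_mul_rpow_le {X : Type*} (s : Finset X) (f g : X → ℝ≥0∞) {a : ℝ} (ha : 0 < a)
    (ha1 : a < 1) :
    ∑ i ∈ s, f i ^ a * g i ^ (1 - a) ≤ (∑ i ∈ s, f i) ^ a * (∑ i ∈ s, g i) ^ (1 - a) := by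
  have h1 : 0 < 1 - a := by linarith
  have hpq : (1 / a).HolderConjugate (1 / (1 - a)) := by
    rw [Real.holderConjugate_iff]
    refine ⟨(one_lt_div ha).2 ha1, ?_⟩
    simp
  have := ENNReal.inner_le_Lp_mul_Lq s (fun i => f i ^ a) (fun i => g i ^ (1 - a)) hpq
  simpa [← ENNReal.rpow_mul, ha.ne', h1.ne'] using this

/-- The supporting linear functional of the power mean of order `a < 1`. -/
theorem powerMean_le_sum {X : Type*} (P : X →₀ ℝ≥0) {a : ℝ} (ha : 0 < a) (ha1 : a < 1)
    (t u : X → ℝ≥0∞) (hu0 : ∀ V ∈ P.support, u V ≠ 0) (hut : ∀ V ∈ P.support, u V ≠ ⊤) :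
    (∑ V ∈ P.support, (P V : ℝ≥0∞) * t V ^ a) ^ (1 / a) ≤
      ∑ V ∈ P.support, (P V : ℝ≥0∞) * u V ^ (a - 1) *
        powerMean (ENNReal.ofReal a) P u ^ (1 - a) * t V := by
  have h1 : 0 < 1 - a := by linarith
  -- Hölder's inequality for the factorisation `t ^ a = (t * u ^ (a - 1)) ^ a * (u ^ a) ^ (1 - a)`.
  have h := sum_rpow_mul_rpow_le P.support (fun V => (P V : ℝ≥0∞) * (t V * u V ^ (a - 1)))
    (fun V => (P V : ℝ≥0∞) * u V ^ a) ha ha1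
  have hL : ∑ V ∈ P.support, ((P V : ℝ≥0∞) * (t V * u V ^ (a - 1))) ^ a *
      ((P V : ℝ≥0∞) * u V ^ a) ^ (1 - a) = ∑ V ∈ P.support, (P V : ℝ≥0∞) * t V ^ a := by
    refine Finset.sum_congr rfl fun V hV => ?_
    have hP0 : (P V : ℝ≥0∞) ≠ 0 := by simpa using hV
    have hu := hu0 V hV
    rw [ENNReal.mul_rpow_of_nonneg _ _ ha.le, ENNReal.mul_rpow_of_nonneg _ _ ha.le,
      ENNReal.mul_rpow_of_nonneg _ _ h1.le, ← ENNReal.rpow_mul, ← ENNReal.rpow_mul]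
    calc _ = ((P V : ℝ≥0∞) ^ a * (P V : ℝ≥0∞) ^ (1 - a)) *
          (t V ^ a * (u V ^ ((a - 1) * a) * u V ^ (a * (1 - a)))) := by ring
      _ = _ := by
        rw [← ENNReal.rpow_add _ _ hP0 ENNReal.coe_ne_top, ← ENNReal.rpow_add _ _ hu (hut V hV)]
        ring_nf
        simp [mul_comm]
  rw [hL] at h
  calc (∑ V ∈ P.support, (P V : ℝ≥0∞) * t V ^ a) ^ (1 / a)
      ≤ ((∑ V ∈ P.support, (P V : ℝ≥0∞) * (t V * u V ^ (a - 1))) ^ a *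
          (∑ V ∈ P.support, (P V : ℝ≥0∞) * u V ^ a) ^ (1 - a)) ^ (1 / a) := by gcongr
    _ = (∑ V ∈ P.support, (P V : ℝ≥0∞) * (t V * u V ^ (a - 1))) *
          powerMean (ENNReal.ofReal a) P u ^ (1 - a) := by
        rw [powerMean_ofReal ha, ENNReal.mul_rpow_of_nonneg _ _ (by positivity),
          ← ENNReal.rpow_mul, mul_one_div_cancel ha.ne', ENNReal.rpow_one, ← ENNReal.rpow_mul,
          ← ENNReal.rpow_mul, mul_comm (1 - a)]
    _ = _ := by
        rw [Finset.sum_mul]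
        exact Finset.sum_congr rfl fun V _ => by ring

theorem sum_mapDomain {X : Type*} (P : X →₀ ℝ≥0) (T : X → X) (φ : X → ℝ≥0∞) :
    ∑ W ∈ (P.mapDomain T).support, (P.mapDomain T W : ℝ≥0∞) * φ W =
      ∑ V ∈ P.support, (P V : ℝ≥0∞) * φ (T V) :=
  Finsupp.sum_mapDomain_index (f := T) (s := P) (h := fun (W : X) (r : ℝ≥0) => (r : ℝ≥0∞) * φ W)
    (by simp) (by intros; push_cast; ring)

theorem mapDomain_mem_pmfs {X : Type*} {A B : Set X} {P : X →₀ ℝ≥0} (hP : P ∈ pmfs A) {T : X → X}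
    (hT : ∀ V ∈ P.support, T V ∈ B) : P.mapDomain T ∈ pmfs B := by
  classical
  refine ⟨fun W hW => ?_, ?_⟩
  · obtain ⟨V, hV, rfl⟩ := Finset.mem_image.1 (Finsupp.mapDomain_support (Finset.mem_coe.1 hW))
    exact hT V hV
  · rw [Finsupp.sum_mapDomain_index (by simp) (by simp)]
    exact hP.2

/-- Integrating the supporting functional at `u` bounds the mass by an expression linear in the
measures `T V`, which is where setwise convergence can act. The prior is pushed forward because `T`
may identify members of the support. -/
theorem mass_mapDomain_le (hP : P ∈ pmfs 𝒲) (T : ProbabilityMeasure Y → ProbabilityMeasure Y)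
    {a : ℝ} (ha : 0 < a) (ha1 : a < 1) (u : ProbabilityMeasure Y → Y → ℝ≥0∞)
    (hu : ∀ V, Measurable (u V)) (hu0 : ∀ V ∈ P.support, ∀ y, u V y ≠ 0)
    (hut : ∀ V ∈ P.support, ∀ y, u V y ≠ ⊤) :
    ((meanMeasure (ENNReal.ofReal a) (P.mapDomain T)).mass : ℝ≥0∞) ≤
      ∑ V ∈ P.support, ∫⁻ y, (P V : ℝ≥0∞) * u V y ^ (a - 1) *
        powerMean (ENNReal.ofReal a) P (fun V => u V y) ^ (1 - a) ∂(T V : Measure Y) := by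
  have hP' : P.mapDomain T ∈ pmfs (univ : Set (ProbabilityMeasure Y)) :=
    mapDomain_mem_pmfs hP fun _ _ => mem_univ _
  let ν : Measure Y := refMeasure (P.mapDomain T) + refMeasure (P.mapDomain T) +
    ∑ V ∈ P.support, (T V : Measure Y)
  have hac : ∀ W ∈ (P.mapDomain T).support, (W : Measure Y) ≪ ν := fun W hW =>
    (absolutelyContinuous_refMeasure hW).trans
      ((Measure.absolutelyContinuous_of_le (Measure.le_add_right le_rfl)).trans
        (Measure.absolutelyContinuous_of_le (Measure.le_add_right le_rfl)))
  have hacT : ∀ V ∈ P.support, (T V : Measure Y) ≪ ν := fun V hV =>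
    Measure.absolutelyContinuous_of_le
      ((Finset.single_le_sum (f := fun V => (T V : Measure Y)) (fun _ _ => Measure.zero_le _)
        hV).trans (Measure.le_add_left le_rfl))
  have hmeas : ∀ V, Measurable fun y => (P V : ℝ≥0∞) * u V y ^ (a - 1) *
        powerMean (ENNReal.ofReal a) P (fun V => u V y) ^ (1 - a) := fun V =>
    (((hu V).pow_const _).const_mul _).mul ((measurable_powerMean _ hu).pow_const _)
  rw [meanMeasure_mass hP' _ ν hac]
  calc _ ≤ ∫⁻ y, ∑ V ∈ P.support, (T V : Measure Y).rnDeriv ν y * ((P V : ℝ≥0∞) *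
        u V y ^ (a - 1) * powerMean (ENNReal.ofReal a) P (fun V => u V y) ^ (1 - a)) ∂ν := by
        refine lintegral_mono fun y => ?_
        dsimp only
        rw [powerMean_ofReal ha, sum_mapDomain]
        refine (powerMean_le_sum P ha ha1 _ (fun V => u V y) (fun V hV => hu0 V hV y)
          (fun V hV => hut V hV y)).trans (le_of_eq ?_)
        exact Finset.sum_congr rfl fun V _ => mul_comm _ _
    _ = _ := by
        have hm : ∀ V : ProbabilityMeasure Y, Measurable fun y => (T V : Measure Y).rnDeriv ν y *
            ((P V : ℝ≥0∞) * u V y ^ (a - 1) *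
              powerMean (ENNReal.ofReal a) P (fun V => u V y) ^ (1 - a)) :=
          fun V => (Measure.measurable_rnDeriv _ _).mul (hmeas V)
        rw [lintegral_finsetSum P.support fun V _ => hm V]
        exact Finset.sum_congr rfl fun V hV =>
          lintegral_rnDeriv_mul (hacT V hV) (hmeas V).aemeasurable

/-- Upper semicontinuity of the mass. The functional supporting the mean at a regularisation `u` of
the densities has bounded measurable coefficients `h V`. Replacing each `V` by a member of `𝒲` with
nearly the same integral of `h V` bounds the new mass by almost `∑ ∫ h V dV`, which is at most the
regularised mass. -/
theorem exists_mass_lt_of_closure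
    (hP : P ∈ pmfs (@closure _ (setwiseTopologyProb Y) 𝒲)) {a : ℝ} (ha : 0 < a) (ha1 : a < 1)
    {c : ℝ≥0} (hc : (meanMeasure (ENNReal.ofReal a) P).mass < c) :
    ∃ P' ∈ pmfs 𝒲, (meanMeasure (ENNReal.ofReal a) P').mass < c := by
  set ν := refMeasure P
  have hν : IsProbabilityMeasure ν := isProbabilityMeasure_refMeasure hP
  have h1a : 0 < 1 - a := by linarith
  have hac : ∀ V ∈ P.support, (V : Measure Y) ≪ ν := fun V => absolutelyContinuous_refMeasure
  set M := (meanMeasure (ENNReal.ofReal a) P).mass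
  -- Minkowski's inequality bounds the `a`-th power of the mass, after `δ` is added to all
  -- densities, by `M ^ a + δ ^ a`.
  obtain ⟨δ, hδ, hδM⟩ : ∃ δ : ℝ≥0, 0 < δ ∧ M ^ a + δ ^ a < c ^ a := by
    have hlt : M ^ a < c ^ a := NNReal.rpow_lt_rpow hc ha
    refine ⟨((c ^ a - M ^ a) / 2) ^ (1 / a), NNReal.rpow_pos (half_pos (tsub_pos_of_lt hlt)), ?_⟩
    rw [← NNReal.rpow_mul, one_div_mul_cancel ha.ne', NNReal.rpow_one]
    calc M ^ a + (c ^ a - M ^ a) / 2 < M ^ a + (c ^ a - M ^ a) := by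
          gcongr
          exact half_lt_self (tsub_pos_of_lt hlt)
      _ = c ^ a := add_tsub_cancel_of_le hlt.le
  have hδ0 : (δ : ℝ≥0∞) ≠ 0 := by exact_mod_cast hδ.ne'
  -- Capping at `(P V)⁻¹` changes nothing almost everywhere but makes the densities bounded at every
  -- point; adding `δ` keeps them away from zero, where `u ^ (a - 1)` blows up.
  let w : ProbabilityMeasure Y → Y → ℝ≥0∞ := fun V y =>
    min ((V : Measure Y).rnDeriv ν y) (P V : ℝ≥0∞)⁻¹
  let u : ProbabilityMeasure Y → Y → ℝ≥0∞ := fun V y => w V y + δ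
  have hw : ∀ V, Measurable (w V) := fun V => (Measure.measurable_rnDeriv _ _).min measurable_const
  have hu : ∀ V, Measurable (u V) := fun V => (hw V).add_const _
  have hinv : ∀ V ∈ P.support, (P V : ℝ≥0∞)⁻¹ ≠ ⊤ := fun V hV => by simpa using hV
  have hu0 : ∀ V ∈ P.support, ∀ y, u V y ≠ 0 := fun V _ y => by simp [u, hδ.ne']
  have hub : ∀ V y, u V y ≤ (P V : ℝ≥0∞)⁻¹ + δ := fun V y => by
    simp only [u, w]
    gcongr
    exact min_le_right _ _
  have hut : ∀ V ∈ P.support, ∀ y, u V y ≠ ⊤ := fun V hV y =>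
    ne_top_of_le_ne_top (ENNReal.add_ne_top.2 ⟨hinv V hV, ENNReal.coe_ne_top⟩) (hub V y)
  have hwae : ∀ᵐ y ∂ν, ∀ V ∈ P.support, w V y = (V : Measure Y).rnDeriv ν y := by
    have := (Finset.eventually_all P.support).2 fun W hW => rnDeriv_refMeasure_le P hW
    filter_upwards [this] with y hy V hV
    exact min_eq_left (hy V hV)
  let ψ : Y → ℝ≥0∞ := fun y => powerMean (ENNReal.ofReal a) P fun V => u V y
  have hψ : Measurable ψ := measurable_powerMean _ hu
  let h : ProbabilityMeasure Y → Y → ℝ≥0∞ := fun V y =>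
    (P V : ℝ≥0∞) * u V y ^ (a - 1) * ψ y ^ (1 - a)
  have hh : ∀ V, Measurable (h V) := fun V =>
    (((hu V).pow_const _).const_mul _).mul (hψ.pow_const _)
  have hψb : ∀ y, ψ y ≤ powerMean (ENNReal.ofReal a) P fun V => (P V : ℝ≥0∞)⁻¹ + δ := fun y =>
    powerMean_mono _ _ fun V _ => hub V y
  have hψt : (powerMean (ENNReal.ofReal a) P fun V => (P V : ℝ≥0∞)⁻¹ + δ) ≠ ⊤ :=
    (powerMean_lt_top _ P fun V hV =>
      (ENNReal.add_ne_top.2 ⟨hinv V hV, ENNReal.coe_ne_top⟩).lt_top).ne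
  have hhb : ∀ V, ∃ C : ℝ≥0∞, C ≠ ⊤ ∧ ∀ y, h V y ≤ C := by
    intro V
    refine ⟨(P V : ℝ≥0∞) * (δ : ℝ≥0∞) ^ (a - 1) *
      (powerMean (ENNReal.ofReal a) P fun V => (P V : ℝ≥0∞)⁻¹ + δ) ^ (1 - a), ?_, fun y => ?_⟩
    · refine ENNReal.mul_ne_top (ENNReal.mul_ne_top ENNReal.coe_ne_top ?_)
        (ENNReal.rpow_ne_top_of_nonneg h1a.le hψt)
      simp [ENNReal.rpow_eq_top_iff, hδ.ne']
    · simp only [h]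
      refine mul_le_mul' (mul_le_mul' le_rfl ?_) ?_
      · rw [show a - 1 = -(1 - a) by ring, ENNReal.rpow_neg, ENNReal.rpow_neg]
        exact ENNReal.inv_le_inv.2 (ENNReal.rpow_le_rpow le_add_self h1a.le)
      · exact ENNReal.rpow_le_rpow (hψb y) h1a.le
  have hsum : ∑ V ∈ P.support, ∫⁻ y, h V y ∂(V : Measure Y) < c := by
    have e1 : ∑ V ∈ P.support, ∫⁻ y, h V y ∂(V : Measure Y) =
        ∫⁻ y, ∑ V ∈ P.support, (V : Measure Y).rnDeriv ν y * h V y ∂ν := by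
      have hm : ∀ V : ProbabilityMeasure Y, Measurable fun y => (V : Measure Y).rnDeriv ν y * h V y :=
        fun V => (Measure.measurable_rnDeriv _ _).mul (hh V)
      rw [lintegral_finsetSum P.support fun V _ => hm V]
      exact Finset.sum_congr rfl fun V hV =>
        (lintegral_rnDeriv_mul (hac V hV) (hh V).aemeasurable).symm
    have e2 : ∫⁻ y, ∑ V ∈ P.support, (V : Measure Y).rnDeriv ν y * h V y ∂ν ≤ ∫⁻ y, ψ y ∂ν := by
      refine lintegral_mono_ae ?_
      filter_upwards [hwae] with y hy
      calc ∑ V ∈ P.support, (V : Measure Y).rnDeriv ν y * h V y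
          ≤ ∑ V ∈ P.support, ((P V : ℝ≥0∞) * u V y ^ a) * ψ y ^ (1 - a) := by
            refine Finset.sum_le_sum fun V hV => ?_
            calc (V : Measure Y).rnDeriv ν y * h V y
                = (P V : ℝ≥0∞) * (u V y ^ (a - 1) * (V : Measure Y).rnDeriv ν y) * ψ y ^ (1 - a) := by
                  simp only [h]; ring
              _ ≤ (P V : ℝ≥0∞) * (u V y ^ (a - 1) * u V y) * ψ y ^ (1 - a) := by
                  gcongr
                  rw [← hy V hV]
                  exact le_self_add
              _ = _ := by
                  congr 2
                  nth_rw 2 [← ENNReal.rpow_one (u V y)]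
                  rw [← ENNReal.rpow_add _ _ (hu0 V hV y) (hut V hV y)]
                  congr 1
                  ring
        _ = ψ y ^ a * ψ y ^ (1 - a) := by
            rw [← Finset.sum_mul]
            simp only [ψ]
            rw [powerMean_ofReal ha, ← ENNReal.rpow_mul _ (1 / a) a, one_div_mul_cancel ha.ne',
              ENNReal.rpow_one]
        _ = ψ y := by
            rw [← ENNReal.rpow_add_of_nonneg _ _ ha.le h1a.le]
            simp
    have e3 : (∫⁻ y, ψ y ∂ν) ^ a ≤ (M : ℝ≥0∞) ^ a + (δ : ℝ≥0∞) ^ a := by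
      let f : Y → ℝ≥0∞ := fun y => ∑ V ∈ P.support, (P V : ℝ≥0∞) * (V : Measure Y).rnDeriv ν y ^ a
      have hf : Measurable f := Finset.measurable_fun_sum _ fun V _ =>
        ((Measure.measurable_rnDeriv _ _).pow_const _).const_mul _
      have hadd := ENNReal.lintegral_Lp_add_le (μ := ν) (f := f) (g := fun _ => (δ : ℝ≥0∞) ^ a)
        hf.aemeasurable aemeasurable_const ((one_le_div ha).2 ha1.le)
      rw [one_div_one_div] at hadd
      have hfM : ∫⁻ y, f y ^ (1 / a) ∂ν = M := by
        rw [meanMeasure_mass hP _ ν hac]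
        simp only [powerMean_ofReal ha, f]
      have hδc : ∫⁻ _, ((δ : ℝ≥0∞) ^ a) ^ (1 / a) ∂ν = δ := by
        rw [← ENNReal.rpow_mul, mul_one_div_cancel ha.ne', ENNReal.rpow_one]
        simp
      rw [hfM, hδc] at hadd
      refine le_trans (ENNReal.rpow_le_rpow (lintegral_mono_ae ?_) ha.le) hadd
      filter_upwards [hwae] with y hy
      simp only [ψ]
      rw [powerMean_ofReal ha]
      refine ENNReal.rpow_le_rpow ?_ (by positivity)
      calc ∑ V ∈ P.support, (P V : ℝ≥0∞) * u V y ^ a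
          ≤ ∑ V ∈ P.support, ((P V : ℝ≥0∞) * (V : Measure Y).rnDeriv ν y ^ a +
              (P V : ℝ≥0∞) * (δ : ℝ≥0∞) ^ a) := by
            refine Finset.sum_le_sum fun V hV => ?_
            rw [← mul_add, ← hy V hV]
            gcongr
            exact ENNReal.rpow_add_le_add_rpow _ _ ha.le ha1.le
        _ = _ := by
            rw [Finset.sum_add_distrib, ← Finset.sum_mul, pmfs_sum_ennreal hP, one_mul]
            rfl
    rw [e1]
    refine e2.trans_lt ?_
    rw [← ENNReal.rpow_lt_rpow_iff ha]
    refine e3.trans_lt ?_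
    rw [← ENNReal.coe_rpow_of_nonneg _ ha.le, ← ENNReal.coe_rpow_of_nonneg _ ha.le,
      ← ENNReal.coe_rpow_of_nonneg _ ha.le]
    exact_mod_cast hδM
  obtain ⟨r, hr, hrc⟩ := ENNReal.lt_iff_exists_add_pos_lt.1 hsum
  set n := P.support.card
  have hn : 0 < n := Finset.card_pos.2 (pmfs_support_nonempty hP)
  have hchoose : ∀ V, ∃ V' : ProbabilityMeasure Y, V ∈ P.support → V' ∈ 𝒲 ∧
      ∫⁻ y, h V y ∂(V' : Measure Y) < ∫⁻ y, h V y ∂(V : Measure Y) + (r / n : ℝ≥0) := by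
    intro V
    by_cases hV : V ∈ P.support
    swap
    · exact ⟨V, fun h => absurd h hV⟩
    obtain ⟨F, hF, hF𝒲, hFV⟩ := exists_setwiseTendsto_of_mem_closure (hP.1 hV)
    obtain ⟨C, hC, hhC⟩ := hhb V
    have hlim := hFV.tendsto_lintegral (hh V) hC hhC
    have hfin : ∫⁻ y, h V y ∂(V : Measure Y) ≠ ⊤ :=
      ne_top_of_le_ne_top hC ((lintegral_mono hhC).trans (by simp))
    have hlt : ∫⁻ y, h V y ∂(V : Measure Y) <
        ∫⁻ y, h V y ∂(V : Measure Y) + (r / n : ℝ≥0) :=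
      ENNReal.lt_add_right hfin (by
        have : 0 < r / n := div_pos hr (by exact_mod_cast hn)
        exact_mod_cast this.ne')
    obtain ⟨V', hV', hV'𝒲⟩ := ((hlim.eventually_lt_const hlt).and hF𝒲).exists
    exact ⟨V', fun _ => ⟨hV'𝒲, hV'⟩⟩
  choose T hT using hchoose
  refine ⟨P.mapDomain T, mapDomain_mem_pmfs hP fun V hV => (hT V hV).1, ?_⟩
  rw [← ENNReal.coe_lt_coe]
  refine (mass_mapDomain_le hP T ha ha1 u hu hu0 hut).trans_lt ?_
  refine lt_of_le_of_lt ?_ hrc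
  calc _ ≤ ∑ V ∈ P.support, (∫⁻ y, h V y ∂(V : Measure Y) + (r / n : ℝ≥0)) :=
        Finset.sum_le_sum fun V hV => (hT V hV).2.le
    _ = _ := by
        rw [Finset.sum_add_distrib, Finset.sum_const, nsmul_eq_mul]
        congr 1
        rw [← ENNReal.coe_natCast, ← ENNReal.coe_mul, mul_div_cancel₀]
        exact_mod_cast hn.ne'

theorem capacity_closure_of_lt_one {a : ℝ} (ha : 0 < a) (ha1 : a < 1) :
    capacity (ENNReal.ofReal a) (@closure _ (setwiseTopologyProb Y) 𝒲) ≤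
      capacity (ENNReal.ofReal a) 𝒲 := by
  refine iSup₂_le fun P hP => ?_
  rw [information_ofReal ha ha1.ne]
  have hM : 0 < (meanMeasure (ENNReal.ofReal a) P).mass := mass_pos hP (by simpa using ha)
  have hlim : Tendsto (fun c : ℝ≥0 => ((a / (a - 1) * Real.log c : ℝ) : EReal))
      (𝓝[>] (meanMeasure (ENNReal.ofReal a) P).mass)
      (𝓝 ((a / (a - 1) * Real.log (meanMeasure (ENNReal.ofReal a) P).mass : ℝ) : EReal)) := by
    refine tendsto_nhdsWithin_of_tendsto_nhds ?_
    refine (continuous_coe_real_ereal.tendsto _).comp (Tendsto.const_mul _ ?_)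
    exact (Real.continuousAt_log (by exact_mod_cast hM.ne')).tendsto.comp
      NNReal.continuous_coe.continuousAt
  refine le_of_tendsto hlim ?_
  filter_upwards [self_mem_nhdsWithin] with c hc
  obtain ⟨P', hP', hlt⟩ := exists_mass_lt_of_closure hP ha ha1 hc
  refine le_trans ?_ (le_capacity hP' _)
  rw [information_ofReal ha ha1.ne, EReal.coe_le_coe_iff]
  refine mul_le_mul_of_nonpos_left ?_ (div_nonpos_of_nonneg_of_nonpos ha.le (by linarith))
  have hM' : 0 < (meanMeasure (ENNReal.ofReal a) P').mass := mass_pos hP' (by simpa using ha)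
  exact Real.log_le_log (by exact_mod_cast hM') (by exact_mod_cast hlt.le)

end LowerSemicontinuity

end Renyi

/-! ### Divergences of convex functions: semicontinuity, uniform absolute continuity, kernels -/

namespace Renyi

variable {Y : Type*} [MeasurableSpace Y]

theorem SetwiseTendsto.tendsto_integral {ι : Type*} {u : ι → ProbabilityMeasure Y} {F : Filter ι}
    {W : ProbabilityMeasure Y} (h : SetwiseTendsto u F W) {f : Y → ℝ} (hf : Measurable f) {C : ℝ}
    (hfC : ∀ y, |f y| ≤ C) :
    Tendsto (fun i => ∫ y, f y ∂(u i : Measure Y)) F (𝓝 (∫ y, f y ∂(W : Measure Y))) := by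
  have key : ∀ V : ProbabilityMeasure Y, ∫ y, f y ∂(V : Measure Y) =
      (∫⁻ y, ENNReal.ofReal (f y + C) ∂(V : Measure Y)).toReal - C := fun V => by
    have hint : Integrable f (V : Measure Y) :=
      Integrable.of_bound hf.aestronglyMeasurable C (Eventually.of_forall hfC)
    rw [← integral_eq_lintegral_of_nonneg_ae, integral_add hint (integrable_const _)]
    · simp
    · refine Eventually.of_forall fun y => ?_
      have := neg_le_of_abs_le (hfC y)
      simp only [Pi.zero_apply]
      linarith
    · exact (hf.add_const C).aestronglyMeasurable
  have hb : ∀ y, ENNReal.ofReal (f y + C) ≤ ENNReal.ofReal (C + C) := fun y =>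
    ENNReal.ofReal_le_ofReal (by linarith [le_of_abs_le (hfC y)])
  have hlim := h.tendsto_lintegral (hf.add_const C).ennreal_ofReal ENNReal.ofReal_ne_top hb
  have hfin : ∫⁻ y, ENNReal.ofReal (f y + C) ∂(W : Measure Y) ≠ ⊤ :=
    ne_top_of_le_ne_top (ENNReal.ofReal_ne_top (r := C + C)) ((lintegral_mono hb).trans (by simp))
  simp only [key]
  exact ((ENNReal.tendsto_toReal hfin).comp hlim).sub_const C

/-! ### Divergences given by convex functions -/

open Classical in
/-- The divergence `∫ φ(dμ/dν) dν`, infinite unless `μ ≪ ν`. -/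
def fDiv (φ : ℝ → ℝ) (μ ν : Measure Y) : ℝ≥0∞ :=
  if μ ≪ ν then ∫⁻ y, ENNReal.ofReal (φ (μ.rnDeriv ν y).toReal) ∂ν else ⊤

theorem fDiv_of_ac {φ : ℝ → ℝ} {μ ν : Measure Y} (h : μ ≪ ν) :
    fDiv φ μ ν = ∫⁻ y, ENNReal.ofReal (φ (μ.rnDeriv ν y).toReal) ∂ν := if_pos h

theorem fDiv_klFun (μ ν : Measure Y) [IsFiniteMeasure μ] [IsFiniteMeasure ν] :
    fDiv InformationTheory.klFun μ ν = InformationTheory.klDiv μ ν :=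
  InformationTheory.klDiv_eq_lintegral_klFun.symm

theorem ac_of_fDiv_ne_top {φ : ℝ → ℝ} {μ ν : Measure Y} (h : fDiv φ μ ν ≠ ⊤) : μ ≪ ν := by
  by_contra hac
  exact h (if_neg hac)

theorem integral_add_integral_eq {μ ν : Measure Y} [IsFiniteMeasure μ] [IsFiniteMeasure ν]
    (h : μ ≪ ν) {a b : Y → ℝ} (ha : Measurable a) (hb : Measurable b) {C : ℝ}
    (haC : ∀ y, |a y| ≤ C) (hbC : ∀ y, |b y| ≤ C) :
    Integrable (fun y => a y * (μ.rnDeriv ν y).toReal + b y) ν ∧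
    ∫ y, a y ∂μ + ∫ y, b y ∂ν = ∫ y, (a y * (μ.rnDeriv ν y).toReal + b y) ∂ν := by
  have h1 : Integrable (fun y => a y * (μ.rnDeriv ν y).toReal) ν :=
    Measure.integrable_toReal_rnDeriv.bdd_mul ha.aestronglyMeasurable (Eventually.of_forall haC)
  have h2 : Integrable b ν :=
    Integrable.of_bound hb.aestronglyMeasurable C (Eventually.of_forall hbC)
  refine ⟨h1.add h2, ?_⟩
  rw [integral_add h1 h2, ← integral_rnDeriv_smul h (f := a)]
  simp only [smul_eq_mul, mul_comm]

theorem ofReal_integral_le_lintegral {ν : Measure Y} {f : Y → ℝ} (hf : Integrable f ν) :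
    ENNReal.ofReal (∫ y, f y ∂ν) ≤ ∫⁻ y, ENNReal.ofReal (f y) ∂ν := by
  have h1 : ∫ y, f y ∂ν ≤ ∫ y, max (f y) 0 ∂ν :=
    integral_mono hf hf.pos_part fun y => le_max_left _ _
  refine (ENNReal.ofReal_le_ofReal h1).trans ?_
  rw [ofReal_integral_eq_lintegral_ofReal hf.pos_part (Eventually.of_forall fun y => le_max_right _ _)]
  refine lintegral_mono fun y => ?_
  simp [ENNReal.ofReal_max]

/-- The easy half of a variational formula: evaluate the affine minorants at `dμ/dν` and integrate.
The integrals on the left pass to setwise limits in both measures, unlike the divergence itself. -/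
theorem ofReal_integral_add_le_fDiv {φ : ℝ → ℝ} {μ ν : Measure Y} [IsFiniteMeasure μ]
    [IsFiniteMeasure ν] {a b : Y → ℝ} (ha : Measurable a) (hb : Measurable b) {C : ℝ}
    (haC : ∀ y, |a y| ≤ C) (hbC : ∀ y, |b y| ≤ C) (hφ : ∀ y t, 0 ≤ t → a y * t + b y ≤ φ t) :
    ENNReal.ofReal (∫ y, a y ∂μ + ∫ y, b y ∂ν) ≤ fDiv φ μ ν := by
  by_cases h : μ ≪ ν
  · obtain ⟨hint, heq⟩ := integral_add_integral_eq h ha hb haC hbC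
    rw [fDiv_of_ac h, heq]
    refine (ofReal_integral_le_lintegral hint).trans (lintegral_mono fun y => ?_)
    exact ENNReal.ofReal_le_ofReal (hφ y _ ENNReal.toReal_nonneg)
  · simp [fDiv, h]

theorem ofReal_mul_add_mul_le_fDiv {φ : ℝ → ℝ} {μ ν : Measure Y} [IsFiniteMeasure μ]
    [IsFiniteMeasure ν] {a b : ℝ} (h0 : ∀ t, 0 ≤ t → 0 ≤ φ t) (hφ : ∀ t, 0 ≤ t → a * t + b ≤ φ t)
    {E : Set Y} (hE : MeasurableSet E) :
    ENNReal.ofReal (a * μ.real E + b * ν.real E) ≤ fDiv φ μ ν := by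
  have h := ofReal_integral_add_le_fDiv (φ := φ) (μ := μ) (ν := ν)
    (a := E.indicator fun _ => a) (b := E.indicator fun _ => b)
    (measurable_const.indicator hE) (measurable_const.indicator hE) (C := max |a| |b|) (fun y => ?_)
    (fun y => ?_) (fun y t ht => ?_)
  · rwa [integral_indicator_const _ hE, integral_indicator_const _ hE, smul_eq_mul, smul_eq_mul,
      mul_comm, mul_comm (ν.real E)] at h
  · by_cases hy : y ∈ E <;> simp [hy]
  · by_cases hy : y ∈ E <;> simp [hy]
  · by_cases hy : y ∈ E
    · simpa [hy] using hφ t ht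
    · simpa [hy] using h0 t ht

/-- A nonnegative superlinear function on `[0, ∞)` that is approximated from below by affine
minorants chosen in a measurable way. -/
structure IsDivergenceKernel (φ : ℝ → ℝ) : Prop where
  measurable : Measurable φ
  nonneg : ∀ t, 0 ≤ t → 0 ≤ φ t
  superlinear : ∀ A : ℝ, ∃ B : ℝ, 0 ≤ B ∧ ∀ t, 0 ≤ t → A * t + -B ≤ φ t
  approx : ∃ a b ψ : ℕ → ℝ → ℝ, (∀ n, Measurable (a n)) ∧ (∀ n, Measurable (b n)) ∧
    (∀ n, Measurable (ψ n)) ∧ (∀ n, ∃ C, ∀ r, |a n r| ≤ C ∧ |b n r| ≤ C) ∧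
    (∀ n r t, 0 ≤ t → a n r * t + b n r ≤ φ t) ∧
    (∀ n r, 0 ≤ r → 0 ≤ ψ n r ∧ ψ n r ≤ a n r * r + b n r) ∧
    ∀ r, 0 ≤ r → Tendsto (fun n => ψ n r) atTop (𝓝 (φ r))

namespace IsDivergenceKernel

variable {φ : ℝ → ℝ}

/-- Joint lower semicontinuity. The affine bounds pass to the limit. Steep minorants on a `Q`-null
set show `W ≪ Q`; the minorants of `approx` composed with the limiting density `dW/dQ` then recover
the divergence by Fatou's lemma. -/
theorem fDiv_le_of_setwiseTendsto (hφ : IsDivergenceKernel φ) {ι : Type*}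
    {u v : ι → ProbabilityMeasure Y} {F : Filter ι} [F.NeBot] {W Q : ProbabilityMeasure Y}
    (hu : SetwiseTendsto u F W) (hv : SetwiseTendsto v F Q) {K : ℝ≥0∞}
    (hK : ∀ᶠ i in F, fDiv φ (u i : Measure Y) (v i) ≤ K) : fDiv φ (W : Measure Y) Q ≤ K := by
  rcases eq_or_ne K ⊤ with rfl | hKt
  · exact le_top
  have hlim : ∀ a b : Y → ℝ, Measurable a → Measurable b → ∀ C : ℝ, (∀ y, |a y| ≤ C) →
      (∀ y, |b y| ≤ C) → (∀ y t, 0 ≤ t → a y * t + b y ≤ φ t) →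
      ENNReal.ofReal (∫ y, a y ∂(W : Measure Y) + ∫ y, b y ∂(Q : Measure Y)) ≤ K := by
    intro a b ha hb C haC hbC hab
    refine le_of_tendsto (ENNReal.tendsto_ofReal
      ((hu.tendsto_integral ha haC).add (hv.tendsto_integral hb hbC))) ?_
    filter_upwards [hK] with i hi
    exact (ofReal_integral_add_le_fDiv ha hb haC hbC hab).trans hi
  have hac : (W : Measure Y) ≪ Q := by
    refine Measure.AbsolutelyContinuous.mk fun E hE hQE => ?_
    by_contra hWE
    have hpos : 0 < (W : Measure Y).real E := by
      rw [measureReal_def]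
      exact ENNReal.toReal_pos hWE (measure_ne_top _ _)
    obtain ⟨B, -, hB⟩ := hφ.superlinear ((K.toReal + 1) / (W : Measure Y).real E)
    have h := hlim (E.indicator fun _ => (K.toReal + 1) / (W : Measure Y).real E)
      (E.indicator fun _ => -B) (measurable_const.indicator hE) (measurable_const.indicator hE)
      (max |(K.toReal + 1) / (W : Measure Y).real E| |-B|) (fun y => by
        by_cases hy : y ∈ E <;> simp [hy]) (fun y => by
        by_cases hy : y ∈ E <;> simp [hy]) (fun y t ht => by
        by_cases hy : y ∈ E
        · simpa [hy] using hB t ht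
        · simpa [hy] using hφ.nonneg t ht)
    rw [integral_indicator_const _ hE, integral_indicator_const _ hE, smul_eq_mul, smul_eq_mul,
      mul_div_cancel₀ _ hpos.ne', measureReal_def (Q : Measure Y), hQE] at h
    have h2 := (ENNReal.ofReal_le_iff_le_toReal hKt).1 h
    simp at h2
    linarith
  obtain ⟨a, b, ψ, ham, hbm, hψm, hC, hab, hψ, hψlim⟩ := hφ.approx
  let f : Y → ℝ := fun y => ((W : Measure Y).rnDeriv Q y).toReal
  have hf : Measurable f := (Measure.measurable_rnDeriv _ _).ennreal_toReal
  have hf0 : ∀ y, 0 ≤ f y := fun y => ENNReal.toReal_nonneg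
  have hn : ∀ n, ∫⁻ y, ENNReal.ofReal (ψ n (f y)) ∂(Q : Measure Y) ≤ K := by
    intro n
    obtain ⟨C, hC⟩ := hC n
    have h1 := hlim (fun y => a n (f y)) (fun y => b n (f y)) ((ham n).comp hf) ((hbm n).comp hf) C
      (fun y => (hC _).1) (fun y => (hC _).2) (fun y t ht => hab n _ t ht)
    obtain ⟨hint, heq⟩ := integral_add_integral_eq hac (a := fun y => a n (f y))
      (b := fun y => b n (f y)) ((ham n).comp hf) ((hbm n).comp hf)
      (fun y => (hC _).1) (fun y => (hC _).2)
    rw [heq, ofReal_integral_eq_lintegral_ofReal hint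
      (Eventually.of_forall fun y => (hψ n (f y) (hf0 y)).1.trans (hψ n (f y) (hf0 y)).2)] at h1
    exact (lintegral_mono fun y => ENNReal.ofReal_le_ofReal (hψ n (f y) (hf0 y)).2).trans h1
  rw [fDiv_of_ac hac]
  calc ∫⁻ y, ENNReal.ofReal (φ (f y)) ∂(Q : Measure Y)
      = ∫⁻ y, liminf (fun n => ENNReal.ofReal (ψ n (f y))) atTop ∂(Q : Measure Y) := by
        refine lintegral_congr fun y => ?_
        exact (ENNReal.tendsto_ofReal (hψlim (f y) (hf0 y))).liminf_eq.symm
    _ ≤ liminf (fun n => ∫⁻ y, ENNReal.ofReal (ψ n (f y)) ∂(Q : Measure Y)) atTop :=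
        lintegral_liminf_le fun n => ((hψm n).comp hf).ennreal_ofReal
    _ ≤ K := liminf_le_of_frequently_le' (Frequently.of_forall hn)

/-- The de la Vallée Poussin argument: superlinearity gives `A * μ E - B * Q E ≤ K`. With `A = (K +
1) / ε` and `B * Q E < 1` this forces `μ E < ε`. -/
theorem uac_of_fDiv_le (hφ : IsDivergenceKernel φ) {S : Set (FiniteMeasure Y)} {Q : Measure Y}
    [IsFiniteMeasure Q] {K : ℝ≥0∞} (hK : K ≠ ⊤) (h : ∀ μ ∈ S, fDiv φ (μ : Measure Y) Q ≤ K) :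
    UAC S Q := by
  intro ε hε
  have hε' : (0 : ℝ) < ε := by exact_mod_cast hε
  have hK0 : 0 ≤ K.toReal := ENNReal.toReal_nonneg
  obtain ⟨B, hB0, hB⟩ := hφ.superlinear ((K.toReal + 1) / ε)
  refine ⟨(1 / (B + 1)).toNNReal, by simp; linarith, fun μ hμ E hE hQ => ?_⟩
  have h1 := (ofReal_mul_add_mul_le_fDiv (μ := (μ : Measure Y)) (ν := Q) hφ.nonneg hB hE).trans
    (h μ hμ)
  have h2 := (ENNReal.ofReal_le_iff_le_toReal hK).1 h1
  have hQ' : Q.real E < 1 / (B + 1) := by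
    rw [measureReal_def]
    refine (ENNReal.toReal_lt_of_lt_ofReal ?_)
    exact hQ
  have hBQ : B * Q.real E < 1 := by
    calc B * Q.real E ≤ B * (1 / (B + 1)) := by gcongr
      _ < 1 := by rw [mul_one_div, div_lt_one (by linarith)]; linarith
  have h3 : (K.toReal + 1) / ε * (μ : Measure Y).real E < K.toReal + 1 := by linarith
  have h4 : (μ : Measure Y).real E < ε := by
    rw [div_mul_eq_mul_div, div_lt_iff₀ hε'] at h3
    exact lt_of_mul_lt_mul_left h3 (by linarith)
  exact_mod_cast h4

end IsDivergenceKernel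

/-! ### The relative entropy kernel -/

section KL

open InformationTheory

/-- The left side is the tangent to `klFun` at `exp l`; the inequality is `1 + x ≤ exp x` at `x = l
- log t`. -/
theorem mul_add_le_klFun (l : ℝ) {t : ℝ} (ht : 0 ≤ t) : l * t + (1 - Real.exp l) ≤ klFun t := by
  rw [klFun_apply]
  rcases ht.eq_or_lt with rfl | ht
  · simp [Real.exp_nonneg]
  · have h := Real.add_one_le_exp (l - Real.log t)
    rw [Real.exp_sub, Real.exp_log ht, le_div_iff₀ ht] at h
    linarith

theorem isDivergenceKernel_klFun : IsDivergenceKernel klFun where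
  measurable := measurable_klFun
  nonneg t ht := klFun_nonneg ht
  superlinear A := ⟨Real.exp A, Real.exp_nonneg _, fun t ht => by
    linarith [mul_add_le_klFun A ht]⟩
  approx := by
    -- Tangents are taken at `r` clamped to `[1 / (n + 1), n + 1]`, so that their coefficients are
    -- bounded. The slope `log (ρ n r)` never has the sign opposite to `r - ρ n r`, so the tangent
    -- at `r` is at least `klFun (ρ n r) ≥ 0`.
    let ρ : ℕ → ℝ → ℝ := fun n r => max (1 / (n + 1)) (min r (n + 1))
    have hρ0 : ∀ n r, 0 < ρ n r := fun n r => lt_max_of_lt_left (by positivity)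
    have hone : ∀ n : ℕ, 1 / ((n : ℝ) + 1) ≤ n + 1 := fun n => by
      rw [div_le_iff₀ (by positivity)]
      nlinarith [n.cast_nonneg (α := ℝ)]
    have hρ1 : ∀ n r, ρ n r ≤ n + 1 := fun n r => max_le (hone n) (min_le_right _ _)
    have hlog : ∀ n r, |Real.log (ρ n r)| ≤ Real.log (n + 1) := fun n r => by
      rw [abs_le]
      constructor
      · rw [← Real.log_inv, ← one_div]
        exact Real.log_le_log (by positivity) (le_max_left _ _)
      · exact Real.log_le_log (hρ0 n r) (hρ1 n r)
    have hρm : ∀ n, Measurable (ρ n) := fun n => by fun_prop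
    refine ⟨fun n r => Real.log (ρ n r), fun n r => 1 - ρ n r, fun n r => klFun (ρ n r),
      fun n => (hρm n).log, fun n => (hρm n).const_sub 1, fun n => measurable_klFun.comp (hρm n),
      fun n => ⟨max (Real.log (n + 1)) (1 + (n + 1)), fun r => ⟨(hlog n r).trans (le_max_left _ _),
        le_max_of_le_right ?_⟩⟩, fun n r t ht => ?_, fun n r hr => ⟨klFun_nonneg (hρ0 n r).le, ?_⟩,
      fun r hr => ?_⟩
    · rw [abs_le]
      constructor <;> linarith [hρ0 n r, hρ1 n r]
    · have := mul_add_le_klFun (Real.log (ρ n r)) ht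
      rwa [Real.exp_log (hρ0 n r)] at this
    · dsimp only
      rw [klFun_apply]
      have hn : (0 : ℝ) ≤ n := n.cast_nonneg
      have : 0 ≤ Real.log (ρ n r) * (r - ρ n r) := by
        rcases le_total r (1 / ((n : ℝ) + 1)) with h | h
        · have e : ρ n r = 1 / ((n : ℝ) + 1) := max_eq_left ((min_le_left _ _).trans h)
          refine mul_nonneg_of_nonpos_of_nonpos (Real.log_nonpos (hρ0 n r).le ?_) ?_
          · rw [e, div_le_one (by positivity)]
            linarith
          · rw [e]
            linarith
        · rcases le_total r (n + 1) with h' | h'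
          · have e : ρ n r = r := by simp only [ρ]; rw [min_eq_left h', max_eq_right h]
            simp [e]
          · have e : ρ n r = n + 1 := by simp only [ρ]; rw [min_eq_right h', max_eq_right (hone n)]
            rw [e]
            exact mul_nonneg (Real.log_nonneg (by linarith)) (by linarith)
      nlinarith
    · refine (continuous_klFun.tendsto r).comp ?_
      have h1 : Tendsto (fun n : ℕ => 1 / ((n : ℝ) + 1)) atTop (𝓝 0) :=
        tendsto_one_div_add_atTop_nhds_zero_nat
      have h2 : Tendsto (fun n : ℕ => min r ((n : ℝ) + 1)) atTop (𝓝 r) := by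
        refine tendsto_const_nhds.congr' ?_
        filter_upwards [eventually_ge_atTop ⌈r⌉₊] with n hn
        have := Nat.ceil_le.1 hn
        exact (min_eq_left (by linarith)).symm
      have h3 := h1.max h2
      rwa [max_eq_right hr] at h3

/-- With `l = (x - y) / 2` and `exp l - 1 - l ≤ l ^ 2`, the right side is at least `2 * l ^ 2 - l ^
2 * y ≥ l ^ 2`. This choice of `l` yields a Pinsker inequality with a weaker constant. -/
theorem sq_div_four_le {x y : ℝ} (hx0 : 0 ≤ x) (hx1 : x ≤ 1) (hy0 : 0 ≤ y) (hy1 : y ≤ 1) :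
    (x - y) ^ 2 / 4 ≤ (x - y) / 2 * x + (1 - Real.exp ((x - y) / 2)) * y := by
  have hexp := abs_le.1 (Real.abs_exp_sub_one_sub_id_le (x := (x - y) / 2) (by
    rw [abs_le]; constructor <;> linarith))
  nlinarith [mul_nonneg hy0 (sub_nonneg.2 hexp.2),
    mul_nonneg (sub_nonneg.2 hy1) (sq_nonneg ((x - y) / 2))]

theorem sq_sub_le_klDiv (μ ν : ProbabilityMeasure Y) {E : Set Y} (hE : MeasurableSet E) :
    ENNReal.ofReal (((μ : Measure Y).real E - (ν : Measure Y).real E) ^ 2 / 4) ≤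
      klDiv (μ : Measure Y) ν := by
  rw [← fDiv_klFun]
  exact (ENNReal.ofReal_le_ofReal (sq_div_four_le measureReal_nonneg measureReal_le_one
    measureReal_nonneg measureReal_le_one)).trans (ofReal_mul_add_mul_le_fDiv
    (fun t ht => klFun_nonneg ht) (fun t ht => mul_add_le_klFun _ ht) hE)

end KL

/-! ### Power kernels -/

section Power

/-- The tangent to `t ^ p` at `s`; Bernoulli's inequality at `t / s`. -/
theorem mul_add_le_rpow {p : ℝ} (hp : 1 < p) {s t : ℝ} (hs : 0 ≤ s) (ht : 0 ≤ t) :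
    p * s ^ (p - 1) * t + -((p - 1) * s ^ p) ≤ t ^ p := by
  rcases hs.eq_or_lt with rfl | hs
  · rw [Real.zero_rpow (by linarith), Real.zero_rpow (by linarith)]
    simpa using Real.rpow_nonneg ht p
  · have h := one_add_mul_self_le_rpow_one_add (s := t / s - 1) (by linarith [div_nonneg ht hs.le])
      hp.le
    rw [show 1 + (t / s - 1) = t / s by ring, Real.div_rpow ht hs.le,
      le_div_iff₀ (Real.rpow_pos_of_pos hs p)] at h
    have e : s ^ p = s ^ (p - 1) * s := by
      rw [Real.rpow_sub_one hs.ne']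
      field_simp
    calc _ = (1 + p * (t / s - 1)) * s ^ p := by
          rw [e]
          field_simp
          ring
      _ ≤ _ := h

theorem isDivergenceKernel_rpow {p : ℝ} (hp : 1 < p) : IsDivergenceKernel fun t => t ^ p where
  measurable := by fun_prop
  nonneg t ht := Real.rpow_nonneg ht p
  superlinear A := by
    have hp0 : 0 < p := by linarith
    -- This is the point where the tangent to `t ^ p` has slope `|A|`.
    have hs : 0 ≤ (|A| / p) ^ (1 / (p - 1)) := by positivity
    refine ⟨(p - 1) * ((|A| / p) ^ (1 / (p - 1))) ^ p, mul_nonneg (by linarith) (by positivity),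
      fun t ht => le_trans ?_ (mul_add_le_rpow hp hs ht)⟩
    rw [← Real.rpow_mul (by positivity) _ (p - 1), one_div_mul_cancel (by linarith), Real.rpow_one,
      mul_div_cancel₀ _ hp0.ne']
    gcongr
    exact le_abs_self A
  approx := by
    have hp0 : 0 < p := by linarith
    let ρ : ℕ → ℝ → ℝ := fun n r => max 0 (min r n)
    have hρ0 : ∀ n r, 0 ≤ ρ n r := fun n r => le_max_left _ _
    have hρ1 : ∀ n r, ρ n r ≤ n := fun n r => max_le n.cast_nonneg (min_le_right _ _)
    have hρm : ∀ n, Measurable (ρ n) := fun n => by fun_prop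
    refine ⟨fun n r => p * ρ n r ^ (p - 1), fun n r => -((p - 1) * ρ n r ^ p),
      fun n r => ρ n r ^ p, fun n => ((hρm n).pow_const _).const_mul _,
      fun n => (((hρm n).pow_const _).const_mul _).neg, fun n => (hρm n).pow_const _,
      fun n => ⟨max (p * n ^ (p - 1)) ((p - 1) * n ^ p), fun r => ⟨?_, ?_⟩⟩,
      fun n r t ht => mul_add_le_rpow hp (hρ0 n r) ht,
      fun n r hr => ⟨Real.rpow_nonneg (hρ0 n r) _, ?_⟩, fun r hr => ?_⟩
    · rw [abs_of_nonneg (mul_nonneg hp0.le (Real.rpow_nonneg (hρ0 n r) _))]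
      refine le_max_of_le_left ?_
      have := Real.rpow_le_rpow (hρ0 n r) (hρ1 n r) (by linarith : 0 ≤ p - 1)
      gcongr
    · rw [abs_neg, abs_of_nonneg (mul_nonneg (by linarith) (Real.rpow_nonneg (hρ0 n r) _))]
      refine le_max_of_le_right (mul_le_mul_of_nonneg_left ?_ (by linarith))
      exact Real.rpow_le_rpow (hρ0 n r) (hρ1 n r) hp0.le
    · have e : ρ n r ^ p = ρ n r ^ (p - 1) * ρ n r := by
        rw [← Real.rpow_add_one' (hρ0 n r) (by linarith)]
        ring_nf
      have hle : ρ n r ≤ r := max_le hr (min_le_left _ _)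
      have := mul_nonneg (mul_nonneg hp0.le (Real.rpow_nonneg (hρ0 n r) (p - 1)))
        (sub_nonneg.2 hle)
      dsimp only
      rw [e]
      nlinarith
    · refine Tendsto.rpow_const ?_ (Or.inr hp0.le)
      refine tendsto_const_nhds.congr' ?_
      filter_upwards [eventually_ge_atTop ⌈r⌉₊] with n hn
      have := Nat.ceil_le.1 hn
      simp only [ρ]
      rw [min_eq_left this, max_eq_right hr]

/-- A power exceeds its tangent at one by at least a multiple of the relative entropy kernel. -/
theorem add_mul_klFun_le_rpow {p : ℝ} (hp : 1 < p) {t : ℝ} (ht : 0 ≤ t) :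
    p * t + (1 - p) + (p - 1) * InformationTheory.klFun t ≤ t ^ p := by
  rw [InformationTheory.klFun_apply]
  rcases ht.eq_or_lt with rfl | ht
  · rw [Real.zero_rpow (by linarith)]
    simp
  · have h1 : 1 + (p - 1) * Real.log t ≤ t ^ (p - 1) := by
      rw [Real.rpow_def_of_pos ht]
      linarith [Real.add_one_le_exp (Real.log t * (p - 1))]
    have e : t ^ p = t ^ (p - 1) * t := by
      rw [Real.rpow_sub_one ht.ne']
      field_simp
    rw [e]
    nlinarith

end Power

end Renyi

/-! ### Existence and uniqueness of centers from a quadratic surplus -/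

namespace Renyi

variable {Y : Type*} [MeasurableSpace Y] {𝒲 : Set (ProbabilityMeasure Y)}

/-! ### Uniform limits of probability measures -/

/-- The limit on sets is finitely additive; uniformity allows it to be exchanged with increasing
unions, which gives countable additivity. -/
theorem exists_tendsto_of_uniformCauchy (u : ℕ → ProbabilityMeasure Y)
    (h : ∀ ε : ℝ, 0 < ε → ∃ N, ∀ n ≥ N, ∀ m ≥ N, ∀ E : Set Y, MeasurableSet E →
      |(u n : Measure Y).real E - (u m : Measure Y).real E| ≤ ε) :
    ∃ Q : ProbabilityMeasure Y, ∀ E : Set Y, MeasurableSet E →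
      Tendsto (fun n => (u n : Measure Y).real E) atTop (𝓝 ((Q : Measure Y).real E)) := by
  have hlim : ∀ E : {E : Set Y // MeasurableSet E}, ∃ l : ℝ,
      Tendsto (fun n => (u n : Measure Y).real E) atTop (𝓝 l) := fun E => by
    refine cauchySeq_tendsto_of_complete (Metric.cauchySeq_iff.2 fun ε hε => ?_)
    obtain ⟨N, hN⟩ := h (ε / 2) (half_pos hε)
    refine ⟨N, fun n hn m hm => ?_⟩
    rw [Real.dist_eq]
    linarith [hN n hn m hm E E.2]
  choose l hl using hlim
  have hl0 : ∀ E, 0 ≤ l E := fun E => ge_of_tendsto' (hl E) fun n => measureReal_nonneg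
  have hunif : ∀ ε : ℝ, 0 < ε → ∃ n, ∀ E : {E : Set Y // MeasurableSet E},
      |(u n : Measure Y).real E - l E| ≤ ε := fun ε hε => by
    obtain ⟨N, hN⟩ := h ε hε
    refine ⟨N, fun E => ?_⟩
    refine le_of_tendsto ((tendsto_const_nhds.sub (hl E)).abs) ?_
    filter_upwards [eventually_ge_atTop N] with m hm
    exact hN N le_rfl m hm E E.2
  let μ : Measure Y := Measure.ofMeasurable (fun E hE => ENNReal.ofReal (l ⟨E, hE⟩))
    (by
      have : l ⟨∅, MeasurableSet.empty⟩ = 0 :=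
        tendsto_nhds_unique (hl ⟨∅, MeasurableSet.empty⟩) (by simp)
      rw [this, ENNReal.ofReal_zero])
    (by
      intro f hf hd
      have hpart : ∀ k, MeasurableSet (⋃ i ∈ Finset.range k, f i) := fun k =>
        Finset.measurableSet_biUnion _ fun i _ => hf i
      have hadd : ∀ k, ∑ i ∈ Finset.range k, l ⟨f i, hf i⟩ = l ⟨_, hpart k⟩ := fun k => by
        refine tendsto_nhds_unique (tendsto_finsetSum _ fun i _ => hl ⟨f i, hf i⟩) ?_
        refine (hl ⟨_, hpart k⟩).congr fun n => ?_
        exact measureReal_biUnion_finset (fun i _ j _ hij => hd hij) fun i _ => hf i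
      have hconv : Tendsto (fun k => l ⟨_, hpart k⟩) atTop (𝓝 (l ⟨_, MeasurableSet.iUnion hf⟩)) := by
        rw [Metric.tendsto_atTop]
        intro ε hε
        obtain ⟨n, hn⟩ := hunif (ε / 4) (by positivity)
        have hmono : Monotone fun k : ℕ => ⋃ i ∈ Finset.range k, f i := fun a b hab =>
          biUnion_subset_biUnion_left fun i hi => by
            simp only [Finset.coe_range, mem_Iio] at hi ⊢
            omega
        have hU : ⋃ k : ℕ, ⋃ i ∈ Finset.range k, f i = ⋃ i, f i := by
          ext y
          simp only [mem_iUnion, Finset.mem_range, exists_prop]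
          exact ⟨fun ⟨k, i, _, hy⟩ => ⟨i, hy⟩, fun ⟨i, hy⟩ => ⟨i + 1, i, by omega, hy⟩⟩
        have h1 : Tendsto (fun k => (u n : Measure Y).real (⋃ i ∈ Finset.range k, f i)) atTop
            (𝓝 ((u n : Measure Y).real (⋃ i, f i))) := by
          rw [← hU]
          exact (ENNReal.tendsto_toReal (measure_ne_top _ _)).comp
            (tendsto_measure_iUnion_atTop hmono)
        obtain ⟨N, hN⟩ := Metric.tendsto_atTop.1 h1 (ε / 4) (by positivity)
        refine ⟨N, fun k hk => ?_⟩
        have e1 := hN k hk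
        rw [Real.dist_eq] at e1 ⊢
        have e2 := abs_le.1 (hn ⟨_, hpart k⟩)
        have e3 := abs_le.1 (hn ⟨_, MeasurableSet.iUnion hf⟩)
        have e4 := abs_lt.1 e1
        rw [abs_lt]
        constructor <;> linarith
      refine tendsto_nhds_unique ?_ (ENNReal.tendsto_nat_tsum _)
      refine (ENNReal.tendsto_ofReal hconv).congr fun k => ?_
      rw [← hadd, ENNReal.ofReal_sum_of_nonneg fun i _ => hl0 _])
  have hμ : ∀ E (hE : MeasurableSet E), μ E = ENNReal.ofReal (l ⟨E, hE⟩) := fun E hE =>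
    Measure.ofMeasurable_apply E hE
  have hprob : IsProbabilityMeasure μ := ⟨by
    have : l ⟨univ, MeasurableSet.univ⟩ = 1 :=
      tendsto_nhds_unique (hl ⟨univ, MeasurableSet.univ⟩) (by simp)
    rw [hμ _ MeasurableSet.univ, this, ENNReal.ofReal_one]⟩
  refine ⟨⟨μ, hprob⟩, fun E hE => ?_⟩
  have : μ.real E = l ⟨E, hE⟩ := by
    rw [measureReal_def, hμ E hE, ENNReal.toReal_ofReal (hl0 _)]
  change Tendsto _ _ (𝓝 (μ.real E))
  rw [this]
  exact hl ⟨E, hE⟩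

theorem setwiseTendsto_of_real {ι : Type*} {u : ι → ProbabilityMeasure Y} {F : Filter ι}
    {Q : ProbabilityMeasure Y} (h : ∀ E : Set Y, MeasurableSet E →
      Tendsto (fun n => (u n : Measure Y).real E) F (𝓝 ((Q : Measure Y).real E))) :
    SetwiseTendsto u F Q := fun E hE => by
  have := ENNReal.tendsto_ofReal (h E hE)
  simpa only [ofReal_measureReal (measure_ne_top _ _)] using this

theorem eq_of_measureReal_eq {Q R : ProbabilityMeasure Y}
    (h : ∀ E, MeasurableSet E → (Q : Measure Y).real E = (R : Measure Y).real E) : Q = R := by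
  refine Subtype.ext (Measure.ext fun E hE => ?_)
  have := h E hE
  rwa [measureReal_def, measureReal_def,
    ENNReal.toReal_eq_toReal_iff' (measure_ne_top _ _) (measure_ne_top _ _)] at this

/-! ### Mixtures of priors -/

/-- The average of `d` for the weights `P`. -/
def priorSum {X : Type*} (P : X →₀ ℝ≥0) (d : X → ℝ≥0∞) : ℝ≥0∞ :=
  ∑ W ∈ P.support, (P W : ℝ≥0∞) * d W

theorem priorSum_mix {X : Type*} (P P' : X →₀ ℝ≥0) (s t : ℝ≥0) (d : X → ℝ≥0∞) :
    priorSum (s • P + t • P') d = s * priorSum P d + t * priorSum P' d := by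
  have key : ∀ P : X →₀ ℝ≥0, priorSum P d =
      P.sum fun (W : X) (r : ℝ≥0) => (r : ℝ≥0∞) * d W := fun P => rfl
  have hsmul : ∀ (s : ℝ≥0) (P : X →₀ ℝ≥0), priorSum (s • P) d = s * priorSum P d := fun s P => by
    rw [key, Finsupp.sum_smul_index' (by simp)]
    simp only [smul_eq_mul, ENNReal.coe_mul, mul_assoc]
    rw [← Finsupp.mul_sum, key]
  rw [← hsmul, ← hsmul, key, key, key]
  classical
  exact Finsupp.sum_add_index' (by simp) (by intros; push_cast; ring)

theorem mix_mem_pmfs {X : Type*} {A : Set X} {P P' : X →₀ ℝ≥0} (hP : P ∈ pmfs A)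
    (hP' : P' ∈ pmfs A) {s t : ℝ≥0} (hst : s + t = 1) : s • P + t • P' ∈ pmfs A := by
  classical
  constructor
  · intro W hW
    rcases Finset.mem_union.1 (Finsupp.support_add (Finset.mem_coe.1 hW)) with h | h
    · exact hP.1 (Finsupp.support_smul h)
    · exact hP'.1 (Finsupp.support_smul h)
  · rw [Finsupp.sum_add_index' (by simp) (by simp), Finsupp.sum_smul_index' (by simp),
      Finsupp.sum_smul_index' (by simp)]
    simp only [smul_eq_mul]
    rw [← Finsupp.mul_sum, ← Finsupp.mul_sum, hP.2, hP'.2, mul_one, mul_one, hst]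

theorem exists_le_of_le_priorSum {X : Type*} {A : Set X} {P : X →₀ ℝ≥0} (hP : P ∈ pmfs A)
    {d : X → ℝ≥0∞} {x : ℝ≥0∞} (h : x ≤ priorSum P d) : ∃ W ∈ P.support, x ≤ d W := by
  obtain ⟨W, hW, hmax⟩ := P.support.exists_max_image d (pmfs_support_nonempty hP)
  refine ⟨W, hW, h.trans ?_⟩
  calc priorSum P d ≤ ∑ V ∈ P.support, (P V : ℝ≥0∞) * d W :=
        Finset.sum_le_sum fun V hV => by
          gcongr
          exact hmax V hV
    _ = d W := by rw [← Finset.sum_mul, pmfs_sum_ennreal hP, one_mul]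

theorem priorSum_le {X : Type*} {A : Set X} {P : X →₀ ℝ≥0} (hP : P ∈ pmfs A)
    {d : X → ℝ≥0∞} {x : ℝ≥0∞} (h : ∀ W ∈ P.support, d W ≤ x) : priorSum P d ≤ x := by
  calc priorSum P d ≤ ∑ V ∈ P.support, (P V : ℝ≥0∞) * x :=
        Finset.sum_le_sum fun V hV => by
          gcongr
          exact h V hV
    _ = x := by rw [← Finset.sum_mul, pmfs_sum_ennreal hP, one_mul]

/-! ### Existence and uniqueness of centers -/

/-- A sequence of priors that nearly maximise `F` has outputs converging to the only candidate for
a center, which is a center when `d` is lower semicontinuous. -/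
theorem exists_unique_center (h𝒲 : 𝒲.Nonempty)
    (d : ProbabilityMeasure Y → ProbabilityMeasure Y → ℝ≥0∞)
    (F : (ProbabilityMeasure Y →₀ ℝ≥0) → ℝ≥0∞)
    (hd : ∀ (u v : ℕ → ProbabilityMeasure Y) (W Q : ProbabilityMeasure Y) (K : ℝ≥0∞),
      SetwiseTendsto u atTop W → SetwiseTendsto v atTop Q → (∀ᶠ n in atTop, d (u n) (v n) ≤ K) →
      d W Q ≤ K)
    (q : (ProbabilityMeasure Y →₀ ℝ≥0) → ProbabilityMeasure Y) (c : ℝ) (hc : 0 < c)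
    (hq : ∀ P ∈ pmfs (univ : Set (ProbabilityMeasure Y)), priorSum P (fun W => d W (q P)) ≤ F P)
    (hF : ∀ P ∈ pmfs (univ : Set (ProbabilityMeasure Y)), ∀ Q : ProbabilityMeasure Y,
      ∀ E : Set Y, MeasurableSet E →
      F P + ENNReal.ofReal (c * ((q P : Measure Y).real E - (Q : Measure Y).real E) ^ 2) ≤
        priorSum P (fun W => d W Q))
    (hK : ⨆ P ∈ pmfs 𝒲, F P ≠ ⊤) :
    ∃ Q : ProbabilityMeasure Y, (∀ W ∈ 𝒲, d W Q ≤ ⨆ P ∈ pmfs 𝒲, F P) ∧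
      ∀ R : ProbabilityMeasure Y, (∀ W ∈ 𝒲, d W R ≤ ⨆ P ∈ pmfs 𝒲, F P) → R = Q := by
  set K := ⨆ P ∈ pmfs 𝒲, F P with hKdef
  have hFK : ∀ P ∈ pmfs 𝒲, F P ≤ K := fun P hP => le_iSup₂ (f := fun P _ => F P) P hP
  have hFt : ∀ P ∈ pmfs 𝒲, F P ≠ ⊤ := fun P hP => ne_top_of_le_ne_top hK (hFK P hP)
  -- Both priors are tested against the output of their mixture, whose own average divergence is at
  -- most `K`.
  have hmix : ∀ P ∈ pmfs 𝒲, ∀ P' ∈ pmfs 𝒲, ∀ s t : ℝ≥0, s + t = 1 → ∀ E, MeasurableSet E →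
      s * ((F P).toReal + c * ((q P : Measure Y).real E -
        (q (s • P + t • P') : Measure Y).real E) ^ 2) +
      t * ((F P').toReal + c * ((q P' : Measure Y).real E -
        (q (s • P + t • P') : Measure Y).real E) ^ 2) ≤ K.toReal := by
    intro P hP P' hP' s t hst E hE
    have hm := mix_mem_pmfs hP hP' hst
    have h1 := (hq _ (pmfs_univ hm)).trans (hFK _ hm)
    rw [priorSum_mix] at h1
    have h2 := (add_le_add (mul_le_mul_right (hF P (pmfs_univ hP) (q (s • P + t • P')) E hE) (s : ℝ≥0∞))
      (mul_le_mul_right (hF P' (pmfs_univ hP') (q (s • P + t • P')) E hE) (t : ℝ≥0∞))).trans h1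
    have h3 := ENNReal.toReal_mono hK h2
    rw [ENNReal.toReal_add, ENNReal.toReal_mul, ENNReal.toReal_mul, ENNReal.toReal_add (hFt P hP),
      ENNReal.toReal_add (hFt P' hP'), ENNReal.toReal_ofReal (by positivity),
      ENNReal.toReal_ofReal (by positivity), ENNReal.coe_toReal, ENNReal.coe_toReal] at h3
    · exact h3
    · exact ENNReal.ofReal_ne_top
    · exact ENNReal.ofReal_ne_top
    · exact ENNReal.mul_ne_top ENNReal.coe_ne_top
        (ENNReal.add_ne_top.2 ⟨hFt P hP, ENNReal.ofReal_ne_top⟩)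
    · exact ENNReal.mul_ne_top ENNReal.coe_ne_top
        (ENNReal.add_ne_top.2 ⟨hFt P' hP', ENNReal.ofReal_ne_top⟩)
  -- For equal weights, `((x - z) ^ 2 + (y - z) ^ 2) / 2 ≥ (x - y) ^ 2 / 4` eliminates the output
  -- `z` of the mixture.
  have hnear : ∀ P ∈ pmfs 𝒲, ∀ P' ∈ pmfs 𝒲, ∀ ε : ℝ, K.toReal - ε ≤ (F P).toReal →
      K.toReal - ε ≤ (F P').toReal → ∀ E, MeasurableSet E →
      c * ((q P : Measure Y).real E - (q P' : Measure Y).real E) ^ 2 ≤ 4 * ε := by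
    intro P hP P' hP' ε h1 h2 E hE
    have h := hmix P hP P' hP' (1 / 2) (1 / 2) (add_halves 1) E hE
    push_cast at h
    set x := (q P : Measure Y).real E
    set y := (q P' : Measure Y).real E
    set z := (q ((1 / 2 : ℝ≥0) • P + (1 / 2 : ℝ≥0) • P') : Measure Y).real E
    nlinarith [mul_nonneg hc.le (sq_nonneg (x + y - 2 * z))]
  have hexists : ∀ ε : ℝ, 0 < ε → ∃ P ∈ pmfs 𝒲, K.toReal - ε ≤ (F P).toReal := by
    intro ε hε
    by_contra! hcon
    have hle : K ≤ ENNReal.ofReal (K.toReal - ε) := iSup₂_le fun P hP => by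
      rw [← ENNReal.ofReal_toReal (hFt P hP)]
      exact ENNReal.ofReal_le_ofReal (hcon P hP).le
    obtain ⟨W, hW⟩ := h𝒲
    have h1 := hcon _ (single_mem_pmfs hW)
    have h2 := ENNReal.toReal_mono ENNReal.ofReal_ne_top hle
    rw [ENNReal.toReal_ofReal (by linarith [ENNReal.toReal_nonneg (a := F (Finsupp.single W 1))])]
      at h2
    linarith
  have hpos : ∀ n : ℕ, (0 : ℝ) < (1 / 4) ^ n := fun n => by positivity
  choose P hP hPF using fun n : ℕ => hexists ((1 / 4) ^ n) (hpos n)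
  have hcauchy : ∀ ε : ℝ, 0 < ε → ∃ N, ∀ n ≥ N, ∀ m ≥ N, ∀ E : Set Y, MeasurableSet E →
      |(q (P n) : Measure Y).real E - (q (P m) : Measure Y).real E| ≤ ε := by
    intro ε hε
    obtain ⟨N, hN⟩ := exists_pow_lt_of_lt_one (show 0 < c * ε ^ 2 / 4 by positivity)
      (show (1 / 4 : ℝ) < 1 by norm_num)
    refine ⟨N, fun n hn m hm E hE => ?_⟩
    have hpow : ∀ k ≥ N, K.toReal - (1 / 4) ^ N ≤ (F (P k)).toReal := fun k hk => by
      have : (1 / 4 : ℝ) ^ k ≤ (1 / 4) ^ N :=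
        pow_le_pow_of_le_one (by norm_num) (by norm_num) hk
      linarith [hPF k]
    have h := hnear _ (hP n) _ (hP m) _ (hpow n hn) (hpow m hm) E hE
    refine abs_le_of_sq_le_sq ?_ hε.le
    have : c * ((q (P n) : Measure Y).real E - (q (P m) : Measure Y).real E) ^ 2 ≤ c * ε ^ 2 := by
      linarith
    exact le_of_mul_le_mul_left this hc
  obtain ⟨Q, hQ⟩ := exists_tendsto_of_uniformCauchy (fun n => q (P n)) hcauchy
  have hpow4 : Tendsto (fun n : ℕ => (1 / 4 : ℝ) ^ n) atTop (𝓝 0) :=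
    tendsto_pow_atTop_nhds_zero_of_lt_one (by norm_num) (by norm_num)
  have hpow2 : Tendsto (fun n : ℕ => (1 / 2 : ℝ) ^ n) atTop (𝓝 0) :=
    tendsto_pow_atTop_nhds_zero_of_lt_one (by norm_num) (by norm_num)
  have hclose : ∀ v : ℕ → ProbabilityMeasure Y, (∃ δ : ℕ → ℝ, Tendsto δ atTop (𝓝 0) ∧
      ∀ n, ∀ E, MeasurableSet E →
        c * ((q (P n) : Measure Y).real E - (v n : Measure Y).real E) ^ 2 ≤ δ n) →
      ∀ E, MeasurableSet E →
        Tendsto (fun n => (v n : Measure Y).real E) atTop (𝓝 ((Q : Measure Y).real E)) := by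
    rintro v ⟨δ, hδ, hv⟩ E hE
    have h1 : Tendsto (fun n => ((q (P n) : Measure Y).real E - (v n : Measure Y).real E) ^ 2) atTop
        (𝓝 0) := by
      refine squeeze_zero (fun n => sq_nonneg _) (fun n => ?_)
        (by simpa using hδ.div_const c : Tendsto (fun n => δ n / c) atTop (𝓝 0))
      rw [le_div_iff₀ hc, mul_comm]
      exact hv n E hE
    have h2 : Tendsto (fun n => (q (P n) : Measure Y).real E - (v n : Measure Y).real E) atTop
        (𝓝 0) := by
      rw [tendsto_zero_iff_abs_tendsto_zero]
      simpa [Real.sqrt_sq_eq_abs, Function.comp_def] using h1.sqrt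
    simpa using (hQ E hE).sub h2
  refine ⟨Q, fun W hW => ?_, fun R hR => ?_⟩
  · have ht1 : ∀ n : ℕ, (1 / 2 : ℝ≥0) ^ n ≤ 1 := fun n => pow_le_one₀ (by positivity) (by
      rw [div_le_one (by norm_num)]
      norm_num)
    -- `W` gets weight `2⁻ⁿ` while `P n` is optimal up to `4⁻ⁿ`. Dividing the deficit by the weight
    -- gives `d W (q (P' n)) ≤ K + 2⁻ⁿ`. The priors `P' n` are still nearly optimal, so their
    -- outputs also tend to `Q`.
    let P' : ℕ → ProbabilityMeasure Y →₀ ℝ≥0 := fun n =>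
      (1 - (1 / 2 : ℝ≥0) ^ n) • P n + (1 / 2 : ℝ≥0) ^ n • Finsupp.single W 1
    have hP' : ∀ n, P' n ∈ pmfs 𝒲 := fun n =>
      mix_mem_pmfs (hP n) (single_mem_pmfs hW) (tsub_add_cancel_of_le (ht1 n))
    have hcoe : ∀ n : ℕ, ((1 - (1 / 2 : ℝ≥0) ^ n : ℝ≥0) : ℝ) = 1 - (1 / 2) ^ n := fun n => by
      rw [NNReal.coe_sub (ht1 n)]
      simp
    have hF0 : ∀ P, 0 ≤ (F P).toReal := fun P => ENNReal.toReal_nonneg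
    have hr : ∀ n : ℕ, (1 / 2 : ℝ) ^ n ≤ 1 ∧ (0 : ℝ) < (1 / 2) ^ n := fun n =>
      ⟨pow_le_one₀ (by norm_num) (by norm_num), by positivity⟩
    have e4 : ∀ n : ℕ, (1 / 4 : ℝ) ^ n = (1 / 2) ^ n * (1 / 2) ^ n := fun n => by
      rw [← mul_pow]
      norm_num
    have hlow : ∀ n, (1 - (1 / 2) ^ n) * (F (P n)).toReal +
        (1 / 2) ^ n * (d W (q (P' n))).toReal ≤ K.toReal ∧ d W (q (P' n)) ≠ ⊤ ∧
        (1 - (1 / 2) ^ n) * (F (P n)).toReal ≤ (F (P' n)).toReal := by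
      intro n
      have h1 := hq _ (pmfs_univ (hP' n))
      have hF' := hF (P n) (pmfs_univ (hP n)) (q (P' n)) ∅ MeasurableSet.empty
      have h2 : ((1 - (1 / 2 : ℝ≥0) ^ n : ℝ≥0) : ℝ≥0∞) * F (P n) +
          ((1 / 2 : ℝ≥0) ^ n : ℝ≥0) * d W (q (P' n)) ≤ F (P' n) := by
        refine le_trans ?_ h1
        simp only [P'] at hF' ⊢
        rw [priorSum_mix]
        refine add_le_add (mul_le_mul_right (le_trans le_self_add hF') _) (mul_le_mul_right ?_ _)
        simp [priorSum]
      have hF't := hFt _ (hP' n)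
      have h3 := ENNReal.add_ne_top.1 (ne_top_of_le_ne_top hF't h2)
      have hdt : d W (q (P' n)) ≠ ⊤ := fun htop => h3.2 (by
        rw [htop, ENNReal.mul_top]
        have : (0 : ℝ≥0) < (1 / 2) ^ n := by positivity
        exact_mod_cast this.ne')
      have h4 := ENNReal.toReal_mono hF't h2
      rw [ENNReal.toReal_add h3.1 h3.2, ENNReal.toReal_mul, ENNReal.toReal_mul, ENNReal.coe_toReal,
        ENNReal.coe_toReal, hcoe, NNReal.coe_pow] at h4
      have h5 := ENNReal.toReal_mono hK (hFK _ (hP' n))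
      have h6 : (0 : ℝ) ≤ (1 / 2) ^ n * (d W (q (P' n))).toReal :=
        mul_nonneg (hr n).2.le ENNReal.toReal_nonneg
      have e : ((1 / 2 : ℝ≥0) : ℝ) = 1 / 2 := by simp
      rw [e] at h4
      exact ⟨h4.trans h5, hdt, by linarith⟩
    have hconv : SetwiseTendsto (fun n => q (P' n)) atTop Q := by
      refine setwiseTendsto_of_real (hclose _ ⟨fun n => 4 * ((1 / 4) ^ n + (1 / 2) ^ n * K.toReal), ?_,
        fun n E hE => ?_⟩)
      · simpa using (hpow4.add (hpow2.mul_const K.toReal)).const_mul 4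
      · have hb := (hlow n).2.2
        have hKn := ENNReal.toReal_mono hK (hFK _ (hP n))
        have := hPF n
        have hk0 : (0 : ℝ) ≤ K.toReal := ENNReal.toReal_nonneg
        refine hnear _ (hP n) _ (hP' n) _ ?_ ?_ E hE
        · have := mul_nonneg (hr n).2.le hk0
          linarith
        · nlinarith [hr n, mul_le_mul_of_nonneg_left hKn (hr n).2.le]
    refine le_of_forall_gt_imp_ge_of_dense fun K' hK' => ?_
    refine hd (fun _ => W) _ W Q K' (fun E _ => tendsto_const_nhds) hconv ?_
    have hb : ∀ n, (d W (q (P' n))).toReal ≤ K.toReal + (1 / 2) ^ n := fun n => by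
      have h1 := (hlow n).1
      have h2 := hPF n
      rw [e4] at h2
      have h3 : (1 - (1 / 2 : ℝ) ^ n) * (K.toReal - (1 / 2) ^ n * (1 / 2) ^ n) ≤
          (1 - (1 / 2) ^ n) * (F (P n)).toReal :=
        mul_le_mul_of_nonneg_left h2 (by linarith [hr n])
      refine le_of_mul_le_mul_left ?_ (hr n).2
      have h4 : 0 ≤ (1 / 2 : ℝ) ^ n * (1 / 2) ^ n * (1 / 2) ^ n := by positivity
      nlinarith
    rcases eq_or_ne K' ⊤ with rfl | hK't
    · exact Eventually.of_forall fun _ => le_top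
    have hlt : K.toReal < K'.toReal := (ENNReal.toReal_lt_toReal hK hK't).2 hK'
    have hlim : Tendsto (fun n : ℕ => K.toReal + (1 / 2 : ℝ) ^ n) atTop (𝓝 (K.toReal)) := by
      simpa using hpow2.const_add K.toReal
    filter_upwards [hlim.eventually_lt_const hlt] with n hn
    rw [← ENNReal.toReal_le_toReal (hlow n).2.1 hK't]
    exact (hb n).trans hn.le
  -- The surplus of `R` over the optimal output of `P n` is at most the deficit `4⁻ⁿ`, so the same
  -- outputs converge to `R`.
  · refine eq_of_measureReal_eq fun E hE => tendsto_nhds_unique (tendsto_const_nhds (f := atTop (α := ℕ)))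
      (hclose (fun _ => R) ⟨fun n => (1 / 4) ^ n, hpow4, fun n E hE => ?_⟩ E hE)
    have h1 := (hF (P n) (pmfs_univ (hP n)) R E hE).trans
      (priorSum_le (hP n) fun W hW => hR W ((hP n).1 hW))
    have h2 := ENNReal.toReal_mono hK h1
    rw [ENNReal.toReal_add (hFt _ (hP n)) ENNReal.ofReal_ne_top,
      ENNReal.toReal_ofReal (by positivity)] at h2
    linarith [hPF n]

end Renyi

/-! ### Hull, closure and compactness from a scale -/

namespace Renyi

variable {Y : Type*} [MeasurableSpace Y] {𝒲 : Set (ProbabilityMeasure Y)}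

/-- A reparametrisation of the order `ϑ` divergence and information as the images under `G` of
nonnegative extended quantities `d` and `F`, with the properties on which the theory of centers
rests. -/
structure IsScale (ϑ : ℝ≥0∞) (G : ℝ≥0∞ → EReal)
    (d : ProbabilityMeasure Y → ProbabilityMeasure Y → ℝ≥0∞)
    (F : (ProbabilityMeasure Y →₀ ℝ≥0) → ℝ≥0∞) : Prop where
  strictMono : StrictMono G
  continuous : Continuous G
  map_top : G ⊤ = ⊤
  information_eq : ∀ P ∈ pmfs (univ : Set (ProbabilityMeasure Y)),
    (information ϑ P : EReal) = G (F P)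
  divergence_eq : ∀ W Q : ProbabilityMeasure Y, divergence ϑ W Q = G (d W Q)
  exists_le : ∀ P ∈ pmfs (univ : Set (ProbabilityMeasure Y)), ∀ Q : ProbabilityMeasure Y,
    ∃ W ∈ P.support, F P ≤ d W Q
  closed : ∀ (H : Filter (ProbabilityMeasure Y)) [H.NeBot] (W Q : ProbabilityMeasure Y) (K : ℝ≥0∞),
    SetwiseTendsto id H W → (∀ᶠ V in H, d V Q ≤ K) → d W Q ≤ K
  convex : ∀ P ∈ pmfs (univ : Set (ProbabilityMeasure Y)), ∀ V Q : ProbabilityMeasure Y,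
    V.toFiniteMeasure = meanMeasure 1 P → ∀ K, (∀ W ∈ P.support, d W Q ≤ K) → d V Q ≤ K
  uac : ∀ (𝒱 : Set (ProbabilityMeasure Y)) (Q : ProbabilityMeasure Y) (K : ℝ≥0∞), K ≠ ⊤ →
    (∀ W ∈ 𝒱, d W Q ≤ K) → UAC (meanMeasures ϑ 𝒱) Q
  mass_le : ∀ P ∈ pmfs (univ : Set (ProbabilityMeasure Y)),
    ((meanMeasure ϑ P).mass : ℝ≥0∞) ≤ 1 + F P
  center : ∀ 𝒱 : Set (ProbabilityMeasure Y), 𝒱.Nonempty → ⨆ P ∈ pmfs 𝒱, F P ≠ ⊤ →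
    ∃ Q : ProbabilityMeasure Y, (∀ W ∈ 𝒱, d W Q ≤ ⨆ P ∈ pmfs 𝒱, F P) ∧
      ∀ R : ProbabilityMeasure Y, (∀ W ∈ 𝒱, d W R ≤ ⨆ P ∈ pmfs 𝒱, F P) → R = Q

theorem pmfs_nonempty {X : Type*} {A : Set X} (hA : A.Nonempty) : (pmfs A).Nonempty :=
  hA.elim fun _ hW => ⟨_, single_mem_pmfs hW⟩

namespace IsScale

variable {ϑ : ℝ≥0∞} {G : ℝ≥0∞ → EReal} {d : ProbabilityMeasure Y → ProbabilityMeasure Y → ℝ≥0∞}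
  {F : (ProbabilityMeasure Y →₀ ℝ≥0) → ℝ≥0∞}

theorem capacity_eq (h : IsScale ϑ G d F) (h𝒲 : 𝒲.Nonempty) :
    capacity ϑ 𝒲 = G (⨆ P ∈ pmfs 𝒲, F P) := by
  have : Nonempty (pmfs 𝒲) := (pmfs_nonempty h𝒲).to_subtype
  rw [capacity, iSup_subtype', iSup_subtype',
    h.strictMono.monotone.map_ciSup_of_continuousAt h.continuous.continuousAt
      (OrderTop.bddAbove _)]
  exact iSup_congr fun P => h.information_eq _ (pmfs_univ P.2)

/-- The supremum of the divergences is never below the capacity, by `exists_le`; only the upper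
bound carries information. -/
theorem isCenter_iff (h : IsScale ϑ G d F) (h𝒲 : 𝒲.Nonempty) (Q : ProbabilityMeasure Y) :
    IsCenter ϑ 𝒲 Q ↔ ∀ W ∈ 𝒲, d W Q ≤ ⨆ P ∈ pmfs 𝒲, F P := by
  rw [IsCenter]
  simp only [h.divergence_eq]
  constructor
  · intro heq W hW
    rw [← h.strictMono.le_iff_le, ← h.capacity_eq h𝒲, ← heq]
    exact le_iSup₂ (f := fun W _ => G (d W Q)) W hW
  · intro hle
    refine le_antisymm (iSup₂_le fun W hW => ?_) (iSup₂_le fun P hP => ?_)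
    · rw [h.capacity_eq h𝒲]
      exact h.strictMono.monotone (hle W hW)
    · rw [h.information_eq P (pmfs_univ hP)]
      obtain ⟨W, hW, hFW⟩ := h.exists_le P (pmfs_univ hP) Q
      exact (h.strictMono.monotone hFW).trans (le_iSup₂ (f := fun W _ => G (d W Q)) W (hP.1 hW))

/-- The center `Q` of `𝒲` has radius equal to the capacity. If that radius persists on `𝒱`, then any
prior on `𝒱` has some `V` in its support with `F P ≤ d V Q`, and `d V Q` is within the radius. -/
theorem capacity_le (h : IsScale ϑ G d F) (h𝒲 : 𝒲.Nonempty) {𝒱 : Set (ProbabilityMeasure Y)}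
    (h𝒱 : ∀ (Q : ProbabilityMeasure Y) (K : ℝ≥0∞), (∀ W ∈ 𝒲, d W Q ≤ K) → ∀ V ∈ 𝒱, d V Q ≤ K) :
    capacity ϑ 𝒱 ≤ capacity ϑ 𝒲 := by
  rw [h.capacity_eq h𝒲]
  rcases eq_or_ne (⨆ P ∈ pmfs 𝒲, F P) ⊤ with hK | hK
  · rw [hK, h.map_top]
    exact le_top
  obtain ⟨Q, hQ, -⟩ := h.center 𝒲 h𝒲 hK
  refine iSup₂_le fun P hP => ?_
  rw [h.information_eq P (pmfs_univ hP)]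
  obtain ⟨V, hV, hFV⟩ := h.exists_le P (pmfs_univ hP) Q
  exact h.strictMono.monotone (hFV.trans (h𝒱 Q _ hQ V (hP.1 hV)))

theorem capacity_convHull_le (h : IsScale ϑ G d F) (h𝒲 : 𝒲.Nonempty) :
    capacity ϑ (convHull 𝒲) ≤ capacity ϑ 𝒲 :=
  h.capacity_le h𝒲 fun Q K hK V ⟨P, hP, hPV⟩ =>
    h.convex P (pmfs_univ hP) V Q hPV K fun W hW => hK W (hP.1 hW)

theorem capacity_closure_le (h : IsScale ϑ G d F) (h𝒲 : 𝒲.Nonempty) :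
    capacity ϑ (@closure _ (setwiseTopologyProb Y) 𝒲) ≤ capacity ϑ 𝒲 :=
  h.capacity_le h𝒲 fun Q K hK V hV => by
    obtain ⟨H, hH, h𝒲H, hHV⟩ := exists_setwiseTendsto_of_mem_closure hV
    exact h.closed H V Q K hHV (mem_of_superset h𝒲H hK)

theorem compactness (h : IsScale ϑ G d F) (h𝒲 : 𝒲.Nonempty) (hC : capacity ϑ 𝒲 < ⊤) :
    (∃! q : ProbabilityMeasure Y, IsCenter ϑ 𝒲 q) ∧
    (∀ q : ProbabilityMeasure Y, IsCenter ϑ 𝒲 q → UAC (meanMeasures ϑ 𝒲) q) ∧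
    RelativelyCompact (setwiseTopology Y) (meanMeasures ϑ 𝒲) ∧
    RelativelyCompact (weakTopology Y) (meanMeasures ϑ 𝒲) := by
  have hK : ⨆ P ∈ pmfs 𝒲, F P ≠ ⊤ := fun hK => by
    rw [h.capacity_eq h𝒲, hK, h.map_top] at hC
    exact lt_irrefl _ hC
  obtain ⟨Q, hQ, hQu⟩ := h.center 𝒲 h𝒲 hK
  have huac : ∀ q : ProbabilityMeasure Y, IsCenter ϑ 𝒲 q → UAC (meanMeasures ϑ 𝒲) q :=
    fun q hq => h.uac 𝒲 q _ hK ((h.isCenter_iff h𝒲 q).1 hq)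
  have hweak : RelativelyCompact (weakTopology Y) (meanMeasures ϑ 𝒲) := by
    refine (huac Q ((h.isCenter_iff h𝒲 Q).2 hQ)).relativelyCompact_weak
      (C := (1 + ⨆ P ∈ pmfs 𝒲, F P).toNNReal) ?_
    rintro μ ⟨α, hα, P, hP, rfl⟩
    refine (mass_mono hP hα).trans ?_
    rw [← ENNReal.coe_le_coe, ENNReal.coe_toNNReal (ENNReal.add_ne_top.2 ⟨ENNReal.one_ne_top, hK⟩)]
    refine (h.mass_le P (pmfs_univ hP)).trans ?_
    gcongr
    exact le_iSup₂ (f := fun P _ => F P) P hP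
  refine ⟨⟨Q, (h.isCenter_iff h𝒲 Q).2 hQ, fun R hR => hQu R ((h.isCenter_iff h𝒲 R).1 hR)⟩,
    huac, hweak.setwise, hweak⟩

end IsScale

end Renyi

/-! ### Scales from convex divergences; order one -/

namespace Renyi

variable {Y : Type*} [MeasurableSpace Y] {𝒲 : Set (ProbabilityMeasure Y)}
  {P : ProbabilityMeasure Y →₀ ℝ≥0}

theorem fDiv_withDensity {φ : ℝ → ℝ} {ν : Measure Y} [SigmaFinite ν] {m : Y → ℝ≥0∞}
    (hm : Measurable m) :
    fDiv φ (ν.withDensity m) ν = ∫⁻ y, ENNReal.ofReal (φ (m y).toReal) ∂ν := by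
  rw [fDiv_of_ac (withDensity_absolutelyContinuous _ _)]
  refine lintegral_congr_ae ?_
  filter_upwards [Measure.rnDeriv_withDensity ν hm] with y hy
  rw [hy]

/-- If some member of the support is not absolutely continuous, the average is infinite and there is
nothing to prove. -/
theorem priorSum_fDiv_le {φ : ℝ → ℝ} {ν : Measure Y} {x : ℝ≥0∞}
    (h : (∀ W ∈ P.support, (W : Measure Y) ≪ ν) →
      x ≤ priorSum P fun W => fDiv φ (W : Measure Y) ν) :
    x ≤ priorSum P fun W => fDiv φ (W : Measure Y) ν := by
  rcases eq_or_ne (priorSum P fun W => fDiv φ (W : Measure Y) ν) ⊤ with htop | htop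
  · exact htop ▸ le_top
  refine h fun W hW => ac_of_fDiv_ne_top (φ := φ) fun hWtop => htop ?_
  refine ENNReal.sum_eq_top.2 ⟨W, hW, ?_⟩
  simp only [hWtop]
  rw [ENNReal.mul_top]
  simpa using hW

/-- Divergences of convex functions fit into the theory of centers. -/
theorem IsDivergenceKernel.isScale {φ : ℝ → ℝ} (hφ : IsDivergenceKernel φ) {ϑ : ℝ≥0∞}
    {G : ℝ≥0∞ → EReal} {F : (ProbabilityMeasure Y →₀ ℝ≥0) → ℝ≥0∞}
    (hG : StrictMono G) (hGc : Continuous G) (hGt : G ⊤ = ⊤)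
    (hinf : ∀ P ∈ pmfs (univ : Set (ProbabilityMeasure Y)), (information ϑ P : EReal) = G (F P))
    (hdiv : ∀ W Q : ProbabilityMeasure Y, divergence ϑ W Q = G (fDiv φ (W : Measure Y) Q))
    (hmean : ∀ P ∈ pmfs (univ : Set (ProbabilityMeasure Y)), ∀ Q : ProbabilityMeasure Y,
      fDiv φ (meanMeasure ϑ P : Measure Y) Q ≤ priorSum P fun W => fDiv φ (W : Measure Y) Q)
    (hone : ∀ P ∈ pmfs (univ : Set (ProbabilityMeasure Y)), ∀ Q : ProbabilityMeasure Y,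
      fDiv φ (meanMeasure 1 P : Measure Y) Q ≤ priorSum P fun W => fDiv φ (W : Measure Y) Q)
    (hmass : ∀ P ∈ pmfs (univ : Set (ProbabilityMeasure Y)),
      ((meanMeasure ϑ P).mass : ℝ≥0∞) ≤ 1 + F P)
    {c : ℝ} (hc : 0 < c)
    (hF : ∀ P ∈ pmfs (univ : Set (ProbabilityMeasure Y)), ∃ q : ProbabilityMeasure Y,
      priorSum P (fun W => fDiv φ (W : Measure Y) q) ≤ F P ∧
      ∀ Q : ProbabilityMeasure Y, ∀ E : Set Y, MeasurableSet E →
        F P + ENNReal.ofReal (c * ((q : Measure Y).real E - (Q : Measure Y).real E) ^ 2) ≤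
          priorSum P fun W => fDiv φ (W : Measure Y) Q) :
    IsScale ϑ G (fun W Q => fDiv φ (W : Measure Y) Q) F where
  strictMono := hG
  continuous := hGc
  map_top := hGt
  information_eq := hinf
  divergence_eq := hdiv
  exists_le P hP Q := by
    obtain ⟨q, -, hq⟩ := hF P hP
    exact exists_le_of_le_priorSum hP (le_self_add.trans (hq Q ∅ MeasurableSet.empty))
  closed H _ W Q K hH hK :=
    hφ.fDiv_le_of_setwiseTendsto hH (v := fun _ => Q) (fun _ _ => tendsto_const_nhds) hK
  convex P hP V Q hV K hK := by
    have hV' : (V : Measure Y) = (meanMeasure 1 P : Measure Y) := congrArg Subtype.val hV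
    rw [hV']
    exact (hone P hP Q).trans (priorSum_le hP hK)
  uac 𝒱 Q K hK h := by
    -- Only order `ϑ` needs a divergence bound; mean measures of lower order are dominated by those
    -- of order `ϑ`.
    have hS := hφ.uac_of_fDiv_le (S := meanMeasure ϑ '' pmfs 𝒱) (Q := (Q : Measure Y)) hK (by
      rintro _ ⟨P, hP, rfl⟩
      exact (hmean P (pmfs_univ hP) Q).trans (priorSum_le hP fun W hW => h W (hP.1 hW)))
    intro ε hε
    obtain ⟨δ, hδ, hSδ⟩ := hS ε hε
    refine ⟨δ, hδ, ?_⟩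
    rintro _ ⟨α, hα, P, hP, rfl⟩ E hE hQE
    refine lt_of_le_of_lt ?_ (hSδ _ ⟨P, hP, rfl⟩ E hE hQE)
    exact ENNReal.toNNReal_mono (measure_ne_top _ _) (meanMeasure_mono hP hα E)
  mass_le := hmass
  center 𝒱 h𝒱 hK := by
    obtain ⟨W₀, -⟩ := id h𝒱
    have hex : ∀ P, ∃ q : ProbabilityMeasure Y, P ∈ pmfs (univ : Set (ProbabilityMeasure Y)) →
        priorSum P (fun W => fDiv φ (W : Measure Y) q) ≤ F P ∧
        ∀ Q : ProbabilityMeasure Y, ∀ E : Set Y, MeasurableSet E →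
          F P + ENNReal.ofReal (c * ((q : Measure Y).real E - (Q : Measure Y).real E) ^ 2) ≤
            priorSum P fun W => fDiv φ (W : Measure Y) Q := fun P => by
      by_cases hP : P ∈ pmfs (univ : Set (ProbabilityMeasure Y))
      · obtain ⟨q, hq⟩ := hF P hP
        exact ⟨q, fun _ => hq⟩
      · exact ⟨W₀, fun h => absurd h hP⟩
    choose q hq using hex
    exact exists_unique_center h𝒱 _ F
      (fun u v W Q K hu hv hK => hφ.fDiv_le_of_setwiseTendsto hu hv hK) q c hc
      (fun P hP => (hq P hP).1) (fun P hP => (hq P hP).2) hK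

/-! ### Order one -/

section One

open InformationTheory

theorem sum_rnDeriv_refMeasure (hP : P ∈ pmfs (univ : Set (ProbabilityMeasure Y))) :
    ∀ᵐ y ∂(refMeasure P), (∀ W ∈ P.support, (W : Measure Y).rnDeriv (refMeasure P) y < ⊤) ∧
      ∑ W ∈ P.support, (P W : ℝ) * ((W : Measure Y).rnDeriv (refMeasure P) y).toReal = 1 := by
  have h1 : ∀ᵐ y ∂(refMeasure P), ∀ W ∈ P.support,
      (W : Measure Y).rnDeriv (refMeasure P) y < ⊤ :=
    (Finset.eventually_all P.support).2 fun W _ => Measure.rnDeriv_lt_top _ _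
  have h2 : (fun y => powerMean 1 P fun W => (W : Measure Y).rnDeriv (refMeasure P) y)
      =ᵐ[refMeasure P] fun _ => 1 := by
    have hm : Measurable fun y => powerMean 1 P fun W =>
        (W : Measure Y).rnDeriv (refMeasure P) y :=
      measurable_powerMean 1 fun W => Measure.measurable_rnDeriv _ _
    have e := meanMeasure_eq_withDensity hP 1 (refMeasure P)
      fun W => absolutelyContinuous_refMeasure
    rw [meanMeasure_one hP] at e
    have h3 := Measure.rnDeriv_withDensity (refMeasure P) hm
    rw [← e] at h3
    exact h3.symm.trans (Measure.rnDeriv_self _)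
  filter_upwards [h1, h2] with y hy1 hy2
  refine ⟨hy1, ?_⟩
  rw [powerMean_one] at hy2
  have h := congrArg ENNReal.toReal hy2
  rw [ENNReal.toReal_sum fun W hW => ENNReal.mul_ne_top ENNReal.coe_ne_top (hy1 W hW).ne] at h
  simpa using h

/-- The pointwise compensation identity: the logarithm of the product splits, and the remaining
terms combine because `p` and `p * g` both sum to one. -/
theorem sum_mul_klFun_mul {X : Type*} (s : Finset X) (p g : X → ℝ) (hp : ∑ i ∈ s, p i = 1)
    (hg0 : ∀ i ∈ s, 0 ≤ g i) (hg : ∑ i ∈ s, p i * g i = 1) {x : ℝ} (hx : 0 ≤ x) :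
    ∑ i ∈ s, p i * klFun (g i * x) = x * ∑ i ∈ s, p i * klFun (g i) + klFun x := by
  rcases hx.eq_or_lt with rfl | hx
  · simp [hp, klFun_zero]
  have key : ∀ i ∈ s, p i * klFun (g i * x) =
      x * (p i * klFun (g i)) + p i * g i * (x * Real.log x) + p i - p i * x := fun i hi => by
    simp only [klFun_apply]
    rcases (hg0 i hi).eq_or_lt with h | h
    · rw [← h]
      simp
      ring
    · rw [Real.log_mul h.ne' hx.ne']
      ring
  rw [Finset.sum_congr rfl key, Finset.sum_sub_distrib, Finset.sum_add_distrib,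
    Finset.sum_add_distrib, ← Finset.mul_sum, ← Finset.sum_mul, ← Finset.sum_mul, hg, hp,
    klFun_apply]
  ring

theorem sum_mul_ofReal {X : Type*} (P : X →₀ ℝ≥0) (f : X → ℝ) (hf : ∀ W ∈ P.support, 0 ≤ f W) :
    ∑ W ∈ P.support, (P W : ℝ≥0∞) * ENNReal.ofReal (f W) =
      ENNReal.ofReal (∑ W ∈ P.support, (P W : ℝ) * f W) := by
  rw [ENNReal.ofReal_sum_of_nonneg fun W hW => mul_nonneg (NNReal.coe_nonneg _) (hf W hW)]
  refine Finset.sum_congr rfl fun W _ => ?_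
  rw [ENNReal.ofReal_mul (NNReal.coe_nonneg _), ENNReal.ofReal_coe_nnreal]

theorem priorSum_fDiv_eq_lintegral {φ : ℝ → ℝ} (hφ : Measurable φ) {ν : Measure Y}
    (hac : ∀ W ∈ P.support, (W : Measure Y) ≪ ν) :
    priorSum P (fun W => fDiv φ (W : Measure Y) ν) = ∫⁻ y, ∑ W ∈ P.support,
      (P W : ℝ≥0∞) * ENNReal.ofReal (φ ((W : Measure Y).rnDeriv ν y).toReal) ∂ν := by
  have hm : ∀ W : ProbabilityMeasure Y, Measurable fun y =>
      ENNReal.ofReal (φ ((W : Measure Y).rnDeriv ν y).toReal) := fun W =>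
    (hφ.comp (Measure.measurable_rnDeriv _ _).ennreal_toReal).ennreal_ofReal
  rw [lintegral_finsetSum _ fun W _ => (hm W).const_mul _]
  refine Finset.sum_congr rfl fun W hW => ?_
  rw [lintegral_const_mul _ (hm W), ← fDiv_of_ac (hac W hW)]

/-- The mutual information of the prior `P`. -/
def mutualInformation (P : ProbabilityMeasure Y →₀ ℝ≥0) : ℝ≥0∞ :=
  priorSum P fun W => fDiv klFun (W : Measure Y) (refMeasure P)

/-- Topsøe's compensation identity, of which only this direction is needed. By the chain rule
`dW/dQ` is `dW/dν` times `dν/dQ` for the mixture `ν`, so `sum_mul_klFun_mul` can be integrated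
against `Q`. -/
theorem mutualInformation_add_le (hP : P ∈ pmfs (univ : Set (ProbabilityMeasure Y)))
    (Q : ProbabilityMeasure Y) :
    mutualInformation P + fDiv klFun (refMeasure P) Q ≤
      priorSum P fun W => fDiv klFun (W : Measure Y) Q := by
  refine priorSum_fDiv_le fun hac => ?_
  set ν := refMeasure P with hν
  have hνQ : ν ≪ Q := refMeasure_absolutelyContinuous hac
  have hself : ∀ W ∈ P.support, (W : Measure Y) ≪ ν := fun W => absolutelyContinuous_refMeasure
  let f : Y → ℝ≥0∞ := ν.rnDeriv Q
  have hfm : Measurable f := Measure.measurable_rnDeriv _ _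
  let g : ProbabilityMeasure Y → Y → ℝ≥0∞ := fun W => (W : Measure Y).rnDeriv ν
  have hgm : ∀ W, Measurable (g W) := fun W => Measure.measurable_rnDeriv _ _
  -- The normalisation of the posterior holds almost everywhere for the mixture, hence `Q`-almost
  -- everywhere only where its density is nonzero. Elsewhere both sides reduce to `klFun 0`.
  have hgae : ∀ᵐ y ∂(Q : Measure Y), f y ≠ 0 → (∀ W ∈ P.support, g W y < ⊤) ∧
      ∑ W ∈ P.support, (P W : ℝ) * (g W y).toReal = 1 := by
    rw [← ae_withDensity_iff hfm, Measure.withDensity_rnDeriv_eq _ _ hνQ]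
    exact sum_rnDeriv_refMeasure hP
  have hchain : ∀ᵐ y ∂(Q : Measure Y), ∀ W ∈ P.support,
      g W y * f y = (W : Measure Y).rnDeriv Q y :=
    (Finset.eventually_all P.support).2 fun W hW =>
      Measure.rnDeriv_mul_rnDeriv (κ := (Q : Measure Y)) (hself W hW)
  have hsm : Measurable fun y => ∑ W ∈ P.support,
      (P W : ℝ≥0∞) * ENNReal.ofReal (klFun (g W y).toReal) :=
    Finset.measurable_fun_sum _ fun W _ =>
      ((measurable_klFun.comp (hgm W).ennreal_toReal).ennreal_ofReal).const_mul _
  rw [mutualInformation, ← hν, priorSum_fDiv_eq_lintegral measurable_klFun hself,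
    priorSum_fDiv_eq_lintegral measurable_klFun hac, fDiv_of_ac hνQ,
    ← lintegral_rnDeriv_mul hνQ hsm.aemeasurable,
    ← lintegral_add_left (show Measurable fun y => ν.rnDeriv Q y * ∑ W ∈ P.support,
      (P W : ℝ≥0∞) * ENNReal.ofReal (klFun (g W y).toReal) from hfm.mul hsm)]
  refine lintegral_mono_ae ?_
  filter_upwards [hgae, hchain, Measure.rnDeriv_lt_top ν (Q : Measure Y)] with y hy1 hy2 hy3
  have e : ∑ W ∈ P.support, (P W : ℝ≥0∞) *
      ENNReal.ofReal (klFun ((W : Measure Y).rnDeriv Q y).toReal) =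
      ENNReal.ofReal (∑ W ∈ P.support, (P W : ℝ) * klFun ((g W y).toReal * (f y).toReal)) := by
    rw [← sum_mul_ofReal P _ fun W _ =>
      klFun_nonneg (mul_nonneg ENNReal.toReal_nonneg ENNReal.toReal_nonneg)]
    refine Finset.sum_congr rfl fun W hW => ?_
    rw [← hy2 W hW, ENNReal.toReal_mul]
  rw [e]
  change f y * ∑ W ∈ P.support, (P W : ℝ≥0∞) * ENNReal.ofReal (klFun (g W y).toReal) +
    ENNReal.ofReal (klFun (f y).toReal) ≤ _
  by_cases hf0 : f y = 0
  · simp [hf0, klFun_zero, pmfs_sum_real hP]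
  · obtain ⟨-, hsum⟩ := hy1 hf0
    rw [sum_mul_klFun_mul _ (fun W => (P W : ℝ)) (fun W => (g W y).toReal) (pmfs_sum_real hP)
        (fun W _ => ENNReal.toReal_nonneg) hsum ENNReal.toReal_nonneg,
      sum_mul_ofReal P _ fun W _ => klFun_nonneg ENNReal.toReal_nonneg,
      ENNReal.ofReal_add (mul_nonneg ENNReal.toReal_nonneg (Finset.sum_nonneg fun W _ =>
        mul_nonneg (NNReal.coe_nonneg _) (klFun_nonneg ENNReal.toReal_nonneg)))
        (klFun_nonneg ENNReal.toReal_nonneg), ENNReal.ofReal_mul ENNReal.toReal_nonneg,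
      ENNReal.ofReal_toReal hy3.ne]

/-- Finiteness lets the extended quantity agree with the real-valued information. The densities are
at most `1 / P W`, and `klFun t ≤ 1 + t ^ 2`. -/
theorem mutualInformation_ne_top : mutualInformation P ≠ ⊤ := by
  refine ENNReal.sum_ne_top.2 fun W hW => ENNReal.mul_ne_top ENNReal.coe_ne_top ?_
  dsimp only
  rw [fDiv_of_ac (absolutelyContinuous_refMeasure hW)]
  refine ne_top_of_le_ne_top (b := ∫⁻ _, ENNReal.ofReal (1 + ((P W : ℝ≥0∞)⁻¹.toReal) ^ 2)
    ∂(refMeasure P)) ?_ (lintegral_mono_ae ?_)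
  · rw [lintegral_const]
    exact ENNReal.mul_ne_top ENNReal.ofReal_ne_top (measure_ne_top _ _)
  · filter_upwards [rnDeriv_refMeasure_le P hW] with y hy
    refine ENNReal.ofReal_le_ofReal ?_
    have hinv : (P W : ℝ≥0∞)⁻¹ ≠ ⊤ := by simpa using hW
    have h1 := ENNReal.toReal_mono hinv hy
    set t := ((W : Measure Y).rnDeriv (refMeasure P) y).toReal
    have ht : 0 ≤ t := ENNReal.toReal_nonneg
    have h2 : klFun t ≤ 1 + t ^ 2 := by
      rw [klFun_apply]
      rcases ht.eq_or_lt with h | h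
      · rw [← h]
        simp
      · nlinarith [mul_le_mul_of_nonneg_left (Real.log_le_sub_one_of_pos h) ht]
    have h3 := pow_le_pow_left₀ ht h1 2
    linarith

theorem information_one (hP : P ∈ pmfs (univ : Set (ProbabilityMeasure Y))) :
    (information 1 P : EReal) = mutualInformation P := by
  have h : information 1 P = (mutualInformation P).toReal := by
    rw [information, if_neg one_ne_zero, if_neg ENNReal.one_ne_top, if_pos rfl]
    simp only [posterior, meanMeasure_one hP]
    rw [mutualInformation, priorSum_fDiv_eq_lintegral measurable_klFun
      fun W => absolutelyContinuous_refMeasure]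
    have hterm : ∀ y, ∑ W ∈ P.support, (P W : ℝ≥0∞) * ENNReal.ofReal
        (klFun ((W : Measure Y).rnDeriv (refMeasure P) y).toReal) = ENNReal.ofReal
        (∑ W ∈ P.support, (P W : ℝ) * klFun ((W : Measure Y).rnDeriv (refMeasure P) y).toReal) :=
      fun y => sum_mul_ofReal P _ fun W _ => klFun_nonneg ENNReal.toReal_nonneg
    simp only [hterm]
    rw [← integral_eq_lintegral_of_nonneg_ae]
    · refine integral_congr_ae ?_
      filter_upwards [sum_rnDeriv_refMeasure hP] with y hy
      have e : ∑ W ∈ P.support, (P W : ℝ) *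
          klFun ((W : Measure Y).rnDeriv (refMeasure P) y).toReal =
          ∑ W ∈ P.support, ((P W : ℝ) * (((W : Measure Y).rnDeriv (refMeasure P) y).toReal *
            Real.log ((W : Measure Y).rnDeriv (refMeasure P) y).toReal) + (P W : ℝ) -
            (P W : ℝ) * ((W : Measure Y).rnDeriv (refMeasure P) y).toReal) :=
        Finset.sum_congr rfl fun W _ => by rw [klFun_apply]; ring
      rw [e, Finset.sum_sub_distrib, Finset.sum_add_distrib, hy.2, pmfs_sum_real hP,
        add_sub_cancel_right]
      refine Finset.sum_congr rfl fun W hW => ?_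
      have hPW : (P W : ℝ) ≠ 0 := by simpa using hW
      rw [mul_div_cancel_left₀ _ hPW, mul_assoc]
    · exact Eventually.of_forall fun y => Finset.sum_nonneg fun W _ =>
        mul_nonneg (P W).2 (klFun_nonneg ENNReal.toReal_nonneg)
    · exact (Finset.measurable_fun_sum _ fun W _ => (measurable_klFun.comp
        (Measure.measurable_rnDeriv _ _).ennreal_toReal).const_mul _).aestronglyMeasurable
  rw [h, EReal.coe_ennreal_toReal mutualInformation_ne_top]

theorem isScale_one : IsScale (Y := Y) 1 (fun x => (x : EReal))
    (fun W Q => fDiv klFun (W : Measure Y) Q) mutualInformation := by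
  refine isDivergenceKernel_klFun.isScale (c := 1 / 4) EReal.coe_ennreal_strictMono
    continuous_coe_ennreal_ereal EReal.coe_ennreal_top (fun P hP => information_one hP)
    (fun W Q => ?_) (fun P hP Q => ?_) (fun P hP Q => ?_) (fun P hP => ?_) (by norm_num)
    fun P hP => ?_
  · rw [fDiv_klFun]
    simp [divergence]
  · rw [meanMeasure_one hP]
    exact le_add_self.trans (mutualInformation_add_le hP Q)
  · rw [meanMeasure_one hP]
    exact le_add_self.trans (mutualInformation_add_le hP Q)
  · rw [mass_meanMeasure_one hP]
    exact le_self_add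
  · refine ⟨⟨refMeasure P, isProbabilityMeasure_refMeasure hP⟩, le_rfl, fun Q E hE => ?_⟩
    refine le_trans ?_ (mutualInformation_add_le hP Q)
    gcongr
    have := sq_sub_le_klDiv ⟨refMeasure P, isProbabilityMeasure_refMeasure hP⟩ Q hE
    have hprob := isProbabilityMeasure_refMeasure hP
    rw [ProbabilityMeasure.coe_mk, ← fDiv_klFun] at this
    rwa [one_div_mul_eq_div]

end One

end Renyi

/-! ### Finite orders above one -/

namespace Renyi

variable {Y : Type*} [MeasurableSpace Y] {𝒲 : Set (ProbabilityMeasure Y)}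
  {P : ProbabilityMeasure Y →₀ ℝ≥0}

/-! ### Finite orders greater than one -/

theorem ofReal_toReal_rpow {x : ℝ≥0∞} (hx : x ≠ ⊤) {p : ℝ} (hp : 0 ≤ p) :
    ENNReal.ofReal (x.toReal ^ p) = x ^ p := by
  rw [← ENNReal.ofReal_rpow_of_nonneg ENNReal.toReal_nonneg hp, ENNReal.ofReal_toReal hx]

theorem fDiv_rpow_of_ac {p : ℝ} (hp : 0 ≤ p) {μ ν : Measure Y} [IsFiniteMeasure μ]
    (h : μ ≪ ν) : fDiv (fun t => t ^ p) μ ν = ∫⁻ y, μ.rnDeriv ν y ^ p ∂ν := by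
  rw [fDiv_of_ac h]
  refine lintegral_congr_ae ?_
  filter_upwards [Measure.rnDeriv_lt_top μ ν] with y hy
  exact ofReal_toReal_rpow hy.ne hp

theorem powerMean_rpow {X : Type*} {P : X →₀ ℝ≥0} {p : ℝ} (hp : 0 < p) (g : X → ℝ≥0∞) :
    powerMean (ENNReal.ofReal p) P g ^ p = ∑ W ∈ P.support, (P W : ℝ≥0∞) * g W ^ p := by
  rw [powerMean_ofReal hp, ← ENNReal.rpow_mul, one_div_mul_cancel hp.ne', ENNReal.rpow_one]

/-- The `p`-th power of the order `p` mean is exactly the weighted sum of `p`-th powers, so the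
identity holds pointwise under the integral. -/
theorem fDiv_rpow_meanMeasure (hP : P ∈ pmfs (univ : Set (ProbabilityMeasure Y))) {p : ℝ}
    (hp : 0 < p) {ν : Measure Y} [SigmaFinite ν] (hac : ∀ W ∈ P.support, (W : Measure Y) ≪ ν) :
    fDiv (fun t => t ^ p) (meanMeasure (ENNReal.ofReal p) P : Measure Y) ν =
      priorSum P fun W => fDiv (fun t => t ^ p) (W : Measure Y) ν := by
  rw [meanMeasure_eq_withDensity hP _ ν hac, fDiv_withDensity
    (measurable_powerMean _ fun W => Measure.measurable_rnDeriv _ _),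
    priorSum_fDiv_eq_lintegral (by fun_prop) hac]
  refine lintegral_congr_ae ?_
  have h : ∀ᵐ y ∂ν, ∀ W ∈ P.support, (W : Measure Y).rnDeriv ν y < ⊤ :=
    (Finset.eventually_all P.support).2 fun W _ => Measure.rnDeriv_lt_top _ _
  filter_upwards [h] with y hy
  rw [ofReal_toReal_rpow (powerMean_lt_top _ P hy).ne hp.le, powerMean_rpow hp]
  exact Finset.sum_congr rfl fun W hW => by rw [ofReal_toReal_rpow (hy W hW).ne hp.le]

theorem fDiv_rpow_smul {p : ℝ} (hp : 0 < p) {μ ν : Measure Y} [IsFiniteMeasure μ]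
    [SigmaFinite ν] (c : ℝ≥0) (h : μ ≪ ν) :
    fDiv (fun t => t ^ p) (c • μ) ν = (c : ℝ≥0∞) ^ p * fDiv (fun t => t ^ p) μ ν := by
  rw [fDiv_rpow_of_ac hp.le (h.smul_left c), fDiv_rpow_of_ac hp.le h,
    ← lintegral_const_mul _ ((Measure.measurable_rnDeriv _ _).pow_const _)]
  refine lintegral_congr_ae ?_
  filter_upwards [Measure.rnDeriv_smul_left μ ν c] with y hy
  rw [hy, Pi.smul_apply, ENNReal.smul_def, smul_eq_mul, ENNReal.mul_rpow_of_nonneg _ _ hp.le]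

theorem fDiv_rpow_mono {p : ℝ} (hp : 0 ≤ p) {ν : Measure Y} [SigmaFinite ν] {f g : Y → ℝ≥0∞}
    (hf : Measurable f) (hg : Measurable g) (hfg : ∀ y, f y ≤ g y) (hgt : ∀ᵐ y ∂ν, g y ≠ ⊤) :
    fDiv (fun t => t ^ p) (ν.withDensity f) ν ≤ fDiv (fun t => t ^ p) (ν.withDensity g) ν := by
  rw [fDiv_withDensity hf, fDiv_withDensity hg]
  refine lintegral_mono_ae ?_
  filter_upwards [hgt] with y hy
  exact ENNReal.ofReal_le_ofReal (Real.rpow_le_rpow ENNReal.toReal_nonneg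
    (ENNReal.toReal_mono hy (hfg y)) hp)

theorem fDiv_rpow_meanMeasure_mono (hP : P ∈ pmfs (univ : Set (ProbabilityMeasure Y))) {p : ℝ}
    (hp : 0 ≤ p) {α β : ℝ≥0∞} (h : α ≤ β) {ν : Measure Y} [SigmaFinite ν]
    (hac : ∀ W ∈ P.support, (W : Measure Y) ≪ ν) :
    fDiv (fun t => t ^ p) (meanMeasure α P : Measure Y) ν ≤
      fDiv (fun t => t ^ p) (meanMeasure β P : Measure Y) ν := by
  rw [meanMeasure_eq_withDensity hP _ ν hac, meanMeasure_eq_withDensity hP _ ν hac]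
  refine fDiv_rpow_mono hp (measurable_powerMean _ fun W => Measure.measurable_rnDeriv _ _)
    (measurable_powerMean _ fun W => Measure.measurable_rnDeriv _ _)
    (fun y => powerMean_le_powerMean hP h _) ?_
  have hfin : ∀ᵐ y ∂ν, ∀ W ∈ P.support, (W : Measure Y).rnDeriv ν y < ⊤ :=
    (Finset.eventually_all P.support).2 fun W _ => Measure.rnDeriv_lt_top _ _
  filter_upwards [hfin] with y hy
  exact (powerMean_lt_top _ P hy).ne

/-- By `add_mul_klFun_le_rpow` a power lies above its tangent at one plus `(p - 1) * klFun`. The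
tangent integrates to one, and a tangent of `klFun` used on `E` alone adds the Pinsker term. -/
theorem one_add_sq_le_fDiv_rpow {p : ℝ} (hp : 1 < p) (μ ν : ProbabilityMeasure Y) {E : Set Y}
    (hE : MeasurableSet E) :
    ENNReal.ofReal (1 + (p - 1) / 4 * ((μ : Measure Y).real E - (ν : Measure Y).real E) ^ 2) ≤
      fDiv (fun t => t ^ p) (μ : Measure Y) ν := by
  set l := ((μ : Measure Y).real E - (ν : Measure Y).real E) / 2 with hl
  have hq := sq_div_four_le (x := (μ : Measure Y).real E) (y := (ν : Measure Y).real E)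
    measureReal_nonneg measureReal_le_one measureReal_nonneg measureReal_le_one
  rw [← hl] at hq
  have hb : ∀ a b : ℝ, ∀ y, |a + E.indicator (fun _ => b) y| ≤ |a| + |b| := fun a b y => by
    refine (abs_add_le _ _).trans (add_le_add_right ?_ _)
    by_cases hy : y ∈ E <;> simp [hy]
  have hint : ∀ (a b : ℝ) (V : ProbabilityMeasure Y),
      ∫ y, (a + E.indicator (fun _ => b) y) ∂(V : Measure Y) = a + b * (V : Measure Y).real E :=
    fun a b V => by
      rw [integral_add (integrable_const _) ((integrable_const _).indicator hE),
        integral_indicator_const _ hE]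
      simp [mul_comm]
  refine le_trans ?_ (ofReal_integral_add_le_fDiv
    (a := fun y => p + E.indicator (fun _ => (p - 1) * l) y)
    (b := fun y => (1 - p) + E.indicator (fun _ => (p - 1) * (1 - Real.exp l)) y)
    ((measurable_const.indicator hE).const_add _) ((measurable_const.indicator hE).const_add _)
    (C := max (|p| + |(p - 1) * l|) (|1 - p| + |(p - 1) * (1 - Real.exp l)|))
    (fun y => (hb _ _ y).trans (le_max_left _ _)) (fun y => (hb _ _ y).trans (le_max_right _ _))
    (fun y t ht => ?_))
  · rw [hint, hint]
    refine ENNReal.ofReal_le_ofReal ?_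
    nlinarith [mul_le_mul_of_nonneg_left hq (show 0 ≤ p - 1 by linarith)]
  · have h1 := add_mul_klFun_le_rpow hp ht
    by_cases hy : y ∈ E
    · simp only [hy, indicator_of_mem]
      have h2 := mul_le_mul_of_nonneg_left (mul_add_le_klFun l ht) (show 0 ≤ p - 1 by linarith)
      linarith
    · simp only [hy, not_false_eq_true, indicator_of_notMem]
      have h2 := mul_nonneg (show 0 ≤ p - 1 by linarith) (InformationTheory.klFun_nonneg ht)
      linarith

/-- When `W` is not absolutely continuous, the negative exponent `1 - p` makes the integrand
infinite where `Q` has density zero and `W` does not, matching the value `⊤` of `fDiv`. -/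
theorem lintegral_rnDeriv_rpow_mul {p : ℝ} (hp : 1 < p) (W Q : ProbabilityMeasure Y) :
    ∫⁻ y, (W : Measure Y).rnDeriv ((W : Measure Y) + Q) y ^ p *
      (Q : Measure Y).rnDeriv ((W : Measure Y) + Q) y ^ (1 - p) ∂((W : Measure Y) + (Q : Measure Y)) =
      fDiv (fun t => t ^ p) (W : Measure Y) Q := by
  set ν : Measure Y := (W : Measure Y) + Q
  have hp0 : 0 < p := by linarith
  have hWν : (W : Measure Y) ≪ ν :=
    Measure.absolutelyContinuous_of_le (Measure.le_add_right le_rfl)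
  have hQν : (Q : Measure Y) ≪ ν :=
    Measure.absolutelyContinuous_of_le (Measure.le_add_left le_rfl)
  have hWm : Measurable ((W : Measure Y).rnDeriv ν) := Measure.measurable_rnDeriv _ _
  have hQm : Measurable ((Q : Measure Y).rnDeriv ν) := Measure.measurable_rnDeriv _ _
  by_cases hac : (W : Measure Y) ≪ Q
  · rw [fDiv_rpow_of_ac hp0.le hac, ← lintegral_rnDeriv_mul hQν
      ((Measure.measurable_rnDeriv _ _).pow_const _).aemeasurable]
    refine lintegral_congr_ae ?_
    filter_upwards [Measure.rnDeriv_mul_rnDeriv (κ := ν) hac,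
      Measure.rnDeriv_lt_top (Q : Measure Y) ν] with y hy hyt
    rw [← hy, Pi.mul_apply]
    by_cases h0 : (Q : Measure Y).rnDeriv ν y = 0
    · simp [h0, hp0]
    · rw [ENNReal.mul_rpow_of_nonneg _ _ hp0.le, mul_assoc, ← ENNReal.rpow_add _ _ h0 hyt.ne,
        add_sub_cancel, ENNReal.rpow_one, mul_comm]
  · rw [fDiv, if_neg hac]
    by_contra hfin
    refine hac (Measure.AbsolutelyContinuous.mk fun E hE hQE => ?_)
    have h1 := ae_lt_top ((hWm.pow_const p).mul (hQm.pow_const (1 - p))) hfin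
    rw [← Measure.setLIntegral_rnDeriv hQν, lintegral_eq_zero_iff hQm] at hQE
    rw [← Measure.setLIntegral_rnDeriv hWν, lintegral_eq_zero_iff hWm]
    filter_upwards [hQE, ae_restrict_of_ae h1] with y hy1 hy2
    by_contra h0
    rw [Pi.zero_apply] at hy1 h0
    rw [Pi.mul_apply, hy1, ENNReal.zero_rpow_of_neg (by linarith), ENNReal.mul_top] at hy2
    · exact lt_irrefl _ hy2
    · simp [h0, hp0.le]

/-- Sibson's identity: writing the mean measure as its mass times a probability measure `q`, the
average of `d(·, Q)` is `mass ^ p * d(q, Q)`. It equals `mass ^ p` at `Q = q`, and since the mass is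
at least one the surplus elsewhere is at least the Pinsker term. -/
theorem isScale_ofReal {p : ℝ} (hp : 1 < p) :
    IsScale (Y := Y) (ENNReal.ofReal p) (fun x => ENNReal.log (x ^ (1 / (p - 1))))
      (fun W Q => fDiv (fun t => t ^ p) (W : Measure Y) Q)
      (fun P => ((meanMeasure (ENNReal.ofReal p) P).mass : ℝ≥0∞) ^ p) := by
  have hp0 : 0 < p := by linarith
  have hp1 : 0 < p - 1 := by linarith
  have hone : 1 ≤ ENNReal.ofReal p := by
    rw [← ENNReal.ofReal_one]
    exact ENNReal.ofReal_le_ofReal hp.le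
  have hM : ∀ P ∈ pmfs (univ : Set (ProbabilityMeasure Y)),
      (1 : ℝ≥0∞) ≤ (meanMeasure (ENNReal.ofReal p) P).mass := fun P hP => by
    exact_mod_cast one_le_mass hP hone
  refine (isDivergenceKernel_rpow hp).isScale (c := (p - 1) / 4)
    (ENNReal.log_strictMono.comp (ENNReal.strictMono_rpow_of_pos (by positivity)))
    (ENNReal.continuous_log.comp ENNReal.continuous_rpow_const) ?_ (fun P hP => ?_) (fun W Q => ?_)
    (fun P hP Q => ?_) (fun P hP Q => ?_) (fun P hP => ?_) (by positivity) fun P hP => ?_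
  · rw [ENNReal.top_rpow_of_pos (by positivity), ENNReal.log_top]
  · have hM0 : (meanMeasure (ENNReal.ofReal p) P).mass ≠ 0 :=
      (mass_pos hP (by simpa using hp0)).ne'
    rw [information_ofReal hp0 hp.ne', ← ENNReal.rpow_mul, ENNReal.log_rpow,
      ENNReal.log_of_nnreal hM0, ← EReal.coe_mul, mul_one_div]
  · rw [ENNReal.log_rpow, ← lintegral_rnDeriv_rpow_mul hp]
    have h1 : ENNReal.ofReal p ≠ 1 := by simpa using hp.ne'
    rw [divergence]
    rw [if_neg (by simpa using hp0), if_neg ENNReal.ofReal_ne_top, if_neg h1,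
      ENNReal.toReal_ofReal hp0.le]
  · exact priorSum_fDiv_le fun hac => (fDiv_rpow_meanMeasure hP hp0 hac).le
  · exact priorSum_fDiv_le fun hac => (fDiv_rpow_meanMeasure_mono hP hp0.le hone hac).trans
      (fDiv_rpow_meanMeasure hP hp0 hac).le
  · refine le_add_left ?_
    calc ((meanMeasure (ENNReal.ofReal p) P).mass : ℝ≥0∞)
        = ((meanMeasure (ENNReal.ofReal p) P).mass : ℝ≥0∞) ^ (1 : ℝ) := (ENNReal.rpow_one _).symm
      _ ≤ _ := ENNReal.rpow_le_rpow_of_exponent_le (hM P hP) hp.le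
  · set μ := meanMeasure (ENNReal.ofReal p) P
    have hM0 : μ.mass ≠ 0 := (mass_pos hP (by simpa using hp0)).ne'
    have hprob : IsProbabilityMeasure (μ.mass⁻¹ • (μ : Measure Y)) := ⟨by
      rw [Measure.smul_apply, ← FiniteMeasure.ennreal_mass, ENNReal.smul_def, smul_eq_mul,
        ← ENNReal.coe_mul, inv_mul_cancel₀ hM0, ENNReal.coe_one]⟩
    let q : ProbabilityMeasure Y := ⟨μ.mass⁻¹ • (μ : Measure Y), hprob⟩
    have hμq : (μ : Measure Y) = μ.mass • (q : Measure Y) := by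
      change _ = μ.mass • μ.mass⁻¹ • (μ : Measure Y)
      rw [smul_smul, mul_inv_cancel₀ hM0, one_smul]
    have hμacq : (μ : Measure Y) ≪ q := by
      rw [hμq]
      exact Measure.AbsolutelyContinuous.rfl.smul_left _
    refine ⟨q, ?_, fun Q E hE => priorSum_fDiv_le fun hac => ?_⟩
    · rw [← fDiv_rpow_meanMeasure hP hp0 fun W hW =>
        (absolutelyContinuous_meanMeasure hP (by simpa using hp0) hW).trans hμacq]
      change fDiv _ (μ : Measure Y) _ ≤ _
      rw [hμq, fDiv_rpow_smul hp0 _ Measure.AbsolutelyContinuous.rfl,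
        fDiv_rpow_of_ac hp0.le Measure.AbsolutelyContinuous.rfl]
      refine (mul_le_of_le_one_right' (le_of_eq ?_))
      rw [lintegral_congr_ae (g := fun _ => 1)]
      · simp
      · filter_upwards [Measure.rnDeriv_self (q : Measure Y)] with y hy
        rw [hy, ENNReal.one_rpow]
    · rw [← fDiv_rpow_meanMeasure hP hp0 hac]
      change _ ≤ fDiv _ (μ : Measure Y) _
      have hqQ : (q : Measure Y) ≪ Q := by
        refine Measure.AbsolutelyContinuous.trans (Measure.AbsolutelyContinuous.rfl.smul_left _) ?_
        rw [show (μ : Measure Y) = _ from meanMeasure_eq_withDensity hP _ (Q : Measure Y) hac]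
        exact withDensity_absolutelyContinuous _ _
      rw [hμq, fDiv_rpow_smul hp0 _ hqQ]
      have h1 := one_add_sq_le_fDiv_rpow hp q Q hE
      have hMp : (1 : ℝ≥0∞) ≤ (μ.mass : ℝ≥0∞) ^ p := ENNReal.one_le_rpow (hM P hP) hp0
      refine le_trans ?_ (mul_le_mul_right h1 _)
      rw [ENNReal.ofReal_add zero_le_one (by positivity), ENNReal.ofReal_one, mul_add, mul_one]
      exact add_le_add_right (le_mul_of_one_le_left' hMp) _

end Renyi

/-! ### Order infinity -/

namespace Renyi

variable {Y : Type*} [MeasurableSpace Y] {𝒲 : Set (ProbabilityMeasure Y)}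
  {P : ProbabilityMeasure Y →₀ ℝ≥0}

/-! ### Order infinity -/

/-- The essential supremum of the likelihood ratio of two probability measures. -/
def maxRatio (W Q : ProbabilityMeasure Y) : ℝ≥0∞ :=
  essSup (fun y => (W : Measure Y).rnDeriv ((W : Measure Y) + Q) y /
    (Q : Measure Y).rnDeriv ((W : Measure Y) + Q) y) ((W : Measure Y) + Q)

/-- The order relation `W ≤ K • Q` makes mixtures, setwise limits and least upper bounds immediate.
For `K = ⊤` it would mean absolute continuity, whereas the bound on `maxRatio` is vacuous. -/
theorem maxRatio_le_iff {W Q : ProbabilityMeasure Y} {K : ℝ≥0∞} (hK : K ≠ ⊤) :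
    maxRatio W Q ≤ K ↔ (W : Measure Y) ≤ K • (Q : Measure Y) := by
  set ν : Measure Y := (W : Measure Y) + Q with hν
  have hWν : (W : Measure Y) ≪ ν :=
    Measure.absolutelyContinuous_of_le (Measure.le_add_right le_rfl)
  have hQν : (Q : Measure Y) ≪ ν :=
    Measure.absolutelyContinuous_of_le (Measure.le_add_left le_rfl)
  have hiff : ∀ᵐ y ∂ν, (W : Measure Y).rnDeriv ν y / (Q : Measure Y).rnDeriv ν y ≤ K ↔
      (W : Measure Y).rnDeriv ν y ≤ K * (Q : Measure Y).rnDeriv ν y := by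
    filter_upwards [Measure.rnDeriv_lt_top (Q : Measure Y) ν] with y hy
    exact ENNReal.div_le_iff_le_mul (Or.inr hK) (Or.inl hy.ne)
  have hQm : Measurable fun y => K * (Q : Measure Y).rnDeriv ν y :=
    (Measure.measurable_rnDeriv _ _).const_mul K
  have hKQ : K • (Q : Measure Y) = ν.withDensity fun y => K * (Q : Measure Y).rnDeriv ν y := by
    conv_lhs => rw [← Measure.withDensity_rnDeriv_eq _ _ hQν]
    exact (withDensity_smul K (Measure.measurable_rnDeriv _ _)).symm
  constructor
  · intro h
    rw [hKQ, ← Measure.withDensity_rnDeriv_eq _ _ hWν]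
    refine withDensity_mono ?_
    filter_upwards [hiff, ENNReal.ae_le_essSup (μ := ν) fun y =>
      (W : Measure Y).rnDeriv ν y / (Q : Measure Y).rnDeriv ν y] with y hy1 hy2
    exact hy1.1 (hy2.trans h)
  · intro h
    refine essSup_le_of_ae_le K ?_
    have hle : (W : Measure Y).rnDeriv ν ≤ᵐ[ν] fun y => K * (Q : Measure Y).rnDeriv ν y := by
      refine ae_le_of_forall_setLIntegral_le_of_sigmaFinite (Measure.measurable_rnDeriv _ _)
        fun E hE _ => ?_
      rw [Measure.setLIntegral_rnDeriv hWν, ← withDensity_apply _ hE, ← hKQ]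
      exact h E
    filter_upwards [hiff, hle] with y hy1 hy2
    exact hy1.2 hy2

/-- With `le_meanMeasure_top` this identifies `μ_{∞,P}` as the least finite measure above the
support of `P`: relative to a dominating `ρ` all densities are at most one. -/
theorem meanMeasure_top_le (hP : P ∈ pmfs (univ : Set (ProbabilityMeasure Y))) {ρ : Measure Y}
    [IsFiniteMeasure ρ] (h : ∀ W ∈ P.support, (W : Measure Y) ≤ ρ) :
    (meanMeasure ⊤ P : Measure Y) ≤ ρ := by
  rw [meanMeasure_eq_withDensity hP ⊤ ρ fun W hW => Measure.absolutelyContinuous_of_le (h W hW)]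
  have h1 : ∀ᵐ y ∂ρ, ∀ W ∈ P.support, (W : Measure Y).rnDeriv ρ y ≤ 1 :=
    (Finset.eventually_all P.support).2 fun W hW => Measure.rnDeriv_le_one_of_le (h W hW)
  calc _ ≤ ρ.withDensity 1 := withDensity_mono (by
        filter_upwards [h1] with y hy
        rw [powerMean_top]
        exact iSup₂_le hy)
    _ = ρ := withDensity_one

theorem le_meanMeasure_top (hP : P ∈ pmfs (univ : Set (ProbabilityMeasure Y)))
    {W : ProbabilityMeasure Y} (hW : W ∈ P.support) :
    (W : Measure Y) ≤ meanMeasure ⊤ P := by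
  rw [meanMeasure_eq_withDensity hP ⊤ (refMeasure P) fun W => absolutelyContinuous_refMeasure,
    ← Measure.withDensity_rnDeriv_eq _ _ (absolutelyContinuous_refMeasure hW)]
  refine withDensity_mono (Eventually.of_forall fun y => ?_)
  dsimp only
  rw [powerMean_top]
  exact le_iSup₂ (f := fun (W : ProbabilityMeasure Y) (_ : W ∈ P.support) =>
    (W : Measure Y).rnDeriv (refMeasure P) y) W hW

theorem measureReal_sub_le_of_le {μ ρ : Measure Y} [IsFiniteMeasure μ] [IsFiniteMeasure ρ]
    (h : μ ≤ ρ) {E : Set Y} (hE : MeasurableSet E) :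
    ρ.real E - μ.real E ≤ ρ.real univ - μ.real univ := by
  have h1 : μ.real Eᶜ ≤ ρ.real Eᶜ := ENNReal.toReal_mono (measure_ne_top _ _) (h _)
  rw [measureReal_compl hE, measureReal_compl hE] at h1
  linarith

/-- The measures `μ_{∞,P}` of two priors that nearly maximise the mass are close. -/
theorem meanMeasure_top_sub_le {P P' : ProbabilityMeasure Y →₀ ℝ≥0} (hP : P ∈ pmfs 𝒲)
    (hP' : P' ∈ pmfs 𝒲) {K ε : ℝ} (hK : ∀ R ∈ pmfs 𝒲, ((meanMeasure ⊤ R).mass : ℝ) ≤ K)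
    (hPK : K - ε ≤ (meanMeasure ⊤ P).mass) {E : Set Y} (hE : MeasurableSet E) :
    (meanMeasure ⊤ P' : Measure Y).real E - (meanMeasure ⊤ P : Measure Y).real E ≤ ε := by
  have hR := mix_mem_pmfs hP hP' (add_halves (1 : ℝ≥0))
  set R := ((1 : ℝ≥0) / 2) • P + ((1 : ℝ≥0) / 2) • P' with hRdef
  have hsP : ∀ W ∈ P.support, W ∈ R.support := fun W hW => by
    have : P W ≠ 0 := by simpa using hW
    simp [hRdef, this]
  have hsP' : ∀ W ∈ P'.support, W ∈ R.support := fun W hW => by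
    have : P' W ≠ 0 := by simpa using hW
    simp [hRdef, this]
  have h1 : (meanMeasure ⊤ P : Measure Y) ≤ meanMeasure ⊤ R :=
    meanMeasure_top_le (pmfs_univ hP) fun W hW => le_meanMeasure_top (pmfs_univ hR) (hsP W hW)
  have h2 : (meanMeasure ⊤ P' : Measure Y) ≤ meanMeasure ⊤ R :=
    meanMeasure_top_le (pmfs_univ hP') fun W hW => le_meanMeasure_top (pmfs_univ hR) (hsP' W hW)
  have h3 := measureReal_sub_le_of_le h1 hE
  have h4 : (meanMeasure ⊤ P' : Measure Y).real E ≤ (meanMeasure ⊤ R : Measure Y).real E :=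
    ENNReal.toReal_mono (measure_ne_top _ _) (h2 _)
  have h5 : (meanMeasure ⊤ R : Measure Y).real univ ≤ K := hK R hR
  have h6 : K - ε ≤ (meanMeasure ⊤ P : Measure Y).real univ := hPK
  linarith

/-- There is no quadratic surplus here. If `P n` nearly maximises the mass, no other prior can
exceed `μ_{∞,P n}` by more than the deficit on any set. So the normalised measures are uniformly
Cauchy, and their limit `Q` satisfies `W ≤ K Q`. -/
theorem exists_unique_center_top (h𝒲 : 𝒲.Nonempty)
    (hK : ⨆ P ∈ pmfs 𝒲, ((meanMeasure ⊤ P).mass : ℝ≥0∞) ≠ ⊤) :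
    ∃ Q : ProbabilityMeasure Y,
      (∀ W ∈ 𝒲, maxRatio W Q ≤ ⨆ P ∈ pmfs 𝒲, ((meanMeasure ⊤ P).mass : ℝ≥0∞)) ∧
      ∀ R : ProbabilityMeasure Y,
        (∀ W ∈ 𝒲, maxRatio W R ≤ ⨆ P ∈ pmfs 𝒲, ((meanMeasure ⊤ P).mass : ℝ≥0∞)) → R = Q := by
  obtain ⟨K, hKdef⟩ : ∃ K : ℝ≥0, (K : ℝ≥0∞) = ⨆ P ∈ pmfs 𝒲, ((meanMeasure ⊤ P).mass : ℝ≥0∞) :=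
    ⟨_, ENNReal.coe_toNNReal hK⟩
  rw [← hKdef]
  have hFK : ∀ P ∈ pmfs 𝒲, (meanMeasure ⊤ P).mass ≤ K := fun P hP => by
    have := le_iSup₂ (f := fun P (_ : P ∈ pmfs 𝒲) => ((meanMeasure ⊤ P).mass : ℝ≥0∞)) P hP
    rw [← hKdef] at this
    exact_mod_cast this
  have hFK' : ∀ P ∈ pmfs 𝒲, ((meanMeasure ⊤ P).mass : ℝ) ≤ K := fun P hP => by
    exact_mod_cast hFK P hP
  have hM1 : ∀ P ∈ pmfs 𝒲, (1 : ℝ) ≤ (meanMeasure ⊤ P).mass := fun P hP => by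
    exact_mod_cast one_le_mass hP le_top
  have hK1 : (1 : ℝ) ≤ K := by
    obtain ⟨P, hP⟩ := pmfs_nonempty h𝒲
    exact (hM1 P hP).trans (hFK' P hP)
  have hexists : ∀ ε : ℝ, 0 < ε → ∃ P ∈ pmfs 𝒲, (K : ℝ) - ε ≤ (meanMeasure ⊤ P).mass := by
    intro ε hε
    by_contra! hcon
    have hle : (K : ℝ≥0∞) ≤ ENNReal.ofReal (K - ε) := by
      rw [hKdef]
      refine iSup₂_le fun P hP => ?_
      rw [← ENNReal.ofReal_coe_nnreal]
      exact ENNReal.ofReal_le_ofReal (hcon P hP).le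
    obtain ⟨P, hP⟩ := pmfs_nonempty h𝒲
    have h1 := hcon P hP
    have h3 := hM1 P hP
    have h2 := ENNReal.toReal_mono ENNReal.ofReal_ne_top hle
    rw [ENNReal.toReal_ofReal (by linarith), ENNReal.coe_toReal] at h2
    linarith
  have hpos : ∀ n : ℕ, (0 : ℝ) < (1 / 2) ^ n := fun n => by positivity
  choose P hP hPF using fun n : ℕ => hexists ((1 / 2) ^ n) (hpos n)
  have hpow2 : Tendsto (fun n : ℕ => (1 / 2 : ℝ) ^ n) atTop (𝓝 0) :=
    tendsto_pow_atTop_nhds_zero_of_lt_one (by norm_num) (by norm_num)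
  have hM0 : ∀ n, (meanMeasure ⊤ (P n)).mass ≠ 0 := fun n => (mass_pos (hP n) ENNReal.top_ne_zero).ne'
  have hprob : ∀ n, IsProbabilityMeasure
      ((meanMeasure ⊤ (P n)).mass⁻¹ • (meanMeasure ⊤ (P n) : Measure Y)) := fun n => ⟨by
    rw [Measure.smul_apply, ← FiniteMeasure.ennreal_mass, ENNReal.smul_def, smul_eq_mul,
      ← ENNReal.coe_mul, inv_mul_cancel₀ (hM0 n), ENNReal.coe_one]⟩
  let q : ℕ → ProbabilityMeasure Y := fun n =>
    ⟨(meanMeasure ⊤ (P n)).mass⁻¹ • (meanMeasure ⊤ (P n) : Measure Y), hprob n⟩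
  have hμ : ∀ n E, (meanMeasure ⊤ (P n) : Measure Y).real E =
      (meanMeasure ⊤ (P n)).mass * (q n : Measure Y).real E := fun n E => by
    change _ = _ * ((meanMeasure ⊤ (P n)).mass⁻¹ • (meanMeasure ⊤ (P n) : Measure Y)).real E
    rw [measureReal_nnreal_smul_apply, ← mul_assoc, ← NNReal.coe_mul, mul_inv_cancel₀ (hM0 n),
      NNReal.coe_one, one_mul]
  have hq01 : ∀ n E, 0 ≤ (q n : Measure Y).real E ∧ (q n : Measure Y).real E ≤ 1 := fun n E =>
    ⟨measureReal_nonneg, measureReal_le_one⟩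
  have hμq : ∀ n E, (K - (1 / 2) ^ n) * (q n : Measure Y).real E ≤
      (meanMeasure ⊤ (P n) : Measure Y).real E ∧
      (meanMeasure ⊤ (P n) : Measure Y).real E ≤ K * (q n : Measure Y).real E := fun n E => by
    rw [hμ]
    exact ⟨mul_le_mul_of_nonneg_right (hPF n) (hq01 n E).1,
      mul_le_mul_of_nonneg_right (hFK' _ (hP n)) (hq01 n E).1⟩
  have hcauchy : ∀ ε : ℝ, 0 < ε → ∃ N, ∀ n ≥ N, ∀ m ≥ N, ∀ E : Set Y, MeasurableSet E →
      |(q n : Measure Y).real E - (q m : Measure Y).real E| ≤ ε := by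
    intro ε hε
    obtain ⟨N, hN⟩ := exists_pow_lt_of_lt_one (show 0 < ε / 2 by positivity)
      (show (1 / 2 : ℝ) < 1 by norm_num)
    have hone : ∀ n ≥ N, ∀ m ≥ N, ∀ E : Set Y, MeasurableSet E →
        (q n : Measure Y).real E - (q m : Measure Y).real E ≤ ε := by
      intro n hn m hm E hE
      have hpn : (1 / 2 : ℝ) ^ n ≤ (1 / 2) ^ N := pow_le_pow_of_le_one (by norm_num) (by norm_num) hn
      have hpm : (1 / 2 : ℝ) ^ m ≤ (1 / 2) ^ N := pow_le_pow_of_le_one (by norm_num) (by norm_num) hm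
      -- The chain is `(K - 2⁻ⁿ) q_n E ≤ μ_n E ≤ μ_m E + 2⁻ᵐ ≤ K q_m E + 2⁻ᵐ`; since `K ≥ 1` the
      -- difference of the `q`'s is at most `2⁻ⁿ + 2⁻ᵐ`.
      have h1 := meanMeasure_top_sub_le (hP m) (hP n) hFK' (hPF m) hE
      have h2 := (hμq n E).1
      have h3 := (hμq m E).2
      have h4 := mul_le_mul_of_nonneg_left (hq01 n E).2 (hpos n).le
      have h5 : K * ((q n : Measure Y).real E - (q m : Measure Y).real E) ≤ ε := by nlinarith
      by_contra! hcon
      nlinarith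
    refine ⟨N, fun n hn m hm E hE => abs_le.2 ⟨?_, hone n hn m hm E hE⟩⟩
    linarith [hone m hm n hn E hE]
  obtain ⟨Q, hQ⟩ := exists_tendsto_of_uniformCauchy q hcauchy
  have hle_iff : ∀ V R : ProbabilityMeasure Y, (V : Measure Y) ≤ (K : ℝ≥0∞) • (R : Measure Y) ↔
      ∀ E, MeasurableSet E → (V : Measure Y).real E ≤ K * (R : Measure Y).real E := fun V R => by
    rw [Measure.le_iff]
    refine forall₂_congr fun E hE => ?_
    rw [Measure.smul_apply, smul_eq_mul, ← ENNReal.toReal_le_toReal (measure_ne_top _ _)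
      (ENNReal.mul_ne_top ENNReal.coe_ne_top (measure_ne_top _ _)), ENNReal.toReal_mul,
      ENNReal.coe_toReal]
    rfl
  refine ⟨Q, fun W hW => ?_, fun R hR => ?_⟩
  · rw [maxRatio_le_iff ENNReal.coe_ne_top, hle_iff]
    intro E hE
    have hlim := ((hQ E hE).const_mul (K : ℝ)).add hpow2
    rw [add_zero] at hlim
    refine ge_of_tendsto hlim ?_
    refine Eventually.of_forall fun n => ?_
    have h1 := meanMeasure_top_sub_le (hP n) (single_mem_pmfs hW) hFK' (hPF n) hE
    have h2 : (W : Measure Y) ≤ meanMeasure ⊤ (Finsupp.single W 1) :=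
      le_meanMeasure_top (pmfs_univ (single_mem_pmfs hW)) (by simp)
    have h3 : (W : Measure Y).real E ≤ (meanMeasure ⊤ (Finsupp.single W 1) : Measure Y).real E :=
      ENNReal.toReal_mono (measure_ne_top _ _) (h2 _)
    linarith [(hμq n E).2]
  -- A competing center `R` satisfies `μ_n ≤ K R`, hence `Q ≤ R` in the limit. For probability
  -- measures, comparison on complements upgrades this to equality.
  · have hle : ∀ E, MeasurableSet E → (Q : Measure Y).real E ≤ (R : Measure Y).real E := by
      intro E hE
      have h1 : ∀ n, (K - (1 / 2) ^ n) * (q n : Measure Y).real E ≤ K * (R : Measure Y).real E := by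
        intro n
        refine (hμq n E).1.trans ?_
        have h2 : (meanMeasure ⊤ (P n) : Measure Y) ≤ K • (R : Measure Y) :=
          meanMeasure_top_le (pmfs_univ (hP n)) fun W hW =>
            (maxRatio_le_iff ENNReal.coe_ne_top).1 (hR W ((hP n).1 hW))
        refine (ENNReal.toReal_mono (measure_ne_top _ _) (h2 E)).trans (le_of_eq ?_)
        exact measureReal_nnreal_smul_apply _
      have h2 : Tendsto (fun n => (K - (1 / 2) ^ n) * (q n : Measure Y).real E) atTop
          (𝓝 (K * (Q : Measure Y).real E)) := by
        simpa using (hpow2.const_sub (K : ℝ)).mul (hQ E hE)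
      exact le_of_mul_le_mul_left (le_of_tendsto' h2 h1) (by linarith)
    refine eq_of_measureReal_eq fun E hE => le_antisymm ?_ (hle E hE)
    have h1 := hle Eᶜ hE.compl
    rw [probReal_compl_eq_one_sub hE, probReal_compl_eq_one_sub hE] at h1
    linarith

theorem isScale_top : IsScale (Y := Y) ⊤ ENNReal.log maxRatio
    (fun P => ((meanMeasure ⊤ P).mass : ℝ≥0∞)) where
  strictMono := ENNReal.log_strictMono
  continuous := ENNReal.continuous_log
  map_top := ENNReal.log_top
  information_eq P hP := by
    rw [information_top, ENNReal.log_of_nnreal (mass_pos hP ENNReal.top_ne_zero).ne']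
  divergence_eq W Q := by
    rw [divergence, if_neg ENNReal.top_ne_zero, if_pos rfl]
    rfl
  exists_le P hP Q := by
    obtain ⟨W, hW, hmax⟩ := P.support.exists_max_image (fun W => maxRatio W Q)
      (pmfs_support_nonempty hP)
    refine ⟨W, hW, ?_⟩
    rcases eq_or_ne (maxRatio W Q) ⊤ with h | h
    · rw [h]
      exact le_top
    have hfin : IsFiniteMeasure (maxRatio W Q • (Q : Measure Y)) := ⟨by
      rw [Measure.smul_apply, measure_univ, smul_eq_mul, mul_one]
      exact h.lt_top⟩
    have h1 := meanMeasure_top_le hP (ρ := maxRatio W Q • (Q : Measure Y)) fun V hV =>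
      (maxRatio_le_iff h).1 (hmax V hV)
    have h2 := h1 univ
    rwa [← FiniteMeasure.ennreal_mass, Measure.smul_apply, measure_univ, smul_eq_mul, mul_one] at h2
  closed H _ W Q K hH hK := by
    rcases eq_or_ne K ⊤ with rfl | h
    · exact le_top
    rw [maxRatio_le_iff h, Measure.le_iff]
    intro E hE
    refine le_of_tendsto (hH E hE) ?_
    filter_upwards [hK] with V hV
    exact (maxRatio_le_iff h).1 hV E
  convex P hP V Q hV K hK := by
    rcases eq_or_ne K ⊤ with rfl | h
    · exact le_top
    have hV' : (V : Measure Y) = (meanMeasure 1 P : Measure Y) := congrArg Subtype.val hV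
    have hfin : IsFiniteMeasure (K • (Q : Measure Y)) := ⟨by
      rw [Measure.smul_apply, measure_univ, smul_eq_mul, mul_one]
      exact h.lt_top⟩
    rw [maxRatio_le_iff h, hV']
    exact (meanMeasure_mono hP le_top).trans
      (meanMeasure_top_le hP fun W hW => (maxRatio_le_iff h).1 (hK W hW))
  uac 𝒱 Q K hK h := by
    have hfin : IsFiniteMeasure (K • (Q : Measure Y)) := ⟨by
      rw [Measure.smul_apply, measure_univ, smul_eq_mul, mul_one]
      exact hK.lt_top⟩
    lift K to ℝ≥0 using hK
    intro ε hε
    refine ⟨ε / (K + 1), by positivity, ?_⟩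
    rintro _ ⟨α, hα, P, hP, rfl⟩ E hE hQE
    have h1 : (meanMeasure α P : Measure Y) ≤ (K : ℝ≥0∞) • (Q : Measure Y) :=
      (meanMeasure_mono hP hα).trans (meanMeasure_top_le (pmfs_univ hP) fun W hW =>
        (maxRatio_le_iff ENNReal.coe_ne_top).1 (h W (hP.1 hW)))
    have h2 := h1 E
    rw [← ENNReal.coe_lt_coe, FiniteMeasure.ennreal_coeFn_eq_coeFn_toMeasure]
    refine h2.trans_lt ?_
    rw [Measure.smul_apply, smul_eq_mul]
    calc (K : ℝ≥0∞) * (Q : Measure Y) E ≤ (K : ℝ≥0∞) * (ε / (K + 1) : ℝ≥0) := by gcongr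
      _ = (K * (ε / (K + 1)) : ℝ≥0) := (ENNReal.coe_mul _ _).symm
      _ < ε := by
        rw [ENNReal.coe_lt_coe, mul_div_assoc', div_lt_iff₀ (by positivity), mul_comm]
        exact mul_lt_mul_of_pos_left (lt_add_one K) hε
  mass_le P hP := le_add_self
  center 𝒱 h𝒱 hK := exists_unique_center_top h𝒱 hK

end Renyi

/-! ### Capacities of the hull and the closure at all orders -/

namespace Renyi

variable {Y : Type*} [MeasurableSpace Y] {𝒲 : Set (ProbabilityMeasure Y)}
  {P : ProbabilityMeasure Y →₀ ℝ≥0}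

/-! ### Convex hulls and closures -/

theorem subset_convHull : 𝒲 ⊆ convHull 𝒲 := fun W hW => by
  refine ⟨Finsupp.single W 1, single_mem_pmfs hW, Subtype.ext ?_⟩
  change (W : Measure Y) = (meanMeasure 1 (Finsupp.single W 1) : Measure Y)
  rw [meanMeasure_one (single_mem_pmfs hW)]
  simp [refMeasure]

/-- The prior obtained by drawing `V` from `P` and then an element from `T V`. -/
def composePrior {X : Type*} (P : X →₀ ℝ≥0) (T : X → X →₀ ℝ≥0) : X →₀ ℝ≥0 :=
  ∑ V ∈ P.support, P V • T V

theorem priorSum_composePrior {X : Type*} (P : X →₀ ℝ≥0) (T : X → X →₀ ℝ≥0) (d : X → ℝ≥0∞) :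
    priorSum (composePrior P T) d = ∑ V ∈ P.support, (P V : ℝ≥0∞) * priorSum (T V) d := by
  classical
  have hzero : priorSum (0 : X →₀ ℝ≥0) d = 0 := by simp [priorSum]
  have hadd : ∀ Q R : X →₀ ℝ≥0, priorSum (Q + R) d = priorSum Q d + priorSum R d := fun Q R => by
    simpa using priorSum_mix Q R 1 1 d
  have hsmul : ∀ (s : ℝ≥0) (Q : X →₀ ℝ≥0), priorSum (s • Q) d = s * priorSum Q d := fun s Q => by
    simpa [hzero] using priorSum_mix Q 0 s 0 d
  unfold composePrior
  induction P.support using Finset.induction_on with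
  | empty => simp [hzero]
  | insert V s hV ih => rw [Finset.sum_insert hV, Finset.sum_insert hV, hadd, hsmul, ih]

theorem composePrior_mem_pmfs {X : Type*} {A B : Set X} {P : X →₀ ℝ≥0} (hP : P ∈ pmfs A)
    {T : X → X →₀ ℝ≥0} (hT : ∀ V ∈ P.support, T V ∈ pmfs B) : composePrior P T ∈ pmfs B := by
  classical
  constructor
  · intro W hW
    obtain ⟨V, hV, hWV⟩ := Finset.mem_biUnion.1
      (Finsupp.support_finsetSum (Finset.mem_coe.1 hW))
    exact (hT V hV).1 (Finsupp.support_smul hWV)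
  · have h := priorSum_composePrior P T fun _ => 1
    have h1 : ∀ V ∈ P.support, priorSum (T V) (fun _ => 1) = 1 := fun V hV => by
      simpa [priorSum] using pmfs_sum_ennreal (hT V hV)
    rw [Finset.sum_congr rfl fun V hV => by rw [h1 V hV, mul_one], pmfs_sum_ennreal hP] at h
    simp only [priorSum, mul_one] at h
    exact_mod_cast h

theorem support_subset_composePrior {X : Type*} (P : X →₀ ℝ≥0) (T : X → X →₀ ℝ≥0) {V W : X}
    (hV : V ∈ P.support) (hW : W ∈ (T V).support) : W ∈ (composePrior P T).support := by
  rw [Finsupp.mem_support_iff, composePrior, Finsupp.finsetSum_apply]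
  refine fun h0 => ?_
  have := (Finset.sum_eq_zero_iff.1 h0) V hV
  simp only [Finsupp.smul_apply, smul_eq_mul, mul_eq_zero] at this
  rcases this with h | h
  · exact (Finsupp.mem_support_iff.1 hV) h
  · exact (Finsupp.mem_support_iff.1 hW) h

theorem sum_rpow_le_rpow_sum {X : Type*} {A : Set X} {P : X →₀ ℝ≥0} (hP : P ∈ pmfs A) {a : ℝ}
    (ha : 0 < a) (ha1 : a < 1) (t : X → ℝ≥0∞) :
    priorSum P (fun W => t W ^ a) ≤ priorSum P t ^ a := by
  have h := powerMean_le_powerMean hP (α := ENNReal.ofReal a) (β := 1) (by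
    rw [← ENNReal.ofReal_one]
    exact ENNReal.ofReal_le_ofReal ha1.le) t
  rw [powerMean_one] at h
  have h2 := ENNReal.rpow_le_rpow h ha.le
  rwa [powerMean_rpow ha] at h2

/-- Each member of the hull is resolved into its own prior and the priors are composed. Concavity of
`t ^ a` shows that this can only lower the mass, and since `a / (a - 1)` is negative the information
can only grow. -/
theorem capacity_convHull_of_lt_one {a : ℝ} (ha : 0 < a) (ha1 : a < 1) :
    capacity (ENNReal.ofReal a) (convHull 𝒲) ≤ capacity (ENNReal.ofReal a) 𝒲 := by
  refine iSup₂_le fun P hP => ?_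
  have hchoose : ∀ V, ∃ R : ProbabilityMeasure Y →₀ ℝ≥0, V ∈ P.support →
      R ∈ pmfs 𝒲 ∧ V.toFiniteMeasure = meanMeasure 1 R := fun V => by
    by_cases hV : V ∈ P.support
    · obtain ⟨R, hR, hVR⟩ := hP.1 hV
      exact ⟨R, fun _ => ⟨hR, hVR⟩⟩
    · exact ⟨0, fun h => absurd h hV⟩
  choose T hT using hchoose
  have hQ : composePrior P T ∈ pmfs 𝒲 := composePrior_mem_pmfs hP fun V hV => (hT V hV).1
  set Q := composePrior P T with hQdef
  refine le_trans ?_ (le_capacity hQ _)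
  rw [information_ofReal ha ha1.ne, information_ofReal ha ha1.ne, EReal.coe_le_coe_iff]
  refine mul_le_mul_of_nonpos_left ?_ (div_nonpos_of_nonneg_of_nonpos ha.le (by linarith))
  have hM : 0 < (meanMeasure (ENNReal.ofReal a) Q).mass := mass_pos hQ (by simpa using ha)
  refine Real.log_le_log (by exact_mod_cast hM) ?_
  rw [NNReal.coe_le_coe, ← ENNReal.coe_le_coe]
  set ν := refMeasure Q
  have hWν : ∀ W ∈ Q.support, (W : Measure Y) ≪ ν := fun W => absolutelyContinuous_refMeasure
  have hTν : ∀ V ∈ P.support, ∀ W ∈ (T V).support, (W : Measure Y) ≪ ν := fun V hV W hW =>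
    hWν W (support_subset_composePrior P T hV hW)
  have hVT : ∀ V ∈ P.support, (V : Measure Y) =
      ν.withDensity fun y => powerMean 1 (T V) fun W => (W : Measure Y).rnDeriv ν y := fun V hV => by
    rw [← meanMeasure_eq_withDensity (hT V hV).1 1 ν (hTν V hV)]
    exact congrArg Subtype.val (hT V hV).2
  have hVν : ∀ V ∈ P.support, (V : Measure Y) ≪ ν := fun V hV => by
    rw [hVT V hV]
    exact withDensity_absolutelyContinuous _ _
  have hdens : ∀ᵐ y ∂ν, ∀ V ∈ P.support, (V : Measure Y).rnDeriv ν y =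
      priorSum (T V) fun W => (W : Measure Y).rnDeriv ν y := by
    refine (Finset.eventually_all P.support).2 fun V hV => ?_
    have h := Measure.rnDeriv_withDensity ν
      (measurable_powerMean 1 (P := T V) fun W => Measure.measurable_rnDeriv (W : Measure Y) ν)
    rw [← hVT V hV] at h
    filter_upwards [h] with y hy
    rw [hy, powerMean_one]
    rfl
  rw [meanMeasure_mass hP _ ν hVν, meanMeasure_mass hQ _ ν hWν]
  refine lintegral_mono_ae ?_
  filter_upwards [hdens] with y hy
  rw [powerMean_ofReal ha, powerMean_ofReal ha]
  refine ENNReal.rpow_le_rpow ?_ (by positivity)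
  calc ∑ W ∈ Q.support, (Q W : ℝ≥0∞) * (W : Measure Y).rnDeriv ν y ^ a
      = ∑ V ∈ P.support, (P V : ℝ≥0∞) *
          priorSum (T V) fun W => (W : Measure Y).rnDeriv ν y ^ a :=
        priorSum_composePrior P T _
    _ ≤ ∑ V ∈ P.support, (P V : ℝ≥0∞) * (V : Measure Y).rnDeriv ν y ^ a := by
        refine Finset.sum_le_sum fun V hV => ?_
        gcongr
        rw [hy V hV]
        exact sum_rpow_le_rpow_sum (hT V hV).1 ha ha1 _

theorem exists_isScale {ϑ : ℝ≥0∞} (hϑ : 1 ≤ ϑ) :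
    ∃ (G : ℝ≥0∞ → EReal) (d : ProbabilityMeasure Y → ProbabilityMeasure Y → ℝ≥0∞)
      (F : (ProbabilityMeasure Y →₀ ℝ≥0) → ℝ≥0∞), IsScale ϑ G d F := by
  rcases ennreal_cases ϑ with rfl | rfl | ⟨p, hp, rfl⟩
  · simp at hϑ
  · exact ⟨_, _, _, isScale_top⟩
  rw [← ENNReal.ofReal_one, ENNReal.ofReal_le_ofReal_iff hp.le] at hϑ
  rcases hϑ.eq_or_lt with rfl | h
  · rw [ENNReal.ofReal_one]
    exact ⟨_, _, _, isScale_one⟩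
  · exact ⟨_, _, _, isScale_ofReal h⟩

theorem order_cases {α : ℝ≥0∞} (hα : 0 < α) :
    1 ≤ α ∨ ∃ a : ℝ, 0 < a ∧ a < 1 ∧ α = ENNReal.ofReal a := by
  rcases ennreal_cases α with rfl | rfl | ⟨a, ha, rfl⟩
  · exact absurd hα (lt_irrefl _)
  · exact Or.inl le_top
  · rcases lt_or_ge a 1 with h | h
    · exact Or.inr ⟨a, ha, h, rfl⟩
    · left
      rw [← ENNReal.ofReal_one]
      exact ENNReal.ofReal_le_ofReal h

theorem capacity_convHull (h𝒲 : 𝒲.Nonempty) {α : ℝ≥0∞} (hα : 0 < α) :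
    capacity α (convHull 𝒲) = capacity α 𝒲 := by
  refine le_antisymm ?_ (capacity_mono α subset_convHull)
  rcases order_cases hα with h | ⟨a, ha, ha1, rfl⟩
  · obtain ⟨G, d, F, hscale⟩ := exists_isScale (Y := Y) h
    exact hscale.capacity_convHull_le h𝒲
  · exact capacity_convHull_of_lt_one ha ha1

/-- A finer topology has smaller closures, so its closure lies between `𝒲` and the setwise closure.
-/
theorem capacity_closure (h𝒲 : 𝒲.Nonempty) {t : TopologicalSpace (ProbabilityMeasure Y)}
    (ht : t ≤ setwiseTopologyProb Y) {α : ℝ≥0∞} (hα : 0 < α) :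
    capacity α (@closure _ t 𝒲) = capacity α 𝒲 := by
  refine le_antisymm ?_ (capacity_mono α (@subset_closure _ t 𝒲))
  refine (capacity_mono α (closure.mono ht)).trans ?_
  rcases order_cases hα with h | ⟨a, ha, ha1, rfl⟩
  · obtain ⟨G, d, F, hscale⟩ := exists_isScale (Y := Y) h
    exact hscale.capacity_closure_le h𝒲
  · exact capacity_closure_of_lt_one ha ha1

end Renyi

end

theorem mainTheorem7 {Y : Type*} [MeasurableSpace Y] (𝒲 : Set (ProbabilityMeasure Y))
    (h𝒲 : 𝒲.Nonempty) :
    (∀ α : ℝ≥0∞, 0 < α → Renyi.capacity α (Renyi.convHull 𝒲) = Renyi.capacity α 𝒲) ∧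
    (∀ t : TopologicalSpace (ProbabilityMeasure Y), t ≤ Renyi.setwiseTopologyProb Y →
      ∀ α : ℝ≥0∞, 0 < α → Renyi.capacity α (@closure _ t 𝒲) = Renyi.capacity α 𝒲) ∧
    (∀ ϑ : ℝ≥0∞, 1 ≤ ϑ → Renyi.capacity ϑ 𝒲 < ⊤ →
      (∃! q : ProbabilityMeasure Y, Renyi.IsCenter ϑ 𝒲 q) ∧
      (∀ q : ProbabilityMeasure Y, Renyi.IsCenter ϑ 𝒲 q →
        Renyi.UAC (Renyi.meanMeasures ϑ 𝒲) q) ∧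
      Renyi.RelativelyCompact (Renyi.setwiseTopology Y) (Renyi.meanMeasures ϑ 𝒲) ∧
      Renyi.RelativelyCompact (Renyi.weakTopology Y) (Renyi.meanMeasures ϑ 𝒲)) ∧
    [Tendsto (fun α : ℝ => (((1 - α) / α : ℝ) : EReal) * Renyi.capacity (ENNReal.ofReal α) 𝒲)
        (𝓝[<] 1) (𝓝 0),
      ∃ m : ProbabilityMeasure Y, Renyi.UAC (ProbabilityMeasure.toFiniteMeasure '' 𝒲) m,
      Renyi.RelativelyCompact (Renyi.setwiseTopology Y) (ProbabilityMeasure.toFiniteMeasure '' 𝒲),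
      Renyi.RelativelyCompact (Renyi.weakTopology Y)
        (ProbabilityMeasure.toFiniteMeasure '' 𝒲)].TFAE := by
  refine ⟨fun α hα => Renyi.capacity_convHull h𝒲 hα,
    fun t ht α hα => Renyi.capacity_closure h𝒲 ht hα, fun ϑ hϑ hC => ?_,
    Renyi.equicontinuity_tfae h𝒲⟩
  obtain ⟨G, d, F, hscale⟩ := Renyi.exists_isScale (Y := Y) hϑ
  exact hscale.compactness h𝒲 hC
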